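/- Let $1\le m<N$, $\hbar>0$, $\lambda=(\lambda_1,\dots,\lambda_N)\in\mathbb R^N$, put $\rho_n=\frac{N+1-2n}{2}$, $\mu_n=\imath\lambda_n-\rho_n$, and assume $\lambda_j\neq0$ for $\frac{N+3}{2}\le j\le N$. **Gauss–Givental realization.** On entire functions of the variables $x_{n,i}$, $1\le i\le n\le N-1$, with $x_{N,i}=0$ and with $\partial/\partial x_{n,i}$ read as $0$ if there is no such variable, let $$E_{ii}=\mu_i-\sum_{k=1}^{i-1}\frac{\partial}{\partial x_{N+k-i,k}}+\sum_{k=i}^{N-1}\frac{\partial}{\partial x_{k,i}},\qquad E_{i,i+1}=-\sum_{n=1}^{i}e^{x_{N-1-i+n,n}-x_{N-i+n,n}}\sum_{k=1}^n\Big(\frac{\partial}{\partial x_{N-1-i+k,k}}-\frac{\partial}{\partial x_{N-1-i+k,k-1}}\Big),$$ $$E_{i+1,i}=\sum_{n=1}^{N-i}e^{x_{n+i,i+1}-x_{n+i-1,i}}\Big[\mu_i-\mu_{i+1}+\sum_{k=1}^n\Big(\frac{\partial}{\partial x_{i+k-1,i}}-\frac{\partial}{\partial x_{i+k-1,i+1}}\Big)\Big],$$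 and let the other $E_{ij}$ be the iterated commutators of these. Let $H_1=E_{11}+\dots+E_{mm}$, $H_i=E_{i,1}$ for $2\le i\le m$, $H_j=E_{j,N}$ for $m+1\le j\le N-1$, $H_N=E_{m+1,m+1}+\dots+E_{NN}$. Put $\pi(\exp X)\phi=\sum_k\frac1{k!}X^k\phi$ and $g(x)=\exp\sum_i x_iH_i$. **Whittaker vectors.** Let $C_l=\prod_{l\le i<j\le N}\hbar^{\rho_i-\imath\lambda_j}\Gamma(\rho_i-\imath\lambda_j)$ and $$\psi_L=\frac1{C_{N-m+1}}\exp\Big\{-\sum_{n=1}^{N-1}(\mu_n-\mu_{n+1})\sum_{i=1}^nx_{n,i}+\sum_{k=1}^{m-1}\mu_{N-k}x_{N-k,1}-\frac1\hbar\Big(e^{x_{N-m,1}}+\sum_{k=1}^m\sum_{i=1}^{N-m-1}e^{x_{i+k-1,k}-x_{i+k,k}}+\sum_{k=m+1}^{N-1}\Big[e^{x_{N-1,k}}+\sum_{i=1}^{N-k-1}e^{x_{i+k-1,k}-x_{i+k,k}}\Big]\Big)\Big\},$$ $$\psi_R=\frac1{C_{m+1}}\exp\Big\{-\sum_{k=m+1}^{N-1}\mu_kx_{k,k}-\frac1\hbar\Big(e^{-x_{m,m}}+\sum_{k=1}^{N-m}\sum_{i=1}^{m-1}e^{x_{k+i,i+1}-x_{k+i-1,i}}+\sum_{k=1}^{m-1}\Big[e^{-x_{N-1,k}}+\sum_{i=1}^{k-1}e^{x_{N-k+i,i+1}-x_{N-k+i-1,i}}\Big]\Big)\Big\}.$$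 **Contours.** A contour for an integrand $f$ on $\mathbb C^d$ whose phase contains the exponentials $e^{\ell_a}$, $a\in A$, is a set $\{s+\imath\eta(s):s\in\mathbb R^d\}$ with $\eta:\mathbb R^d\to\mathbb R^d$ smooth with bounded derivative, such that $\mathrm{Re}\,e^{\ell_a(s+\imath t\eta(s))}$ is bounded below uniformly in $a\in A$, $0\le t\le1$, $s\in\mathbb R^d$ (the deformation is slight), and $|f(s+\imath\eta(s))|\le Ke^{-c|s|}$ for some $K$ and $c>0$. **Whittaker function.** Let $$\Psi^{(m,N)}_\lambda(x_1,\dots,x_N)=e^{x_1\frac{m(N-m)}2}\langle\psi_L,\pi(g(x))\psi_R\rangle,\qquad\langle\phi_1,\phi_2\rangle=\int_{\mathcal C}\prod_{1\le i\le n\le N-1}e^{-x_{n,i}}dx_{n,i}\;\overline{\phi_1}\,\phi_2 ,$$ where $\overline{\phi_1}$ is continued analytically from real arguments and $\mathcal C\subset\mathbb C^{N(N-1)/2}$ is a contour for the integrand of $\langle\psi_L,\pi(g(x))\psi_R\rangle$ and the exponentials in $\psi_L$ and $\psi_R$. **Theorem.** (i) $\psi_L,\psi_R$ are nonzero entire functions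 and are $\mathrm{Gr}_{m,N}$-Whittaker vectors: $E_{m+1,1}\psi_L=-\hbar^{-1}\psi_L$; $E_{ki}\psi_L=0$ for $2\le i\le m$, $i\le k\le N$; $E_{j+1,j}\psi_L=-\hbar^{-1}\psi_L$ for $m+1\le j\le N-1$; and $E_{i-1,i}\psi_R=-\hbar^{-1}\psi_R$ for $2\le i\le m$; $E_{kj}\psi_R=0$ for $m+1\le j\le N-1$, $1\le k\le j$; $E_{m,N}\psi_R=-\hbar^{-1}\psi_R$. (ii) Let $x_{N,1}\in\mathbb R$ and, in the variables of $$\omega_{m,N}=\prod_{n=1}^{N-m}\prod_{k=1}^{\min(n,m)}dx_{n,k}\cdot\prod_{n=1}^{m-1}\prod_{i=n+1}^{\min(N-m+n,m)}dx_{N-m+n,i},$$ let $$\mathcal F_{m,N}=\imath\Big(\sum_{k=1}^m\lambda_{N-m+k}\Big)x_{N,1}+\imath\sum_{n=1}^{N-m}(\lambda_n-\lambda_{n+1})\sum_{i=1}^{\min(m,n)}x_{n,i}+\imath\sum_{n=1}^{m-1}(\lambda_{N-m+n}-\lambda_{N-m+n+1})\sum_{i=n+1}^{\min(N-m+n,m)}x_{N-m+n,i}$$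 $$-\frac1\hbar\Big(e^{-x_{m,m}}+e^{x_{N-m,1}-x_{N,1}}+\sum_{k=1}^m\sum_{i=1}^{N-1-m}e^{x_{i+k-1,k}-x_{i+k,k}}+\sum_{k=1}^{N-m}\sum_{i=1}^{m-1}e^{x_{k+i,i+1}-x_{k+i-1,i}}\Big).$$ Then the series $\pi(g(x_{N,1},0,\dots,0))\psi_R$ converges everywhere; contours for $\Psi^{(m,N)}_\lambda(x_{N,1},0,\dots,0)$ exist; $\mathbb R^{m(N-m)}$ is a contour for $e^{\mathcal F_{m,N}}$ and the exponentials in it; and for every contour in the definition of $\Psi^{(m,N)}_\lambda(x_{N,1},0,\dots,0)$ and every contour $\mathcal C$ for $e^{\mathcal F_{m,N}}$ both integrals converge absolutely and $$\Psi^{(m,N)}_\lambda(x_{N,1},0,\dots,0)=\int_{\mathcal C}\omega_{m,N}\;e^{\mathcal F_{m,N}} .$$ -/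

import Mathlib

namespace GrWhittaker

open scoped ContDiff

noncomputable section

/-! ### Contours that are deformations of the real space -/

/-- An arrow `a → b` between two vertices `(n, i)`; it carries the function `exp (x_b - x_a)`. -/
abbrev Arrow := (ℕ × ℕ) × (ℕ × ℕ)

/-- The point `s + i t η(s)` of `ℂ^ι`.  For `t = 1` and `s ∈ ℝ^ι` it runs over the contour given
by `η`; for `0 ≤ t ≤ 1` it describes the deformation of `ℝ^ι` into that contour. -/
def deform {ι : Type} (η : (ι → ℝ) → (ι → ℝ)) (t : ℝ) (s : ι → ℝ) : ι → ℂ :=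
  fun v => (s v : ℂ) + Complex.I * ((t * η s v : ℝ) : ℂ)

/-- The Jacobian determinant of the parametrization `s ↦ s + i η(s)`. -/
def jacobian {ι : Type} [Fintype ι] [DecidableEq ι] (η : (ι → ℝ) → (ι → ℝ)) (s : ι → ℝ) : ℂ :=
  (Matrix.of fun v w : ι => (if v = w then (1 : ℂ) else 0) +
    Complex.I * ((fderiv ℝ η s (Pi.single w 1) v : ℝ) : ℂ)).det

/-- The integrand of the integral of the holomorphic form `f(z) ∏ dz_v` over the contour, in the
parameter `s`. -/
def contourIntegrand {ι : Type} [Fintype ι] [DecidableEq ι] (η : (ι → ℝ) → (ι → ℝ))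
    (f : (ι → ℂ) → ℂ) (s : ι → ℝ) : ℂ :=
  f (deform η 1 s) * jacobian η s

/-- The integral of `f(z) ∏ dz_v` over the contour `{s + i η(s)}`. -/
def contourIntegral {ι : Type} [Fintype ι] [DecidableEq ι] (η : (ι → ℝ) → (ι → ℝ))
    (f : (ι → ℂ) → ℂ) : ℂ :=
  ∫ s : ι → ℝ, contourIntegrand η f s

/-- `{s + i η(s)}` is an admissible contour for an integrand `f` whose phase contains the
exponentials `exp (x_b - x_a)` of the arrows `a → b` in `A`, where `x = coord z`:
it is a smooth graph over `ℝ^ι` with bounded slopes; it is slight, in that none of the real parts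
of these exponentials becomes very negative in the course of the deformation; and `f` decreases
exponentially along it. -/
structure IsContour {ι : Type} [Fintype ι] (coord : (ι → ℂ) → ℕ × ℕ → ℂ) (A : Multiset Arrow)
    (f : (ι → ℂ) → ℂ) (η : (ι → ℝ) → (ι → ℝ)) : Prop where
  smooth : ContDiff ℝ ∞ η
  slope : ∃ K : ℝ, ∀ s, ‖fderiv ℝ η s‖ ≤ K
  slight : ∃ K : ℝ, ∀ a ∈ A, ∀ t ∈ Set.Icc (0 : ℝ) 1, ∀ s,
    -K ≤ (Complex.exp (coord (deform η t s) a.2 - coord (deform η t s) a.1)).re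
  decay : ∃ K c : ℝ, 0 < c ∧ ∀ s, ‖f (deform η 1 s)‖ ≤ K * Real.exp (-c * ‖s‖)

/-! ### The Gauss-Givental realization of `gl_N` -/

/-- The vertices `(n, i)`, `1 ≤ i ≤ n ≤ N - 1`, which index the variables `x_{n,i}`. -/
def gz (N : ℕ) : Finset (ℕ × ℕ) :=
  (Finset.Icc 1 (N - 1) ×ˢ Finset.Icc 1 (N - 1)).filter fun p => p.2 ≤ p.1

/-- Functions of the complex variables `x_{n,i}`. -/
abbrev Fn (N : ℕ) := (gz N → ℂ) → ℂ

/-- Operators on such functions. -/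
abbrev Op (N : ℕ) := Fn N → Fn N

/-- The value of `x_{n,i}`, with `x_{N,i} = 0`. -/
def coord {N : ℕ} (z : gz N → ℂ) (p : ℕ × ℕ) : ℂ :=
  if h : p ∈ gz N then z ⟨p, h⟩ else 0

/-- The derivative `∂/∂x_{n,i}`, read as zero if there is no variable `x_{n,i}`. -/
def pd {N : ℕ} (p : ℕ × ℕ) : Op N := fun f z =>
  if h : p ∈ gz N then fderiv ℂ f z (Pi.single ⟨p, h⟩ 1) else 0

/-- `ρ_n = (N + 1 - 2 n) / 2`. -/
def rho (N n : ℕ) : ℝ := ((N : ℝ) + 1 - 2 * n) / 2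

/-- `μ_n = i λ_n - ρ_n`. -/
def mu (N : ℕ) (lam : ℕ → ℝ) (n : ℕ) : ℂ := Complex.I * lam n - rho N n

/-- `E_{ii}`. -/
def Ediag {N : ℕ} (lam : ℕ → ℝ) (i : ℕ) : Op N := fun f z =>
  mu N lam i * f z - ∑ k ∈ Finset.Icc 1 (i - 1), pd (N + k - i, k) f z
    + ∑ k ∈ Finset.Icc i (N - 1), pd (k, i) f z

/-- `E_{i,i+1}`. -/
def Eup {N : ℕ} (i : ℕ) : Op N := fun f z =>
  -∑ n ∈ Finset.Icc 1 i,
    Complex.exp (coord z (N - 1 - i + n, n) - coord z (N - i + n, n)) *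
      ∑ k ∈ Finset.Icc 1 n, (pd (N - 1 - i + k, k) f z - pd (N - 1 - i + k, k - 1) f z)

/-- `E_{i+1,i}`. -/
def Edown {N : ℕ} (lam : ℕ → ℝ) (i : ℕ) : Op N := fun f z =>
  ∑ n ∈ Finset.Icc 1 (N - i),
    Complex.exp (coord z (n + i, i + 1) - coord z (n + i - 1, i)) *
      ((mu N lam i - mu N lam (i + 1)) * f z +
        ∑ k ∈ Finset.Icc 1 n, (pd (i + k - 1, i) f z - pd (i + k - 1, i + 1) f z))

/-- The commutator of two operators. -/
def comm {N : ℕ} (A B : Op N) : Op N := fun f z => A (B f) z - B (A f) z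

/-- `E_{i,i+d+1}`, as an iterated commutator of the `E_{k,k+1}`. -/
def Eupper {N : ℕ} (i : ℕ) : ℕ → Op N
  | 0 => Eup i
  | d + 1 => comm (Eupper i d) (Eup (i + d + 1))

/-- `E_{j+d+1,j}`, as an iterated commutator of the `E_{k+1,k}`. -/
def Elower {N : ℕ} (lam : ℕ → ℝ) (j : ℕ) : ℕ → Op N
  | 0 => Edown lam j
  | d + 1 => comm (Edown lam (j + d + 1)) (Elower lam j d)

/-- The action of the matrix unit `E_{ij}` of `gl_N`, `1 ≤ i, j ≤ N`. -/
def E {N : ℕ} (lam : ℕ → ℝ) (i j : ℕ) : Op N :=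
  if i = j then Ediag lam i
  else if i < j then Eupper i (j - i - 1)
  else Elower lam j (i - j - 1)

/-- The generators `H_1, …, H_N` of the commutative subalgebra `h^{(m,N)}`. -/
def H {N : ℕ} (m : ℕ) (lam : ℕ → ℝ) (i : ℕ) : Op N :=
  if i = 1 then fun f z => ∑ k ∈ Finset.Icc 1 m, E lam k k f z
  else if i ≤ m then E lam i 1
  else if i < N then E lam i N
  else fun f z => ∑ k ∈ Finset.Icc (m + 1) N, E lam k k f z

/-- The `k`-th term of the exponential series of the operator `X` applied to `f`. -/
def expTerm {N : ℕ} (X : Op N) (f : Fn N) (z : gz N → ℂ) (k : ℕ) : ℂ :=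
  ((k.factorial : ℕ) : ℂ)⁻¹ * (X^[k] f) z

/-- The action `π(exp X) f` of a group element: the exponential series of `X`, applied to `f`. -/
def expAct {N : ℕ} (X : Op N) (f : Fn N) : Fn N := fun z => ∑' k : ℕ, expTerm X f z k

/-- `∑ x_i H_i`, so that `g(x) = exp (∑ x_i H_i)`. -/
def logG {N : ℕ} (m : ℕ) (lam : ℕ → ℝ) (x : ℕ → ℝ) : Op N := fun f z =>
  ∑ i ∈ Finset.Icc 1 N, (x i : ℂ) * H m lam i f z

/-! ### Whittaker vectors -/

/-- The equations for the left `Gr_{m,N}`-Whittaker vector, for a nonzero entire function. -/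
structure IsLeftWhittaker {N : ℕ} (m : ℕ) (hbar : ℝ) (lam : ℕ → ℝ) (ψ : Fn N) : Prop where
  entire : Differentiable ℂ ψ
  ne_zero : ψ ≠ 0
  corner : ∀ z, E lam (m + 1) 1 ψ z = -(hbar : ℂ)⁻¹ * ψ z
  annihilated : ∀ i ∈ Finset.Icc 2 m, ∀ k ∈ Finset.Icc i N, ∀ z, E lam k i ψ z = 0
  simple : ∀ j ∈ Finset.Icc (m + 1) (N - 1), ∀ z, E lam (j + 1) j ψ z = -(hbar : ℂ)⁻¹ * ψ z

/-- The equations for the right `Gr_{m,N}`-Whittaker vector, for a nonzero entire function. -/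
structure IsRightWhittaker {N : ℕ} (m : ℕ) (hbar : ℝ) (lam : ℕ → ℝ) (ψ : Fn N) : Prop where
  entire : Differentiable ℂ ψ
  ne_zero : ψ ≠ 0
  simple : ∀ i ∈ Finset.Icc 2 m, ∀ z, E lam (i - 1) i ψ z = -(hbar : ℂ)⁻¹ * ψ z
  annihilated : ∀ j ∈ Finset.Icc (m + 1) (N - 1), ∀ k ∈ Finset.Icc 1 j, ∀ z, E lam k j ψ z = 0
  corner : ∀ z, E lam m N ψ z = -(hbar : ℂ)⁻¹ * ψ z

/-- The arrow `x_{n+1,k} → x_{n,k}`. -/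
def vert (n k : ℕ) : Arrow := ((n + 1, k), (n, k))

/-- The arrow `x_{n,k} → x_{n+1,k+1}`. -/
def horiz (n k : ℕ) : Arrow := ((n, k), (n + 1, k + 1))

/-- The vertical arrows of the graph of `Gr_{m,N}` between its variables: their functions are
`exp (x_{i+k-1,k} - x_{i+k,k})`, `1 ≤ k ≤ m`, `1 ≤ i ≤ N - m - 1`. -/
def rectVert (N m : ℕ) : Multiset Arrow :=
  (Finset.Icc 1 m ×ˢ Finset.Icc 1 (N - m - 1)).val.map fun p => vert (p.2 + p.1 - 1) p.1

/-- The horizontal arrows of the graph of `Gr_{m,N}` between its variables: their functions are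
`exp (x_{k+i,i+1} - x_{k+i-1,i})`, `1 ≤ k ≤ N - m`, `1 ≤ i ≤ m - 1`. -/
def rectHoriz (N m : ℕ) : Multiset Arrow :=
  (Finset.Icc 1 (N - m) ×ˢ Finset.Icc 1 (m - 1)).val.map fun p => horiz (p.1 + p.2 - 1) p.2

/-- The exponentials in the left Whittaker vector. -/
def leftArrows (N m : ℕ) : Multiset Arrow :=
  {((N, 1), (N - m, 1))} + rectVert N m +
    (Finset.Icc (m + 1) (N - 1)).val.bind fun k =>
      {vert (N - 1) k} + (Finset.Icc 1 (N - k - 1)).val.map fun i => vert (i + k - 1) k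

/-- The exponentials in the right Whittaker vector. -/
def rightArrows (N m : ℕ) : Multiset Arrow :=
  {((m, m), (N, N))} + rectHoriz N m +
    (Finset.Icc 1 (m - 1)).val.bind fun k =>
      {horiz (N - 1) k} + (Finset.Icc 1 (k - 1)).val.map fun i => horiz (N - k + i - 1) i

/-- `∑ exp (x_b - x_a)` over the arrows `a → b` in `A`. -/
def potential (A : Multiset Arrow) (x : ℕ × ℕ → ℂ) : ℂ :=
  (A.map fun a => Complex.exp (x a.2 - x a.1)).sum

/-- The normalization factor `∏_{l ≤ i < j ≤ N} ħ^{ρ_i - i λ_j} Γ(ρ_i - i λ_j)`. -/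
def normC (N l : ℕ) (hbar : ℝ) (lam : ℕ → ℝ) : ℂ :=
  ∏ j ∈ Finset.Icc l N, ∏ i ∈ Finset.Ico l j,
    (hbar : ℂ) ^ ((rho N i : ℂ) - Complex.I * lam j) *
      Complex.Gamma ((rho N i : ℂ) - Complex.I * lam j)

/-- The left `Gr_{m,N}`-Whittaker vector. -/
def psiL (N m : ℕ) (hbar : ℝ) (lam : ℕ → ℝ) : Fn N := fun z =>
  1 / normC N (N - m + 1) hbar lam *
    Complex.exp (-∑ n ∈ Finset.Icc 1 (N - 1), (mu N lam n - mu N lam (n + 1)) *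
          ∑ i ∈ Finset.Icc 1 n, coord z (n, i)
      + ∑ k ∈ Finset.Icc 1 (m - 1), mu N lam (N - k) * coord z (N - k, 1)
      - 1 / (hbar : ℂ) * potential (leftArrows N m) (coord z))

/-- The right `Gr_{m,N}`-Whittaker vector. -/
def psiR (N m : ℕ) (hbar : ℝ) (lam : ℕ → ℝ) : Fn N := fun z =>
  1 / normC N (m + 1) hbar lam *
    Complex.exp (-∑ k ∈ Finset.Icc (m + 1) (N - 1), mu N lam k * coord z (k, k)
      - 1 / (hbar : ℂ) * potential (rightArrows N m) (coord z))

/-! ### The Whittaker function -/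

/-- The integrand `∏ e^{-x_{n,i}} · conj φ₁ · φ₂` of the pairing; `conj φ₁` is continued
analytically from the real space, hence the inner conjugation. -/
def pairingIntegrand {N : ℕ} (φ₁ φ₂ : Fn N) : Fn N := fun z =>
  (∏ v, Complex.exp (-z v)) * (starRingEnd ℂ) (φ₁ fun v => (starRingEnd ℂ) (z v)) * φ₂ z

/-- The pairing `⟨φ₁, φ₂⟩`, over the contour given by `η`. -/
def pairing {N : ℕ} (η : (gz N → ℝ) → (gz N → ℝ)) (φ₁ φ₂ : Fn N) : ℂ :=
  contourIntegral η (pairingIntegrand φ₁ φ₂)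

/-- The `Gr_{m,N}`-Whittaker function
`Ψ(x) = e^{x_1 m (N-m) / 2} ⟨ψ_L, π(g(x)) ψ_R⟩`, with the pairing taken over the contour `η`. -/
def Psi (N m : ℕ) (hbar : ℝ) (lam : ℕ → ℝ) (η : (gz N → ℝ) → (gz N → ℝ)) (x : ℕ → ℝ) : ℂ :=
  Complex.exp ((x 1 : ℂ) * (m * ((N : ℂ) - m) / 2)) *
    pairing η (psiL N m hbar lam) (expAct (logG m lam x) (psiR N m hbar lam))

/-- The integrand in the definition of `Ψ(x)`. -/
def psiIntegrand (N m : ℕ) (hbar : ℝ) (lam : ℕ → ℝ) (x : ℕ → ℝ) : Fn N :=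
  pairingIntegrand (psiL N m hbar lam) (expAct (logG m lam x) (psiR N m hbar lam))

/-- `η` is an admissible contour for the matrix element that defines `Ψ(x)`. -/
def IsPairingContour (N m : ℕ) (hbar : ℝ) (lam : ℕ → ℝ) (x : ℕ → ℝ)
    (η : (gz N → ℝ) → (gz N → ℝ)) : Prop :=
  IsContour coord (leftArrows N m + rightArrows N m) (psiIntegrand N m hbar lam x) η

/-! ### The stationary phase integral -/

/-- The `m (N - m)` vertices that carry the integration variables: `(n, i)` with `1 ≤ n ≤ N - m`,
`1 ≤ i ≤ min n m`, and `(N - m + n, i)` with `1 ≤ n ≤ m - 1`, `n + 1 ≤ i ≤ min (N - m + n) m`. -/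
def rect (N m : ℕ) : Finset (ℕ × ℕ) :=
  (gz N).filter fun p => p.2 ≤ m ∧ p.1 + m < N + p.2

/-- The value of `x_{n,i}` in the phase function, with `x_{N,1}` given and the end point of the
graph at zero. -/
def coordF {N m : ℕ} (xN1 : ℝ) (z : rect N m → ℂ) (p : ℕ × ℕ) : ℂ :=
  if h : p ∈ rect N m then z ⟨p, h⟩ else if p = (N, 1) then (xN1 : ℂ) else 0

/-- The arrows of the graph of `Gr_{m,N}`. -/
def grArrows (N m : ℕ) : Multiset Arrow :=
  {((m, m), (N, N))} + {((N, 1), (N - m, 1))} + rectVert N m + rectHoriz N m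

/-- The phase function `F_{m,N}`. -/
def phase (N m : ℕ) (hbar : ℝ) (lam : ℕ → ℝ) (xN1 : ℝ) (z : rect N m → ℂ) : ℂ :=
  Complex.I * (∑ k ∈ Finset.Icc 1 m, (lam (N - m + k) : ℂ)) * xN1
  + Complex.I * ∑ n ∈ Finset.Icc 1 (N - m), ((lam n : ℂ) - lam (n + 1)) *
      ∑ i ∈ Finset.Icc 1 (min m n), coordF xN1 z (n, i)
  + Complex.I * ∑ n ∈ Finset.Icc 1 (m - 1), ((lam (N - m + n) : ℂ) - lam (N - m + n + 1)) *
      ∑ i ∈ Finset.Icc (n + 1) (min (N - m + n) m), coordF xN1 z (N - m + n, i)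
  - 1 / (hbar : ℂ) * potential (grArrows N m) (coordF xN1 z)

/-- `η` is an admissible contour for the stationary phase integral. -/
def IsPhaseContour (N m : ℕ) (hbar : ℝ) (lam : ℕ → ℝ) (xN1 : ℝ)
    (η : (rect N m → ℝ) → (rect N m → ℝ)) : Prop :=
  IsContour (coordF xN1) (grArrows N m) (fun z => Complex.exp (phase N m hbar lam xN1 z)) η

end

end GrWhittaker

namespace GrWhittaker
open scoped ContDiff
open MeasureTheory Filter Topology
noncomputable section
set_option linter.unusedSectionVars false

/-! ### Determinants of a list of vectors -/

section Det
variable {ι : Type} [Fintype ι] [DecidableEq ι]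

/-- The determinant of a family of vectors. -/
def vdet (c : ι → ι → ℂ) : ℂ := (Matrix.of c).det

theorem vdet_eq (c : ι → ι → ℂ) : vdet c = Matrix.detRowAlternating c := rfl

theorem vdet_apply (c : ι → ι → ℂ) :
    vdet c = ∑ σ : Equiv.Perm ι, (Equiv.Perm.sign σ : ℂ) * ∏ i, c i (σ i) := by
  rw [vdet, ← Matrix.det_transpose, Matrix.det_apply']
  rfl

theorem continuous_vdet : Continuous (vdet : (ι → ι → ℂ) → ℂ) := by
  simp_rw [funext vdet_apply]
  fun_prop

theorem contDiff_vdet {n : ℕ∞ω} : ContDiff ℝ n (vdet : (ι → ι → ℂ) → ℂ) := by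
  simp_rw [funext vdet_apply]
  fun_prop

theorem hasDerivAt_vdet {c : ℝ → ι → ι → ℂ} {c' : ι → ι → ℂ} {t : ℝ}
    (h : ∀ u, HasDerivAt (fun r => c r u) (c' u) t) :
    HasDerivAt (fun r => vdet (c r)) (∑ u, vdet (Function.update (c t) u (c' u))) t := by
  have h1 : ∀ u v, HasDerivAt (fun r => c r u v) (c' u v) t := fun u v =>
    hasDerivAt_pi.1 (h u) v
  have h2 := vdet_apply (ι := ι)
  have h3 : HasDerivAt (fun r => vdet (c r))
      (∑ σ : Equiv.Perm ι, (Equiv.Perm.sign σ : ℂ) *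
        ∑ u, (∏ j ∈ Finset.univ.erase u, c t j (σ j)) • c' u (σ u)) t := by
    simp_rw [h2]
    refine HasDerivAt.fun_sum fun σ _ => HasDerivAt.const_mul _ ?_
    exact HasDerivAt.fun_finsetProd fun i _ => h1 i (σ i)
  convert h3 using 1
  simp_rw [h2, Finset.mul_sum]
  rw [Finset.sum_comm]
  refine Finset.sum_congr rfl fun σ _ => Finset.sum_congr rfl fun u _ => ?_
  rw [← Finset.mul_prod_erase _ _ (Finset.mem_univ u), Function.update_self, smul_eq_mul,
    mul_comm (c' u (σ u))]
  congr 2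
  refine Finset.prod_congr rfl fun j hj => ?_
  rw [Function.update_of_ne (Finset.ne_of_mem_erase hj)]

theorem vdet_update_swap (c : ι → ι → ℂ) {u w : ι} (h : u ≠ w) (x y : ι → ℂ) :
    vdet (Function.update (Function.update c w x) u y) =
      -vdet (Function.update (Function.update c u x) w y) := by
  rw [vdet_eq, vdet_eq, ← AlternatingMap.map_swap _ _ h]
  congr 1
  ext i
  by_cases h1 : i = u
  · subst h1; simp
  · by_cases h2 : i = w
    · subst h2; simp [Function.update_of_ne h1, Function.update_of_ne h]
    · simp [Function.update_of_ne h1, Function.update_of_ne h2, Equiv.swap_apply_of_ne_of_ne h1 h2]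

theorem sum_vdet_update_smul (c : ι → ι → ℂ) (x : ι → ℂ) :
    ∑ w, vdet (Function.update c w x) • c w = vdet c • x := by
  have := Matrix.mulVec_cramer (Matrix.of c).transpose x
  rw [Matrix.det_transpose] at this
  rw [vdet, ← this]
  ext v
  simp only [Finset.sum_apply, Matrix.mulVec, dotProduct, Matrix.transpose_apply, Matrix.of_apply,
    Pi.smul_apply, smul_eq_mul, Matrix.cramer_transpose_apply]
  exact Finset.sum_congr rfl fun w _ => mul_comm _ _

/-- The algebraic identity behind the closedness of `F dz_1 ∧ ⋯ ∧ dz_d` pulled back by a map with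
first derivatives `c`, `x` and second derivatives `a`, `b`. -/
theorem closed_identity (c : ι → ι → ℂ) (x : ι → ℂ) (a : ι → ι → ι → ℂ)
    (ha : ∀ u w, a u w = a w u) (b : ι → ι → ℂ) (L : (ι → ℂ) →ₗ[ℂ] ℂ) (F : ℂ) :
    L x * vdet c + F * ∑ u, vdet (Function.update c u (b u)) =
      ∑ w, (L (c w) * vdet (Function.update c w x) +
        F * ∑ u, vdet (Function.update (Function.update c w x) u
          (Function.update (a w) w (b w) u))) := by
  have h1 : ∑ w, L (c w) * vdet (Function.update c w x) = L x * vdet c := by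
    have := congrArg L (sum_vdet_update_smul c x)
    rw [map_sum, map_smul] at this
    simp_rw [map_smul, smul_eq_mul] at this
    rw [mul_comm, ← this]
    exact Finset.sum_congr rfl fun w _ => mul_comm _ _
  have h2 : ∀ w, ∑ u, vdet (Function.update (Function.update c w x) u
      (Function.update (a w) w (b w) u)) = vdet (Function.update c w (b w)) +
        ∑ u, if u = w then 0 else vdet (Function.update (Function.update c w x) u (a w u)) := by
    intro w
    rw [← Finset.add_sum_erase _ _ (Finset.mem_univ w),
      ← Finset.add_sum_erase (a := w) _ (fun u => if u = w then (0 : ℂ) else _)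
        (Finset.mem_univ w)]
    simp only [Function.update_self, Function.update_idem, if_true, zero_add]
    congr 1
    refine Finset.sum_congr rfl fun u hu => ?_
    rw [if_neg (Finset.ne_of_mem_erase hu), Function.update_of_ne (Finset.ne_of_mem_erase hu)]
  have h3 : ∑ w, ∑ u, (if u = w then (0 : ℂ) else
      vdet (Function.update (Function.update c w x) u (a w u))) = 0 := by
    have h4 : ∀ w u, (if u = w then (0 : ℂ) else
        vdet (Function.update (Function.update c w x) u (a w u))) = -
        (if w = u then (0 : ℂ) else
        vdet (Function.update (Function.update c u x) w (a u w))) := by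
      intro w u
      by_cases h : u = w
      · simp [h]
      · rw [if_neg h, if_neg (Ne.symm h), vdet_update_swap c h, ha]
    have h5 := Finset.sum_congr rfl fun w (_ : w ∈ (Finset.univ : Finset ι)) =>
      Finset.sum_congr rfl fun u (_ : u ∈ (Finset.univ : Finset ι)) => h4 w u
    simp_rw [Finset.sum_neg_distrib] at h5
    rw [Finset.sum_comm (f := fun w u => if w = u then (0 : ℂ) else
        vdet (Function.update (Function.update c u x) w (a u w)))] at h5
    exact self_eq_neg.1 h5
  simp_rw [Finset.sum_add_distrib, ← Finset.mul_sum, h2, h1, Finset.sum_add_distrib, h3, add_zero]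

end Det

/-! ### Integrals of derivatives -/

theorem integral_fderiv_eq_zero {ι : Type} [Fintype ι] {g : (ι → ℝ) → ℂ} (hg : ContDiff ℝ 1 g)
    (hc : HasCompactSupport g) (v : ι → ℝ) : ∫ s, fderiv ℝ g s v = 0 := by
  have hcont : Continuous fun s => fderiv ℝ g s v :=
    (hg.continuous_fderiv (by norm_num)).clm_apply continuous_const
  have hc' : HasCompactSupport fun s => fderiv ℝ g s v := hc.fderiv_apply ℝ v
  have := integral_bilinear_hasLineDerivAt_right_eq_neg_left_of_integrable (μ := volume)
    (f := fun _ : ι → ℝ => (1 : ℝ)) (f' := fun _ => 0) (g := g) (g' := fun s => fderiv ℝ g s v)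
    (v := v) (B := ContinuousLinearMap.lsmul ℝ ℝ) (by simp)
    (by simpa using hcont.integrable_of_hasCompactSupport hc')
    (by simpa using hg.continuous.integrable_of_hasCompactSupport hc)
    (fun x _ => hasDerivAt_const _ _)
    (fun x _ => ((hg.differentiable (by norm_num)) x).hasFDerivAt.hasLineDerivAt v)
  simpa using this

/-! ### Invariance of the integral under compactly supported deformations -/

section Deform
variable {ι : Type} [Fintype ι] [DecidableEq ι]

/-- The derivative of `s ↦ s + i t η(s)` along the coordinate `u`. -/
def column (η : (ι → ℝ) → (ι → ℝ)) (t : ℝ) (s : ι → ℝ) (u : ι) : ι → ℂ :=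
  fun v => (if u = v then (1 : ℂ) else 0) +
    Complex.I * ((t * fderiv ℝ η s (Pi.single u 1) v : ℝ) : ℂ)

/-- The vector `i x`. -/
def imVec (x : ι → ℝ) : ι → ℂ := fun v => Complex.I * (x v : ℂ)

theorem imVec_zero : imVec (0 : ι → ℝ) = 0 := by ext; simp [imVec]

theorem jacobian_eq (η : (ι → ℝ) → (ι → ℝ)) (s : ι → ℝ) : jacobian η s = vdet (column η 1 s) := by
  rw [jacobian, vdet, ← Matrix.det_transpose]
  congr 1
  ext v w
  simp [column, eq_comm]

theorem column_zero (η : (ι → ℝ) → (ι → ℝ)) (s : ι → ℝ) : vdet (column η 0 s) = 1 := by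
  rw [vdet, ← Matrix.det_one (n := ι)]
  congr 1
  ext u v
  simp [column, Matrix.one_apply]

theorem deform_zero (η : (ι → ℝ) → (ι → ℝ)) (s : ι → ℝ) : deform η 0 s = fun v => (s v : ℂ) := by
  ext v; simp [deform]

theorem deform_eq_smul (η : (ι → ℝ) → (ι → ℝ)) (c : (ι → ℝ) → ℝ) (t : ℝ) (s : ι → ℝ) :
    deform (fun s => c s • η s) t s = deform η (t * c s) s := by
  ext v; simp [deform, mul_assoc]

theorem hasDerivAt_deform (η : (ι → ℝ) → (ι → ℝ)) (t : ℝ) (s : ι → ℝ) :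
    HasDerivAt (fun t => deform η t s) (imVec (η s)) t := by
  refine hasDerivAt_pi.2 fun v => ?_
  have h : HasDerivAt (fun t : ℝ => t * η s v) (η s v) t := hasDerivAt_mul_const (η s v)
  exact (h.ofReal_comp.const_mul Complex.I).const_add _

theorem hasDerivAt_column (η : (ι → ℝ) → (ι → ℝ)) (t : ℝ) (s : ι → ℝ) (u : ι) :
    HasDerivAt (fun t => column η t s u) (imVec (fderiv ℝ η s (Pi.single u 1))) t := by
  refine hasDerivAt_pi.2 fun v => ?_
  have h : HasDerivAt (fun t : ℝ => t * fderiv ℝ η s (Pi.single u 1) v)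
    (fderiv ℝ η s (Pi.single u 1) v) t := hasDerivAt_mul_const _
  exact (h.ofReal_comp.const_mul Complex.I).const_add _

theorem hasDerivAt_line {E : Type*} [NormedAddCommGroup E] [NormedSpace ℝ E]
    {f : (ι → ℝ) → E} (hf : Differentiable ℝ f) (s e : ι → ℝ) :
    HasDerivAt (fun r : ℝ => f (s + r • e)) (fderiv ℝ f s e) 0 :=
  (hf s).hasFDerivAt.hasLineDerivAt e

theorem hasDerivAt_deform_line {η : (ι → ℝ) → (ι → ℝ)} (hη : Differentiable ℝ η) (t : ℝ)
    (s : ι → ℝ) (w : ι) :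
    HasDerivAt (fun r : ℝ => deform η t (s + r • Pi.single w 1)) (column η t s w) 0 := by
  refine hasDerivAt_pi.2 fun v => ?_
  have h := hasDerivAt_pi.1 (hasDerivAt_line hη s (Pi.single w 1)) v
  have h1 : HasDerivAt (fun r : ℝ => (s + r • (Pi.single w (1 : ℝ) : ι → ℝ)) v)
      (if w = v then 1 else 0) 0 := by
    by_cases hw : w = v
    · subst hw
      simpa using (hasDerivAt_id (0 : ℝ)).const_add (s w)
    · simpa [hw, Pi.single_apply, Ne.symm hw] using hasDerivAt_const (0 : ℝ) (s v)
  have h2 := h1.ofReal_comp.add ((h.const_mul t).ofReal_comp.const_mul Complex.I)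
  have h3 : column η t s w v = ((if w = v then 1 else 0 : ℝ) : ℂ) +
      Complex.I * ((t * fderiv ℝ η s (Pi.single w 1) v : ℝ) : ℂ) := by
    rw [column]
    split_ifs <;> simp
  rw [h3]
  exact h2

theorem hasDerivAt_column_line {η : (ι → ℝ) → (ι → ℝ)} (hη : ContDiff ℝ 2 η) (t : ℝ)
    (s : ι → ℝ) (w u : ι) :
    HasDerivAt (fun r : ℝ => column η t (s + r • Pi.single w 1) u)
      (imVec (t • fderiv ℝ (fderiv ℝ η) s (Pi.single w 1) (Pi.single u 1))) 0 := by
  refine hasDerivAt_pi.2 fun v => ?_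
  have hd : Differentiable ℝ (fderiv ℝ η) :=
    (hη.fderiv_right (m := 1) (by norm_num)).differentiable (by norm_num)
  have h := hasDerivAt_line hd s (Pi.single w 1)
  have h1 := hasDerivAt_pi.1 (h.clm_apply (hasDerivAt_const (0 : ℝ) (Pi.single u (1 : ℝ)))) v
  have h2 := ((h1.const_mul t).ofReal_comp.const_mul Complex.I).const_add
    (if u = v then (1 : ℂ) else 0)
  rw [map_zero, add_zero] at h2
  exact h2

theorem integral_deform_sub_eq_zero {F : (ι → ℂ) → ℂ} {U : Set (ι → ℂ)} (hU : IsOpen U)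
    (hF : ContDiffOn ℂ 1 F U) {η : (ι → ℝ) → (ι → ℝ)} (hη : ContDiff ℝ ∞ η)
    (hc : HasCompactSupport η) (hmem : ∀ t ∈ Set.Icc (0 : ℝ) 1, ∀ s, deform η t s ∈ U) :
    ∫ s, (contourIntegrand η F s - F fun v => (s v : ℂ)) = 0 := by
  have hη2 : ContDiff ℝ 2 η := hη.of_le (WithTop.coe_le_coe.2 le_top)
  have hηd : Differentiable ℝ η := hη2.differentiable (by norm_num)
  have hη' : ContDiff ℝ 1 (fderiv ℝ η) := hη2.fderiv_right (by norm_num)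
  have hFd : ∀ z ∈ U, HasFDerivAt F (fderiv ℂ F z) z := fun z hz =>
    ((hF.differentiableOn (by norm_num)).differentiableAt (hU.mem_nhds hz)).hasFDerivAt
  set dt : ℝ → (ι → ℝ) → ℂ := fun t s =>
    fderiv ℂ F (deform η t s) (imVec (η s)) * vdet (column η t s) +
      F (deform η t s) * ∑ u, vdet (Function.update (column η t s) u
        (imVec (fderiv ℝ η s (Pi.single u 1)))) with hdt
  have hdef : Continuous fun p : ℝ × (ι → ℝ) => deform η p.1 p.2 := by
    have := hη.continuous
    unfold deform
    fun_prop
  have hcol : Continuous fun p : ℝ × (ι → ℝ) => column η p.1 p.2 := by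
    have := hη'.continuous
    unfold column
    fun_prop
  have him : Continuous (imVec : (ι → ℝ) → (ι → ℂ)) := by unfold imVec; fun_prop
  have hcont : ContinuousOn (Function.uncurry dt) (Set.Icc (0 : ℝ) 1 ×ˢ Set.univ) := by
    have hm : Set.MapsTo (fun p : ℝ × (ι → ℝ) => deform η p.1 p.2)
        (Set.Icc (0 : ℝ) 1 ×ˢ Set.univ) U := fun p hp => hmem p.1 hp.1 p.2
    have h1 := hF.continuousOn.comp hdef.continuousOn hm
    have h2 := (hF.continuousOn_fderiv_of_isOpen hU (by norm_num)).comp hdef.continuousOn hm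
    have h3 : Continuous fun p : ℝ × (ι → ℝ) => imVec (η p.2) :=
      him.comp (hη.continuous.comp continuous_snd)
    have h4 : Continuous fun p : ℝ × (ι → ℝ) => ∑ u, vdet (Function.update (column η p.1 p.2) u
        (imVec (fderiv ℝ η p.2 (Pi.single u 1)))) := by
      refine continuous_finsetSum _ fun u _ => continuous_vdet.comp (hcol.update u ?_)
      exact him.comp ((hη'.continuous.comp continuous_snd).clm_apply continuous_const)
    exact ((h2.clm_apply h3.continuousOn).mul (continuous_vdet.comp hcol).continuousOn).add
      (h1.mul h4.continuousOn)
  have hzero : ∀ t s, s ∉ tsupport η → dt t s = 0 := by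
    intro t s hs
    have h0 : η s = 0 := image_eq_zero_of_notMem_tsupport hs
    have h1 : fderiv ℝ η s = 0 := by
      have := (notMem_tsupport_iff_eventuallyEq.1 hs).fderiv_eq (𝕜 := ℝ)
      simpa using this
    have h2 : ∀ (c : ι → ι → ℂ) u, vdet (Function.update c u 0) = 0 := fun c u =>
      (Matrix.detRowAlternating (R := ℂ)).map_update_zero c u
    simp [hdt, h0, h1, imVec_zero, h2]
  have hD : ∀ t ∈ Set.Icc (0 : ℝ) 1, ∀ s, HasDerivAt
      (fun t => F (deform η t s) * vdet (column η t s)) (dt t s) t := by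
    intro t ht s
    have h1 := ((hFd _ (hmem t ht s)).restrictScalars ℝ).comp_hasDerivAt t
      (hasDerivAt_deform η t s)
    exact h1.mul (hasDerivAt_vdet fun u => hasDerivAt_column η t s u)
  have hFTC : ∀ s, ∫ t in (0 : ℝ)..1, dt t s = contourIntegrand η F s - F fun v => (s v : ℂ) := by
    intro s
    rw [intervalIntegral.integral_eq_sub_of_hasDerivAt
      (f := fun t => F (deform η t s) * vdet (column η t s)) (fun t ht => hD t
        (by simpa using ht) s)]
    · rw [contourIntegrand, jacobian_eq, column_zero, deform_zero, mul_one]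
    · refine ContinuousOn.intervalIntegrable ?_
      rw [Set.uIcc_of_le zero_le_one]
      exact hcont.comp (f := fun t : ℝ => (t, s)) (by fun_prop) fun t ht => ⟨ht, trivial⟩
  have hdiv : ∀ t ∈ Set.Icc (0 : ℝ) 1, ∫ s, dt t s = 0 := by
    intro t ht
    have hdefs : ContDiff ℝ 1 fun s => deform η t s := by
      have := hη2.of_le (m := 1) (by norm_num)
      unfold deform
      have h2 : ∀ v, ContDiff ℝ 1 fun s => η s v := fun v => contDiff_pi.1 this v
      refine contDiff_pi.2 fun v => ?_
      have h3 := h2 v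
      refine ContDiff.add ?_ (contDiff_const.mul ?_)
      · exact Complex.ofRealCLM.contDiff.comp (contDiff_apply ℝ ℝ v)
      · exact Complex.ofRealCLM.contDiff.comp (contDiff_const.mul h3)
    have hFs : ContDiff ℝ 1 fun s => F (deform η t s) := by
      have h := (hF.restrict_scalars ℝ).comp (s := Set.univ) hdefs.contDiffOn
        (fun s _ => hmem t ht s)
      exact contDiffOn_univ.1 h
    have hims : ContDiff ℝ 1 fun s => imVec (η s) := by
      have := hη2.of_le (m := 1) (by norm_num)
      refine contDiff_pi.2 fun v => contDiff_const.mul ?_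
      exact Complex.ofRealCLM.contDiff.comp (contDiff_pi.1 this v)
    have hcols : ∀ u, ContDiff ℝ 1 fun s => column η t s u := by
      intro u
      refine contDiff_pi.2 fun v => contDiff_const.add (contDiff_const.mul ?_)
      refine Complex.ofRealCLM.contDiff.comp (contDiff_const.mul ?_)
      exact contDiff_pi.1 (hη'.clm_apply contDiff_const) v
    have hup : ∀ w, ContDiff ℝ 1 fun s => Function.update (column η t s) w (imVec (η s)) := by
      intro w
      refine contDiff_pi.2 fun u => ?_
      by_cases h : u = w
      · subst h; simpa using hims
      · simpa [h] using hcols u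
    set G : ι → (ι → ℝ) → ℂ := fun w s =>
      F (deform η t s) * vdet (Function.update (column η t s) w (imVec (η s))) with hG
    have hGs : ∀ w, ContDiff ℝ 1 (G w) := fun w => hFs.mul (contDiff_vdet.comp (hup w))
    have hGc : ∀ w, HasCompactSupport (G w) := by
      intro w
      refine hc.mono fun s hs => ?_
      contrapose! hs
      have h0 : η s = 0 := by simpa using hs
      simp only [hG, Function.mem_support, not_not, h0, imVec_zero]
      rw [vdet_eq, (Matrix.detRowAlternating (R := ℂ)).map_update_zero, mul_zero]
    have hpt : ∀ s, dt t s = ∑ w, fderiv ℝ (G w) s (Pi.single w 1) := by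
      intro s
      have hz := hFd _ (hmem t ht s)
      have hGd : ∀ w, fderiv ℝ (G w) s (Pi.single w 1) =
          fderiv ℂ F (deform η t s) (column η t s w) *
            vdet (Function.update (column η t s) w (imVec (η s))) +
          F (deform η t s) * ∑ u, vdet (Function.update
            (Function.update (column η t s) w (imVec (η s))) u (Function.update
              (fun u => imVec (t • fderiv ℝ (fderiv ℝ η) s (Pi.single w 1) (Pi.single u 1))) w
              (imVec (fderiv ℝ η s (Pi.single w 1))) u)) := by
        intro w
        have h1 := hasDerivAt_line ((hGs w).differentiable (by norm_num)) s (Pi.single w 1)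
        have hz' : HasFDerivAt F (fderiv ℂ F (deform η t s))
            (deform η t (s + (0 : ℝ) • Pi.single w 1)) := by simpa using hz
        have h2 := (hz'.restrictScalars ℝ).comp_hasDerivAt (0 : ℝ)
          (hasDerivAt_deform_line hηd t s w)
        have h3 : ∀ u, HasDerivAt (fun r : ℝ => Function.update
            (column η t (s + r • Pi.single w 1)) w (imVec (η (s + r • Pi.single w 1))) u)
            (Function.update
              (fun u => imVec (t • fderiv ℝ (fderiv ℝ η) s (Pi.single w 1) (Pi.single u 1))) w
              (imVec (fderiv ℝ η s (Pi.single w 1))) u) 0 := by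
          intro u
          by_cases h : u = w
          · subst h
            simp only [Function.update_self]
            refine hasDerivAt_pi.2 fun v => ?_
            exact (hasDerivAt_pi.1 (hasDerivAt_line hηd s (Pi.single u 1)) v).ofReal_comp.const_mul
              Complex.I
          · simp only [Function.update_of_ne h]
            exact hasDerivAt_column_line hη2 t s w u
        have h4 := h1.unique (h2.mul (hasDerivAt_vdet h3))
        rw [h4]
        simp
      rw [Finset.sum_congr rfl fun w _ => hGd w]
      refine closed_identity (column η t s) (imVec (η s))
        (fun w u => imVec (t • fderiv ℝ (fderiv ℝ η) s (Pi.single w 1) (Pi.single u 1)))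
        (fun u w => ?_) (fun u => imVec (fderiv ℝ η s (Pi.single u 1)))
        (fderiv ℂ F (deform η t s)).toLinearMap _
      rw [(hη2.contDiffAt.isSymmSndFDerivAt (by simp)).eq]
    simp_rw [hpt]
    rw [integral_finsetSum]
    · exact Finset.sum_eq_zero fun w _ => integral_fderiv_eq_zero (hGs w) (hGc w) _
    · intro w _
      exact (((hGs w).continuous_fderiv (by norm_num)).clm_apply
        continuous_const).integrable_of_hasCompactSupport ((hGc w).fderiv_apply ℝ _)
  simp_rw [← hFTC]
  rw [← intervalIntegral_integral_swap]
  · rw [intervalIntegral.integral_congr (g := fun _ => 0)]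
    · simp
    · intro t ht
      exact hdiv t (by simpa using ht)
  · have h1 : IntegrableOn (Function.uncurry dt) (Set.Icc (0 : ℝ) 1 ×ˢ tsupport η)
        ((volume : Measure ℝ).prod volume) :=
      (hcont.mono (Set.prod_mono_right (Set.subset_univ _))).integrableOn_compact
        (isCompact_Icc.prod hc)
    have h2 : IntegrableOn (Function.uncurry dt) (Set.uIoc (0 : ℝ) 1 ×ˢ Set.univ)
        ((volume : Measure ℝ).prod volume) := by
      refine h1.of_forall_sdiff_eq_zero (measurableSet_uIoc.prod MeasurableSet.univ) ?_
      rintro ⟨t, s⟩ ⟨⟨h3, -⟩, h4⟩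
      refine hzero t s fun h5 => h4 ⟨?_, h5⟩
      rw [Set.uIoc_of_le zero_le_one] at h3
      exact Set.Ioc_subset_Icc_self h3
    rwa [IntegrableOn, ← Measure.prod_restrict, Measure.restrict_univ] at h2

end Deform

section Deform
variable {ι : Type} [Fintype ι] [DecidableEq ι]

theorem integrable_exp_neg_norm {c : ℝ} (hc : 0 < c) :
    Integrable fun s : ι → ℝ => Real.exp (-c * ‖s‖) := by
  set n := Module.finrank ℝ (ι → ℝ) + 1 with hn
  have h := integrable_one_add_norm (E := ι → ℝ) (μ := volume) (r := n) (by rw [hn]; simp)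
  refine (h.const_mul (n.factorial / c ^ n * Real.exp c)).mono'
    (by fun_prop) (ae_of_all _ fun s => ?_)
  have h1 := Real.pow_div_factorial_le_exp (c * (1 + ‖s‖)) (by positivity) n
  have hs : 0 < 1 + ‖s‖ := by positivity
  rw [Real.norm_eq_abs, abs_of_pos (Real.exp_pos _), Real.rpow_neg hs.le, Real.rpow_natCast]
  have h2 : Real.exp (-c * ‖s‖) = Real.exp c * (Real.exp (c * (1 + ‖s‖)))⁻¹ := by
    rw [← Real.exp_neg, ← Real.exp_add]; ring_nf
  rw [h2]
  have h3 : (Real.exp (c * (1 + ‖s‖)))⁻¹ ≤ n.factorial / c ^ n * ((1 + ‖s‖) ^ n)⁻¹ := by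
    calc _ ≤ ((c * (1 + ‖s‖)) ^ n / n.factorial)⁻¹ := inv_anti₀ (by positivity) h1
      _ = _ := by rw [mul_pow]; field_simp
  calc _ ≤ Real.exp c * (n.factorial / c ^ n * ((1 + ‖s‖) ^ n)⁻¹) := by gcongr
    _ = _ := by ring

theorem norm_vdet_le {c : ι → ι → ℂ} {B : ℝ} (h : ∀ u v, ‖c u v‖ ≤ B) :
    ‖vdet c‖ ≤ Fintype.card (Equiv.Perm ι) * B ^ Fintype.card ι := by
  rw [vdet_apply]
  refine (norm_sum_le _ _).trans ?_
  have : ∀ σ ∈ (Finset.univ : Finset (Equiv.Perm ι)),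
      ‖(Equiv.Perm.sign σ : ℂ) * ∏ i, c i (σ i)‖ ≤ B ^ Fintype.card ι := by
    intro σ _
    have h1 : ‖((Equiv.Perm.sign σ : ℤ) : ℂ)‖ = 1 := by
      rcases Int.units_eq_one_or (Equiv.Perm.sign σ) with h | h <;> simp [h]
    rw [norm_mul, h1, one_mul, norm_prod, ← Finset.card_univ, ← Finset.prod_const]
    exact Finset.prod_le_prod (fun _ _ => norm_nonneg _) fun i _ => h i _
  simpa using Finset.sum_le_card_nsmul _ _ _ this

theorem norm_fderiv_single_le {η : (ι → ℝ) → (ι → ℝ)} {s : ι → ℝ} {K : ℝ}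
    (h : ‖fderiv ℝ η s‖ ≤ K) (u v : ι) : |fderiv ℝ η s (Pi.single u 1) v| ≤ K := by
  have h1 := (fderiv ℝ η s).le_of_opNorm_le h (Pi.single u 1)
  rw [Pi.norm_single, norm_one, mul_one] at h1
  exact (norm_le_pi_norm (fderiv ℝ η s (Pi.single u 1)) v).trans h1

theorem norm_jacobian_le {η : (ι → ℝ) → (ι → ℝ)} {s : ι → ℝ} {K : ℝ}
    (h : ‖fderiv ℝ η s‖ ≤ K) :
    ‖jacobian η s‖ ≤ Fintype.card (Equiv.Perm ι) * (1 + K) ^ Fintype.card ι := by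
  rw [jacobian_eq]
  refine norm_vdet_le fun u v => ?_
  rw [column]
  refine (norm_add_le _ _).trans (add_le_add ?_ ?_)
  · split_ifs <;> simp
  · rw [norm_mul, Complex.norm_I, one_mul, one_mul, Complex.norm_real]
    exact norm_fderiv_single_le h u v

theorem continuous_jacobian {η : (ι → ℝ) → (ι → ℝ)} (hη : ContDiff ℝ ∞ η) :
    Continuous (jacobian η) := by
  simp_rw [funext (jacobian_eq η)]
  have := hη.continuous_fderiv (by simp)
  refine continuous_vdet.comp ?_
  unfold column
  fun_prop

theorem continuous_deform {η : (ι → ℝ) → (ι → ℝ)} (hη : Continuous η) (t : ℝ) :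
    Continuous (deform η t) := by
  unfold deform
  fun_prop

theorem continuous_contourIntegrand {F : (ι → ℂ) → ℂ} {U : Set (ι → ℂ)}
    (hF : ContinuousOn F U) {η : (ι → ℝ) → (ι → ℝ)} (hη : ContDiff ℝ ∞ η)
    (hmem : ∀ s, deform η 1 s ∈ U) : Continuous (contourIntegrand η F) :=
  (hF.comp_continuous (continuous_deform hη.continuous 1) hmem).mul (continuous_jacobian hη)

theorem norm_le_of_fderiv_le {η : (ι → ℝ) → (ι → ℝ)} (hη : ContDiff ℝ ∞ η) {K : ℝ}
    (h : ∀ s, ‖fderiv ℝ η s‖ ≤ K) (s s' : ι → ℝ) : ‖η s - η s'‖ ≤ K * ‖s - s'‖ :=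
  Convex.norm_image_sub_le_of_norm_fderiv_le (𝕜 := ℝ)
    (fun x _ => hη.differentiable (by simp) x) (fun x _ => h x) convex_univ trivial trivial

theorem integrable_contourIntegrand {F : (ι → ℂ) → ℂ} {U : Set (ι → ℂ)}
    (hF : ContinuousOn F U) {η : (ι → ℝ) → (ι → ℝ)} (hη : ContDiff ℝ ∞ η)
    (hmem : ∀ s, deform η 1 s ∈ U) {L : ℝ} (hL : ∀ s, ‖fderiv ℝ η s‖ ≤ L) {K c : ℝ} (hc : 0 < c)
    (hK : ∀ s, ‖F (deform η 1 s)‖ ≤ K * Real.exp (-c * ‖s‖)) :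
    Integrable (contourIntegrand η F) := by
  refine ((integrable_exp_neg_norm hc).const_mul
    (K * (Fintype.card (Equiv.Perm ι) * (1 + L) ^ Fintype.card ι))).mono'
    (continuous_contourIntegrand hF hη hmem).aestronglyMeasurable (ae_of_all _ fun s => ?_)
  rw [contourIntegrand, norm_mul]
  calc _ ≤ K * Real.exp (-c * ‖s‖) * (Fintype.card (Equiv.Perm ι) * (1 + L) ^ Fintype.card ι) := by
        refine mul_le_mul (hK s) (norm_jacobian_le (hL s)) (norm_nonneg _)
          ((norm_nonneg _).trans (hK s))
    _ = _ := by ring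

/-- Cauchy's theorem for a contour `s + i η(s)` that is deformed linearly into the real space,
for an integrand that decreases exponentially throughout the deformation. -/
theorem contourIntegral_eq_integral {F : (ι → ℂ) → ℂ} {U : Set (ι → ℂ)} (hU : IsOpen U)
    (hF : ContDiffOn ℂ 1 F U) {η : (ι → ℝ) → (ι → ℝ)} (hη : ContDiff ℝ ∞ η) {L : ℝ}
    (hL : ∀ s, ‖fderiv ℝ η s‖ ≤ L) (hmem : ∀ t ∈ Set.Icc (0 : ℝ) 1, ∀ s, deform η t s ∈ U)
    {K c : ℝ} (hc : 0 < c)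
    (hK : ∀ t ∈ Set.Icc (0 : ℝ) 1, ∀ s, ‖F (deform η t s)‖ ≤ K * Real.exp (-c * ‖s‖)) :
    contourIntegral η F = ∫ s : ι → ℝ, F fun v => (s v : ℂ) := by
  set χ : ContDiffBump (0 : ι → ℝ) := ⟨1, 2, by norm_num, by norm_num⟩ with hχ
  obtain ⟨C, hC⟩ := (χ.contDiff (n := 1).continuous_fderiv (by norm_num)).bounded_above_of_compact_support
    (χ.hasCompactSupport.fderiv (𝕜 := ℝ))
  have hC0 : 0 ≤ C := (norm_nonneg _).trans (hC 0)
  have hL0 : 0 ≤ L := (norm_nonneg _).trans (hL 0)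
  have hK0 : 0 ≤ K := by
    have := (norm_nonneg _).trans (hK 0 (by simp) 0)
    simpa using this
  set c' : ℕ → (ι → ℝ) → ℝ := fun n s => χ (((n : ℝ) + 1)⁻¹ • s) with hc'
  set e : ℕ → (ι → ℝ) → (ι → ℝ) := fun n s => c' n s • η s with he
  have hn : ∀ n : ℕ, (0 : ℝ) < (n : ℝ) + 1 := fun n => by positivity
  have hsm : ∀ n, ContDiff ℝ ∞ (c' n) := fun n => χ.contDiff.comp (contDiff_const_smul _)
  have hes : ∀ n, ContDiff ℝ ∞ (e n) := fun n => (hsm n).smul hη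
  have hcc : ∀ n, HasCompactSupport (c' n) := fun n =>
    χ.hasCompactSupport.comp_smul (inv_ne_zero (hn n).ne')
  have hec : ∀ n, HasCompactSupport (e n) := fun n => (hcc n).smul_right
  have h01 : ∀ n s, c' n s ∈ Set.Icc (0 : ℝ) 1 := fun n s => ⟨χ.nonneg, χ.le_one⟩
  have hdef : ∀ n t s, deform (e n) t s = deform η (t * c' n s) s := fun n t s =>
    deform_eq_smul η (c' n) t s
  have h01' : ∀ t ∈ Set.Icc (0 : ℝ) 1, ∀ n s, t * c' n s ∈ Set.Icc (0 : ℝ) 1 := fun t ht n s =>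
    ⟨mul_nonneg ht.1 (h01 n s).1, mul_le_one₀ ht.2 (h01 n s).1 (h01 n s).2⟩
  have hememb : ∀ n, ∀ t ∈ Set.Icc (0 : ℝ) 1, ∀ s, deform (e n) t s ∈ U := fun n t ht s => by
    rw [hdef]; exact hmem _ (h01' t ht n s) s
  have heK : ∀ n, ∀ s, ‖F (deform (e n) 1 s)‖ ≤ K * Real.exp (-c * ‖s‖) := fun n s => by
    rw [hdef]; exact hK _ (h01' 1 (by simp) n s) s
  set L' := L + C * (‖η 0‖ + 2 * L) with hL'
  have heL : ∀ n s, ‖fderiv ℝ (e n) s‖ ≤ L' := by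
    intro n s
    have h1 : fderiv ℝ (e n) s = c' n s • fderiv ℝ η s + (fderiv ℝ (c' n) s).smulRight (η s) :=
      fderiv_smul ((hsm n).differentiable (by simp) s) (hη.differentiable (by simp) s)
    have h2 : fderiv ℝ (c' n) s = ((n : ℝ) + 1)⁻¹ • fderiv ℝ χ (((n : ℝ) + 1)⁻¹ • s) :=
      fderiv_comp_smul _
    rw [h1]
    refine (norm_add_le _ _).trans (add_le_add ?_ ?_)
    · rw [norm_smul, Real.norm_eq_abs, abs_of_nonneg (h01 n s).1]
      exact (mul_le_of_le_one_left (norm_nonneg _) (h01 n s).2).trans (hL s)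
    · rw [ContinuousLinearMap.norm_smulRight_apply, h2, norm_smul, Real.norm_eq_abs,
        abs_of_pos (inv_pos.2 (hn n))]
      by_cases hs : ‖s‖ ≤ 2 * (n + 1)
      · have h3 : ‖η s‖ ≤ ((n : ℝ) + 1) * (‖η 0‖ + 2 * L) := by
          have h4 := norm_le_of_fderiv_le hη hL s 0
          have h5 := norm_le_norm_add_norm_sub' (η s) (η 0)
          rw [sub_zero] at h4
          have h6 : L * ‖s‖ ≤ L * (2 * (n + 1)) := by gcongr
          have h7 : (0 : ℝ) ≤ n * ‖η 0‖ := by positivity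
          linarith
        calc _ ≤ ((n : ℝ) + 1)⁻¹ * C * (((n : ℝ) + 1) * (‖η 0‖ + 2 * L)) := by
              have := hC (((n : ℝ) + 1)⁻¹ • s)
              gcongr
          _ = _ := by have := (hn n).ne'; field_simp
      · have h3 : fderiv ℝ χ (((n : ℝ) + 1)⁻¹ • s) = 0 := by
          have h4 : ((n : ℝ) + 1)⁻¹ • s ∉ tsupport χ := by
            rw [χ.tsupport_eq, mem_closedBall_zero_iff, norm_smul, Real.norm_eq_abs,
              abs_of_pos (inv_pos.2 (hn n)), not_le]
            rw [lt_inv_mul_iff₀ (hn n)]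
            push Not at hs
            show ((n : ℝ) + 1) * 2 < _
            linarith
          have := (notMem_tsupport_iff_eventuallyEq.1 h4).fderiv_eq (𝕜 := ℝ)
          simpa using this
        rw [h3]
        simp only [norm_zero, mul_zero, zero_mul]
        positivity
  have hreal : Integrable fun s : ι → ℝ => F fun v => (s v : ℂ) := by
    have h0 : ∀ s, deform η 0 s ∈ U := fun s => hmem 0 (by simp) s
    have h1 : Continuous fun s : ι → ℝ => F fun v => (s v : ℂ) := by
      have := hF.continuousOn.comp_continuous (continuous_deform hη.continuous 0) h0
      refine this.congr fun s => ?_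
      rw [Function.comp_apply, deform_zero]
    refine ((integrable_exp_neg_norm hc).const_mul K).mono' h1.aestronglyMeasurable
      (ae_of_all _ fun s => ?_)
    have := hK 0 (by simp) s
    rwa [deform_zero] at this
  have heq : ∀ n, ∫ s, contourIntegrand (e n) F s = ∫ s : ι → ℝ, F fun v => (s v : ℂ) := by
    intro n
    have h1 := integral_deform_sub_eq_zero hU hF (hes n) (hec n) (hememb n)
    rw [integral_sub (integrable_contourIntegrand hF.continuousOn (hes n)
      (hememb n 1 (by simp)) (heL n) hc (heK n)) hreal] at h1
    exact sub_eq_zero.1 h1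
  have hlim : Tendsto (fun n => ∫ s, contourIntegrand (e n) F s) atTop
      (𝓝 (∫ s, contourIntegrand η F s)) := by
    refine tendsto_integral_of_dominated_convergence (fun s => K * Real.exp (-c * ‖s‖) *
      (Fintype.card (Equiv.Perm ι) * (1 + L') ^ Fintype.card ι))
      (fun n => (continuous_contourIntegrand hF.continuousOn (hes n)
        (hememb n 1 (by simp))).aestronglyMeasurable)
      (((integrable_exp_neg_norm hc).const_mul K).mul_const _) (fun n => ae_of_all _ fun s => ?_)
      (ae_of_all _ fun s => ?_)
    · rw [contourIntegrand, norm_mul]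
      exact mul_le_mul (heK n s) (norm_jacobian_le (heL n s)) (norm_nonneg _)
          ((norm_nonneg _).trans (heK n s))
    · refine tendsto_const_nhds.congr' ?_
      obtain ⟨n₀, hn₀⟩ := exists_nat_gt ‖s‖
      filter_upwards [eventually_ge_atTop n₀] with n hn1
      have h1 : e n =ᶠ[𝓝 s] η := by
        have : ∀ᶠ s' in 𝓝 s, ‖s'‖ < n₀ := continuous_norm.continuousAt.eventually_lt_const hn₀
        filter_upwards [this] with s' hs'
        have h2 : c' n s' = 1 := by
          refine χ.one_of_mem_closedBall ?_
          rw [mem_closedBall_zero_iff, norm_smul, Real.norm_eq_abs, abs_of_pos (inv_pos.2 (hn n)),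
            inv_mul_le_iff₀ (hn n)]
          show _ ≤ ((n : ℝ) + 1) * 1
          have : (n₀ : ℝ) ≤ n := by exact_mod_cast hn1
          linarith
        simp [he, h2]
      have h2 : deform (e n) 1 s = deform η 1 s := by
        ext v; simp only [deform, h1.eq_of_nhds]
      rw [contourIntegrand, contourIntegrand, jacobian, jacobian, h1.fderiv_eq, h2]
  simp_rw [heq] at hlim
  exact tendsto_nhds_unique hlim tendsto_const_nhds

end Deform

/-! ### A regulator that grows superlinearly in a double cone -/

/-- `√w log w` with `w = M² + z²`. -/
def reg (M : ℝ) (z : ℂ) : ℂ :=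
  Complex.exp (Complex.log ((M : ℂ) ^ 2 + z ^ 2) / 2) * Complex.log ((M : ℂ) ^ 2 + z ^ 2)

theorem sq_re (M : ℝ) (z : ℂ) : ((M : ℂ) ^ 2 + z ^ 2).re = M ^ 2 + z.re ^ 2 - z.im ^ 2 := by
  simp [pow_two]; ring

theorem sq_im (M : ℝ) (z : ℂ) : ((M : ℂ) ^ 2 + z ^ 2).im = 2 * z.re * z.im := by
  simp [pow_two]; ring

theorem cone_sq {A B : ℝ} {z : ℂ} (hz : |z.im| ≤ A + B * |z.re|) :
    z.im ^ 2 ≤ 2 * A ^ 2 + 2 * B ^ 2 * z.re ^ 2 := by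
  have h1 : z.im ^ 2 ≤ (A + B * |z.re|) ^ 2 := by
    rw [← sq_abs z.im]; exact pow_le_pow_left₀ (abs_nonneg _) hz 2
  have h2 := sq_abs z.re
  nlinarith [sq_nonneg (A - B * |z.re|)]

theorem sq_mem_slitPlane {A B M : ℝ} (hM : 2 * A ^ 2 + 1 ≤ M ^ 2) {z : ℂ}
    (hz : |z.im| ≤ A + B * |z.re|) : (M : ℂ) ^ 2 + z ^ 2 ∈ Complex.slitPlane := by
  rw [Complex.mem_slitPlane_iff, sq_re, sq_im]
  by_contra! h
  have h1 := cone_sq hz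
  rcases mul_eq_zero.1 h.2 with h2 | h2
  · have h3 : z.re = 0 := by linarith
    rw [h3] at h1
    nlinarith
  · rw [h2] at h
    nlinarith [sq_nonneg z.re]

/-- The opening angle of `M² + z²`, for `z` in a double cone. -/
theorem cos_half_arg_le {A B M : ℝ} (hM : 2 * A ^ 2 + 1 ≤ M ^ 2) {z : ℂ}
    (hz : |z.im| ≤ A + B * |z.re|) :
    1 / (2 * (B ^ 2 + 1)) ≤ Real.cos (((M : ℂ) ^ 2 + z ^ 2).arg / 2) := by
  have hs := sq_mem_slitPlane hM hz
  set w := (M : ℂ) ^ 2 + z ^ 2 with hw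
  have hw0 : w ≠ 0 := Complex.slitPlane_ne_zero hs
  have hr : 0 < ‖w‖ := norm_pos_iff.2 hw0
  have hpos : 0 ≤ Real.cos (w.arg / 2) := by
    refine Real.cos_nonneg_of_neg_pi_div_two_le_of_le ?_ ?_
    · have := Complex.neg_pi_lt_arg w; linarith
    · have := Complex.arg_le_pi w; linarith
  have h1 : Real.cos (w.arg / 2) ^ 2 = 1 / 2 + w.re / ‖w‖ / 2 := by
    rw [Real.cos_sq, mul_div_cancel₀ _ two_ne_zero, Complex.cos_arg hw0]
  have hB : 0 ≤ B ^ 2 := sq_nonneg B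
  have key : (1 / (2 * (B ^ 2 + 1))) ^ 2 ≤ 1 / 2 + w.re / ‖w‖ / 2 := by
    have h2 : (1 / (2 * (B ^ 2 + 1))) ^ 2 ≤ 1 / 4 := by
      rw [div_pow, one_pow]
      exact one_div_le_one_div_of_le (by norm_num) (by nlinarith)
    rcases le_or_gt 0 w.re with h | h
    · have : 0 ≤ w.re / ‖w‖ / 2 := by positivity
      linarith
    · have h3 := cone_sq hz
      have hre : w.re = M ^ 2 + z.re ^ 2 - z.im ^ 2 := sq_re M z
      have him : w.im = 2 * z.re * z.im := sq_im M z
      have h4 : z.re ^ 2 ≤ |z.re * z.im| := by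
        rw [abs_mul, ← sq_abs, sq]
        refine mul_le_mul_of_nonneg_left (sq_le_sq.1 ?_) (abs_nonneg _)
        nlinarith [sq_nonneg M]
      have h5 : |w.im| = 2 * |z.re * z.im| := by
        rw [him, mul_assoc, abs_mul, abs_two]
      have h6 : -w.re ≤ B ^ 2 * |w.im| := by
        rw [h5, hre]; nlinarith [sq_nonneg z.re]
      have h7 : ‖w‖ ≤ (B ^ 2 + 1) * |w.im| := by
        have := Complex.norm_le_abs_re_add_abs_im w
        rw [abs_of_neg h] at this
        linarith
      have h8 : ‖w‖ ^ 2 = w.re ^ 2 + w.im ^ 2 := by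
        rw [← Complex.normSq_eq_norm_sq, Complex.normSq_apply]; ring
      have h9 : ‖w‖ ^ 2 ≤ (B ^ 2 + 1) ^ 2 * w.im ^ 2 := by
        rw [← sq_abs w.im, ← mul_pow]
        exact pow_le_pow_left₀ hr.le h7 2
      have h10 : -w.re ≤ ‖w‖ := by
        have := Complex.abs_re_le_norm w
        rwa [abs_of_neg h] at this
      have h11 : ‖w‖ ≤ (B ^ 2 + 1) ^ 2 * (2 * (‖w‖ + w.re)) := by
        have : ‖w‖ * ‖w‖ ≤ (B ^ 2 + 1) ^ 2 * (2 * (‖w‖ + w.re)) * ‖w‖ := by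
          have h12 : w.im ^ 2 ≤ 2 * (‖w‖ + w.re) * ‖w‖ := by nlinarith
          calc _ ≤ (B ^ 2 + 1) ^ 2 * w.im ^ 2 := by rw [← sq]; exact h9
            _ ≤ (B ^ 2 + 1) ^ 2 * (2 * (‖w‖ + w.re) * ‖w‖) := by gcongr
            _ = _ := by ring
        exact le_of_mul_le_mul_right this hr
      rw [div_pow, one_pow, mul_pow]
      have h13 : 1 / 2 + w.re / ‖w‖ / 2 = (‖w‖ + w.re) / (2 * ‖w‖) := by field_simp
      rw [h13, div_le_div_iff₀ (by positivity) (by positivity)]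
      linarith
  rw [← h1] at key
  exact (abs_le_of_sq_le_sq' key hpos).2

theorem reg_re (M : ℝ) {z : ℂ} (hz : (M : ℂ) ^ 2 + z ^ 2 ≠ 0) :
    (reg M z).re = √‖(M : ℂ) ^ 2 + z ^ 2‖ *
      (Real.log ‖(M : ℂ) ^ 2 + z ^ 2‖ * Real.cos (((M : ℂ) ^ 2 + z ^ 2).arg / 2) -
        ((M : ℂ) ^ 2 + z ^ 2).arg * Real.sin (((M : ℂ) ^ 2 + z ^ 2).arg / 2)) := by
  rw [reg]
  set w := (M : ℂ) ^ 2 + z ^ 2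
  have h1 : (Complex.log w / 2).re = Real.log ‖w‖ / 2 := by
    simp [Complex.log_re]
  have h2 : (Complex.log w / 2).im = w.arg / 2 := by
    simp [Complex.log_im]
  rw [Complex.mul_re, Complex.exp_re, Complex.exp_im, h1, h2, Complex.log_re, Complex.log_im,
    ← Real.log_sqrt (norm_nonneg _), Real.exp_log (Real.sqrt_pos.2 (norm_pos_iff.2 hz))]
  ring

theorem reg_lower {A B M : ℝ} (hM : 2 * A ^ 2 + 1 ≤ M ^ 2) {b : ℝ} (hb : 0 ≤ b) :
    ∃ K, ∀ z : ℂ, |z.im| ≤ A + B * |z.re| → b * |z.re| - K ≤ (reg M z).re := by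
  set κ := 1 / (2 * (B ^ 2 + 1)) with hκ
  have hκ0 : 0 < κ := by positivity
  set R := Real.exp ((2 * b + Real.pi) / κ) with hR
  have hR1 : 1 ≤ R := Real.one_le_exp (by have := Real.pi_pos; positivity)
  refine ⟨(2 * b + Real.pi) * R + 2, fun z hz => ?_⟩
  have hs := sq_mem_slitPlane hM hz
  have hcos := cos_half_arg_le hM hz
  have hw0 := Complex.slitPlane_ne_zero hs
  rw [reg_re M hw0]
  set w := (M : ℂ) ^ 2 + z ^ 2 with hw
  have hr : 0 < ‖w‖ := norm_pos_iff.2 hw0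
  set x := √‖w‖ with hx
  have hx0 : 0 < x := Real.sqrt_pos.2 hr
  have hxx : x ^ 2 = ‖w‖ := Real.sq_sqrt hr.le
  have hlog : Real.log ‖w‖ = 2 * Real.log x := by rw [← hxx, Real.log_pow]; norm_num
  have hargsin : w.arg * Real.sin (w.arg / 2) ≤ Real.pi := by
    calc _ ≤ |w.arg * Real.sin (w.arg / 2)| := le_abs_self _
      _ = |w.arg| * |Real.sin (w.arg / 2)| := abs_mul _ _
      _ ≤ Real.pi * 1 := by
        gcongr
        · exact Complex.abs_arg_le_pi w
        · exact Real.abs_sin_le_one _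
      _ = _ := mul_one _
  have hy : |z.re| ≤ 2 * x := by
    have h1 : z.re ^ 2 ≤ 4 * ‖w‖ := by
      have hre : w.re = M ^ 2 + z.re ^ 2 - z.im ^ 2 := sq_re M z
      have him : w.im = 2 * z.re * z.im := sq_im M z
      rcases le_or_gt (2 * |z.im|) |z.re| with h | h
      · have h2 : 4 * z.im ^ 2 ≤ z.re ^ 2 := by
          rw [← sq_abs z.im, ← sq_abs z.re]; nlinarith [abs_nonneg z.im]
        have h3 := (le_abs_self _).trans (Complex.abs_re_le_norm w)
        nlinarith [sq_nonneg M]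
      · have h2 : z.re ^ 2 ≤ |w.im| := by
          rw [him, abs_mul, abs_mul, abs_two, ← sq_abs z.re]
          nlinarith [abs_nonneg z.re]
        have h3 := Complex.abs_im_le_norm w
        linarith
    rw [← hxx] at h1
    exact abs_le_of_sq_le_sq (by nlinarith) (by positivity)
  have hpi := Real.pi_pos
  have hmain : 2 * b * x - ((2 * b + Real.pi) * R + 2) ≤
      x * (Real.log ‖w‖ * Real.cos (w.arg / 2) - w.arg * Real.sin (w.arg / 2)) := by
    rw [hlog]
    have hxp : x * (w.arg * Real.sin (w.arg / 2)) ≤ x * Real.pi := by gcongr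
    rcases le_or_gt x R with h | h
    · have h2 : x * Real.pi + 2 * b * x ≤ (2 * b + Real.pi) * R := by nlinarith
      have h3 : -2 ≤ x * (2 * Real.log x * Real.cos (w.arg / 2)) := by
        rcases le_or_gt 1 x with h4 | h4
        · have h5 := Real.log_nonneg h4
          have : 0 ≤ x * (2 * Real.log x * Real.cos (w.arg / 2)) := by
            have := hκ0.trans_le hcos
            positivity
          linarith
        · have h5 := Real.log_neg hx0 h4
          have h6 : -1 ≤ x * Real.log x := by
            have h7 := Real.one_sub_inv_le_log_of_pos hx0
            have h8 : x * (1 - x⁻¹) ≤ x * Real.log x := by gcongr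
            have h9 : x * (1 - x⁻¹) = x - 1 := by field_simp
            linarith
          have h7 : Real.cos (w.arg / 2) ≤ 1 := Real.cos_le_one _
          nlinarith [mul_pos_of_neg_of_neg h5 (neg_lt_zero.2 hx0)]
      nlinarith
    · have h2 : (2 * b + Real.pi) / κ ≤ Real.log x := by
        rw [Real.le_log_iff_exp_le hx0]; exact h.le
      have h3 : 2 * b + Real.pi ≤ κ * Real.log x := by
        rw [div_le_iff₀ hκ0] at h2; linarith
      have h4 : 0 ≤ Real.log x := Real.log_nonneg (hR1.trans h.le)
      have h5 : κ * Real.log x ≤ Real.log x * Real.cos (w.arg / 2) := by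
        rw [mul_comm]; gcongr
      have h6 : x * (2 * b + Real.pi) ≤ x * (2 * Real.log x * Real.cos (w.arg / 2)) := by
        gcongr
        nlinarith
      nlinarith
  have : b * |z.re| ≤ 2 * b * x := by nlinarith
  linarith

theorem contDiffAt_reg {n : ℕ∞ω} {M : ℝ} {z : ℂ} (hz : (M : ℂ) ^ 2 + z ^ 2 ∈ Complex.slitPlane) :
    ContDiffAt ℂ n (reg M) z := by
  have h1 : ContDiffAt ℂ n (fun z : ℂ => (M : ℂ) ^ 2 + z ^ 2) z := by fun_prop
  have h2 : ContDiffAt ℂ n (fun z : ℂ => Complex.log ((M : ℂ) ^ 2 + z ^ 2)) z :=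
    ContDiffAt.comp (g := Complex.log) z (Complex.contDiffAt_log hz) h1
  exact ((h2.div_const 2).cexp).mul h2

section Limit
variable {ι : Type} [Fintype ι] [DecidableEq ι]

/-- The affine function `c + ∑ k_v s_v` with real coefficients. -/
def affR (k : ι → ℝ) (c : ℝ) (s : ι → ℝ) : ℝ := c + ∑ v, k v * s v

/-- The affine function `c + ∑ k_v z_v` on the complex space. -/
def affC (k : ι → ℝ) (c : ℝ) (z : ι → ℂ) : ℂ := c + ∑ v, (k v : ℂ) * z v

theorem affC_ofReal (k : ι → ℝ) (c : ℝ) (s : ι → ℝ) :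
    affC k c (fun v => (s v : ℂ)) = (affR k c s : ℝ) := by
  simp [affC, affR]

theorem affC_deform (k : ι → ℝ) (c : ℝ) (η : (ι → ℝ) → (ι → ℝ)) (t : ℝ) (s : ι → ℝ) :
    affC k c (deform η t s) = (affR k c s : ℝ) + ((t * affR k 0 (η s) : ℝ) : ℂ) * Complex.I := by
  simp only [affC, affR, deform, zero_add]
  push_cast
  simp_rw [Finset.mul_sum, Finset.sum_mul, mul_add, Finset.sum_add_distrib]
  rw [add_assoc]
  congr 2
  exact Finset.sum_congr rfl fun v _ => by ring

theorem contDiff_affC (k : ι → ℝ) (c : ℝ) {n : ℕ∞ω} : ContDiff ℂ n (affC k c) := by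
  unfold affC; fun_prop

theorem abs_affR_le (k : ι → ℝ) (s : ι → ℝ) : |affR k 0 s| ≤ (∑ v, |k v|) * ‖s‖ := by
  rw [affR, zero_add, Finset.sum_mul]
  refine (Finset.abs_sum_le_sum_abs _ _).trans (Finset.sum_le_sum fun v _ => ?_)
  rw [abs_mul]
  exact mul_le_mul_of_nonneg_left (norm_le_pi_norm s v) (abs_nonneg _)

theorem affR_sub (k : ι → ℝ) (c : ℝ) (s s' : ι → ℝ) :
    affR k c s - affR k c s' = affR k 0 (s - s') := by
  simp [affR, mul_sub, Finset.sum_sub_distrib]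

/-- Along a slight contour the imaginary part of the exponent of each exponential is controlled by
its real part. -/
theorem cone_of_slight {k : ι → ℝ} {c : ℝ} (hk : k ≠ 0) {η : (ι → ℝ) → (ι → ℝ)}
    (hη : ContDiff ℝ ∞ η) {L K : ℝ} (hL : ∀ s, ‖fderiv ℝ η s‖ ≤ L)
    (hK : ∀ t ∈ Set.Icc (0 : ℝ) 1, ∀ s, -K ≤ (Complex.exp (affC k c (deform η t s))).re) :
    ∃ A B : ℝ, 0 ≤ A ∧ 0 ≤ B ∧ ∀ s, |affR k 0 (η s)| ≤ A + B * |affR k c s| := by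
  obtain ⟨v₀, hv₀⟩ := Function.ne_iff.1 hk
  have hv : k v₀ ≠ 0 := hv₀
  set e : ι → ℝ := Pi.single v₀ (k v₀)⁻¹ with he
  have hke : ∀ x : ℝ, affR k 0 (x • e) = x := by
    intro x
    rw [affR, zero_add, Finset.sum_eq_single v₀]
    · simp [he]; field_simp
    · intro v _ h; simp [he, h]
    · simp
  have hL0 : 0 ≤ L := (norm_nonneg _).trans (hL 0)
  set S := ∑ v, |k v| with hS
  have hS0 : 0 ≤ S := Finset.sum_nonneg fun _ _ => abs_nonneg _
  set T := |K| with hT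
  have hre : ∀ t s, (Complex.exp (affC k c (deform η t s))).re =
      Real.exp (affR k c s) * Real.cos (t * affR k 0 (η s)) := by
    intro t s
    rw [affC_deform, Complex.exp_re]
    simp
  have hhigh : ∀ s, T ≤ affR k c s → |affR k 0 (η s)| ≤ Real.pi := by
    intro s hs
    by_contra! h
    have h0 : 0 < |affR k 0 (η s)| := Real.pi_pos.trans h
    have h1 := hK (Real.pi / |affR k 0 (η s)|) ⟨by positivity, (div_le_one h0).2 h.le⟩ s
    rw [hre] at h1
    have h2 : Real.cos (Real.pi / |affR k 0 (η s)| * affR k 0 (η s)) = -1 := by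
      rw [← Real.cos_abs, abs_mul, abs_div, abs_abs, div_mul_cancel₀ _ h0.ne',
        abs_of_pos Real.pi_pos, Real.cos_pi]
    rw [h2] at h1
    have h3 := Real.add_one_le_exp (affR k c s)
    have h4 := le_abs_self K
    linarith
  refine ⟨Real.pi + S * L * ‖e‖ * T, S * L * ‖e‖, by have := Real.pi_pos; positivity, by positivity,
    fun s => ?_⟩
  rcases le_or_gt T (affR k c s) with h | h
  · have := hhigh s h
    have h1 : 0 ≤ S * L * ‖e‖ * T := by positivity
    have h2 : 0 ≤ S * L * ‖e‖ * |affR k c s| := by positivity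
    linarith
  · set x := T - affR k c s with hx
    have h1 : affR k c (s + x • e) = T := by
      have := affR_sub k c (s + x • e) s
      rw [add_sub_cancel_left, hke] at this
      linarith
    have h2 := hhigh _ h1.ge
    have h3 := abs_affR_le k (η s - η (s + x • e))
    have h4 := norm_le_of_fderiv_le hη hL s (s + x • e)
    have h5 : ‖s - (s + x • e)‖ = |x| * ‖e‖ := by
      rw [sub_add_cancel_left, norm_neg, norm_smul, Real.norm_eq_abs]
    rw [h5] at h4
    have h6 : |x| ≤ T + |affR k c s| := by
      rw [hx]
      refine (abs_sub _ _).trans ?_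
      rw [hT, abs_abs]
    have h7 : |affR k 0 (η s)| ≤ |affR k 0 (η (s + x • e))| +
        |affR k 0 (η s - η (s + x • e))| := by
      rw [← affR_sub k 0]
      have := abs_sub_abs_le_abs_sub (affR k 0 (η s)) (affR k 0 (η (s + x • e)))
      linarith
    have h8 : S * ‖η s - η (s + x • e)‖ ≤ S * (L * ((T + |affR k c s|) * ‖e‖)) := by
      gcongr
      exact h4.trans (by gcongr)
    nlinarith

/-- The regularized integral over the real space converges to the integral over any admissible
contour. -/
theorem tendsto_integral_regularized {α : Type*} (S : Finset α) (k : α → ι → ℝ) (c : α → ℝ)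
    (hk : ∀ a ∈ S, k a ≠ 0)
    (hproper : ∃ C, ∀ s, ‖s‖ ≤ C * (1 + ∑ a ∈ S, |affR (k a) (c a) s|))
    {f : (ι → ℂ) → ℂ} (hf : ContDiff ℂ 1 f) {η : (ι → ℝ) → (ι → ℝ)} (hη : ContDiff ℝ ∞ η)
    (hslope : ∃ L, ∀ s, ‖fderiv ℝ η s‖ ≤ L)
    (hslight : ∃ K, ∀ a ∈ S, ∀ t ∈ Set.Icc (0 : ℝ) 1, ∀ s,
      -K ≤ (Complex.exp (affC (k a) (c a) (deform η t s))).re)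
    (hdecay : ∃ K c : ℝ, 0 < c ∧ ∀ s, ‖f (deform η 1 s)‖ ≤ K * Real.exp (-c * ‖s‖))
    (hgrowth : ∃ K B : ℝ, ∀ t ∈ Set.Icc (0 : ℝ) 1, ∀ s,
      ‖f (deform η t s)‖ ≤ K * Real.exp (B * ‖s‖)) :
    ∃ M₀ : ℝ, ∀ M, M₀ ≤ M → Tendsto (fun ε : ℝ => ∫ s : ι → ℝ, f (fun v => (s v : ℂ)) *
      Complex.exp (-(ε : ℂ) * ∑ a ∈ S, reg M (affR (k a) (c a) s : ℝ))) (𝓝[>] 0)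
      (𝓝 (contourIntegral η f)) := by
  obtain ⟨L, hL⟩ := hslope
  obtain ⟨K, hK⟩ := hslight
  obtain ⟨Kd, cd, hcd, hKd⟩ := hdecay
  obtain ⟨Kg, B, hKg⟩ := hgrowth
  obtain ⟨C', hC'⟩ := hproper
  obtain ⟨C, hC0, hC⟩ : ∃ C > 0, ∀ s, ‖s‖ ≤ C * (1 + ∑ a ∈ S, |affR (k a) (c a) s|) := by
    refine ⟨|C'| + 1, by positivity, fun s => (hC' s).trans ?_⟩
    have : 0 ≤ ∑ a ∈ S, |affR (k a) (c a) s| := Finset.sum_nonneg fun _ _ => abs_nonneg _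
    gcongr
    exact (le_abs_self _).trans (by linarith)
  have hcone : ∀ a : α, ∃ AB : ℝ × ℝ, 0 ≤ AB.1 ∧ 0 ≤ AB.2 ∧ (a ∈ S → ∀ s,
      |affR (k a) 0 (η s)| ≤ AB.1 + AB.2 * |affR (k a) (c a) s|) := by
    intro a
    by_cases ha : a ∈ S
    · obtain ⟨A, B, hA, hB, h⟩ := cone_of_slight (hk a ha) hη hL (hK a ha)
      exact ⟨⟨A, B⟩, hA, hB, fun _ => h⟩
    · exact ⟨0, le_rfl, le_rfl, fun h => absurd h ha⟩
  choose AB hA0 hB0 hAB using hcone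
  set A₁ := ∑ a ∈ S, (AB a).1 with hA₁
  set B₁ := ∑ a ∈ S, (AB a).2 with hB₁
  have hcone : ∀ a ∈ S, ∀ t ∈ Set.Icc (0 : ℝ) 1, ∀ s,
      |(affC (k a) (c a) (deform η t s)).im| ≤ A₁ + B₁ * |(affC (k a) (c a) (deform η t s)).re| := by
    intro a ha t ht s
    rw [affC_deform]
    have h1 := hAB a ha s
    have h2 : (AB a).1 ≤ A₁ := Finset.single_le_sum (f := fun a => (AB a).1) (fun b _ => hA0 b) ha
    have h3 : (AB a).2 ≤ B₁ := Finset.single_le_sum (f := fun a => (AB a).2) (fun b _ => hB0 b) ha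
    have h4 : |t * affR (k a) 0 (η s)| ≤ |affR (k a) 0 (η s)| := by
      rw [abs_mul, abs_of_nonneg ht.1]
      exact mul_le_of_le_one_left (abs_nonneg _) ht.2
    have h5 : (AB a).2 * |affR (k a) (c a) s| ≤ B₁ * |affR (k a) (c a) s| := by gcongr
    simp only [Complex.add_im, Complex.ofReal_im, Complex.mul_im, Complex.I_re, Complex.I_im,
      Complex.ofReal_re, Complex.add_re, Complex.mul_re]
    simp only [mul_zero, mul_one, zero_add, add_zero, sub_zero]
    linarith
  have hre : ∀ a t s, (affC (k a) (c a) (deform η t s)).re = affR (k a) (c a) s := by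
    intro a t s
    rw [affC_deform]; simp
  refine ⟨A₁ ^ 2 * 2 + 1, fun M hM => ?_⟩
  have hM2 : 2 * A₁ ^ 2 + 1 ≤ M ^ 2 := by nlinarith [sq_nonneg A₁]
  set h : (ι → ℂ) → ℂ := fun z => ∑ a ∈ S, reg M (affC (k a) (c a) z) with hh
  set U : Set (ι → ℂ) := {z | ∀ a ∈ S, (M : ℂ) ^ 2 + affC (k a) (c a) z ^ 2 ∈ Complex.slitPlane}
    with hU
  have hUo : IsOpen U := by
    have : U = ⋂ a ∈ S, {z | (M : ℂ) ^ 2 + affC (k a) (c a) z ^ 2 ∈ Complex.slitPlane} := by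
      ext z; simp [hU]
    rw [this]
    refine isOpen_biInter_finset fun a _ => Complex.isOpen_slitPlane.preimage ?_
    have := (contDiff_affC (k a) (c a) (n := 0)).continuous
    fun_prop
  have hmem : ∀ t ∈ Set.Icc (0 : ℝ) 1, ∀ s, deform η t s ∈ U := fun t ht s a ha =>
    sq_mem_slitPlane hM2 (hcone a ha t ht s)
  have hhd : ContDiffOn ℂ 1 h U := by
    intro z hz
    refine ContDiffAt.contDiffWithinAt ?_
    refine ContDiffAt.sum fun a ha => ?_
    exact (contDiffAt_reg (hz a ha)).comp z (contDiff_affC (k a) (c a)).contDiffAt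
  set F : ℝ → (ι → ℂ) → ℂ := fun ε z => f z * Complex.exp (-(ε : ℂ) * h z) with hF
  have hFd : ∀ ε, ContDiffOn ℂ 1 (F ε) U := fun ε =>
    hf.contDiffOn.mul (contDiffOn_const.mul hhd).cexp
  have hlow : ∀ b : ℝ, 0 ≤ b → ∃ K, ∀ t ∈ Set.Icc (0 : ℝ) 1, ∀ s,
      b * ‖s‖ - K ≤ (h (deform η t s)).re := by
    intro b hb
    obtain ⟨K₁, hK₁⟩ := reg_lower (B := B₁) hM2 (b := b * C) (by positivity)
    refine ⟨b * C + S.card • K₁, fun t ht s => ?_⟩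
    have h1 : ∑ a ∈ S, (b * C * |affR (k a) (c a) s| - K₁) ≤ (h (deform η t s)).re := by
      rw [hh, Complex.re_sum]
      refine Finset.sum_le_sum fun a ha => ?_
      have := hK₁ _ (hcone a ha t ht s)
      rwa [hre] at this
    rw [Finset.sum_sub_distrib, ← Finset.mul_sum, Finset.sum_const] at h1
    have h2 : b * ‖s‖ ≤ b * (C * (1 + ∑ a ∈ S, |affR (k a) (c a) s|)) := by
      have := hC s
      gcongr
    linarith
  have hnorm : ∀ ε z, ‖F ε z‖ = ‖f z‖ * Real.exp (-(ε * (h z).re)) := by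
    intro ε z
    rw [hF, norm_mul, Complex.norm_exp]
    simp
  have hint : ∀ ε : ℝ, 0 < ε → contourIntegral η (F ε) = ∫ s : ι → ℝ, F ε fun v => (s v : ℂ) := by
    intro ε hε
    obtain ⟨K₂, hK₂⟩ := hlow ((|B| + 1) / ε) (by positivity)
    refine contourIntegral_eq_integral hUo (hFd ε) hη hL hmem (K := Kg * Real.exp (ε * K₂))
      (c := 1) one_pos fun t ht s => ?_
    rw [hnorm]
    have h1 : (|B| + 1) * ‖s‖ - ε * K₂ ≤ ε * (h (deform η t s)).re := by
      have := mul_le_mul_of_nonneg_left (hK₂ t ht s) hε.le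
      rw [mul_sub, ← mul_assoc, mul_div_cancel₀ _ hε.ne'] at this
      exact this
    have hKg0 : 0 ≤ Kg * Real.exp (B * ‖s‖) := (norm_nonneg _).trans (hKg t ht s)
    have hKg1 : 0 ≤ Kg := nonneg_of_mul_nonneg_left hKg0 (Real.exp_pos _)
    calc _ ≤ Kg * Real.exp (B * ‖s‖) * Real.exp (-(ε * (h (deform η t s)).re)) := by
          gcongr; exact hKg t ht s
      _ = Kg * Real.exp (B * ‖s‖ + -(ε * (h (deform η t s)).re)) := by
          rw [mul_assoc, ← Real.exp_add]
      _ ≤ Kg * Real.exp (ε * K₂ + -1 * ‖s‖) := by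
          refine mul_le_mul_of_nonneg_left (Real.exp_le_exp.2 ?_) hKg1
          have : B * ‖s‖ ≤ |B| * ‖s‖ := by gcongr; exact le_abs_self B
          linarith
      _ = _ := by rw [Real.exp_add, mul_assoc]
  have hlim : Tendsto (fun ε => contourIntegral η (F ε)) (𝓝[>] 0) (𝓝 (contourIntegral η f)) := by
    obtain ⟨K₃, hK₃⟩ := hlow 0 le_rfl
    refine tendsto_integral_filter_of_dominated_convergence (fun s => Kd * Real.exp (-cd * ‖s‖) *
      Real.exp |K₃| * (Fintype.card (Equiv.Perm ι) * (1 + L) ^ Fintype.card ι)) ?_ ?_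
      ((((integrable_exp_neg_norm hcd).const_mul Kd).mul_const _).mul_const _)
      (ae_of_all _ fun s => ?_)
    · exact Eventually.of_forall fun ε => (continuous_contourIntegrand (hFd ε).continuousOn hη
        (hmem 1 (by simp))).aestronglyMeasurable
    · have h1 : ∀ᶠ ε : ℝ in 𝓝[>] 0, ε < 1 :=
        eventually_nhdsWithin_of_eventually_nhds (eventually_lt_nhds one_pos)
      filter_upwards [h1, self_mem_nhdsWithin] with ε hε1 hε0
      have hε0' : 0 < ε := hε0
      refine ae_of_all _ fun s => ?_
      rw [contourIntegrand, norm_mul, hnorm]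
      have h2 := hK₃ 1 (by simp) s
      have h3 : -(ε * (h (deform η 1 s)).re) ≤ |K₃| := by
        have h4 : ε * -(h (deform η 1 s)).re ≤ ε * |K₃| := by
          gcongr
          exact le_trans (by linarith) (le_abs_self K₃)
        have h5 : ε * |K₃| ≤ |K₃| := mul_le_of_le_one_left (abs_nonneg _) hε1.le
        linarith
      refine mul_le_mul ?_ (norm_jacobian_le (hL s)) (norm_nonneg _) ?_
      · exact mul_le_mul (hKd s) (Real.exp_le_exp.2 h3) (Real.exp_pos _).le
          ((norm_nonneg _).trans (hKd s))
      · have := (norm_nonneg _).trans (hKd s)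
        positivity
    · have h1 : Tendsto (fun ε : ℝ => contourIntegrand η (F ε) s) (𝓝 0)
          (𝓝 (contourIntegrand η (F 0) s)) := by
        refine Continuous.tendsto ?_ 0
        unfold contourIntegrand
        simp only [hF]
        fun_prop
      have h2 : contourIntegrand η (F 0) s = contourIntegrand η f s := by
        simp [contourIntegrand, hF]
      rw [h2] at h1
      exact h1.mono_left nhdsWithin_le_nhds
  refine hlim.congr' ?_
  filter_upwards [self_mem_nhdsWithin] with ε hε
  rw [hint ε hε]
  simp only [hF, hh, affC_ofReal]

end Limit

section Growth
variable {ι : Type} [Fintype ι] [DecidableEq ι]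

/-- `exp (∑ q_v z_v - ∑_{a ∈ S} w_a exp (ℓ_a(z)))` for real affine functions `ℓ_a`. -/
def expSum {α : Type*} (S : Finset α) (k : α → ι → ℝ) (c w : α → ℝ) (q : ι → ℂ) (z : ι → ℂ) : ℂ :=
  Complex.exp (∑ v, q v * z v - ∑ a ∈ S, (w a : ℂ) * Complex.exp (affC (k a) (c a) z))

theorem contDiff_expSum {α : Type*} (S : Finset α) (k : α → ι → ℝ) (c w : α → ℝ) (q : ι → ℂ)
    {n : ℕ∞ω} : ContDiff ℂ n (expSum S k c w q) := by
  unfold expSum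
  have := fun a => contDiff_affC (k a) (c a) (n := n)
  fun_prop

theorem expSum_growth {α : Type*} (S : Finset α) (k : α → ι → ℝ) (c w : α → ℝ)
    (hw : ∀ a ∈ S, 0 ≤ w a) (q : ι → ℂ) {η : (ι → ℝ) → (ι → ℝ)} (hη : ContDiff ℝ ∞ η)
    (hslope : ∃ L, ∀ s, ‖fderiv ℝ η s‖ ≤ L)
    (hslight : ∃ K, ∀ a ∈ S, ∀ t ∈ Set.Icc (0 : ℝ) 1, ∀ s,
      -K ≤ (Complex.exp (affC (k a) (c a) (deform η t s))).re) :
    ∃ K B : ℝ, ∀ t ∈ Set.Icc (0 : ℝ) 1, ∀ s,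
      ‖expSum S k c w q (deform η t s)‖ ≤ K * Real.exp (B * ‖s‖) := by
  obtain ⟨L, hL⟩ := hslope
  obtain ⟨K, hK⟩ := hslight
  have hL0 : 0 ≤ L := (norm_nonneg _).trans (hL 0)
  set Q := ∑ v, ‖q v‖ with hQ
  have hQ0 : 0 ≤ Q := Finset.sum_nonneg fun _ _ => norm_nonneg _
  refine ⟨Real.exp (Q * ‖η 0‖ + ∑ a ∈ S, w a * K), Q * (1 + L), fun t ht s => ?_⟩
  rw [expSum, Complex.norm_exp, ← Real.exp_add, Complex.sub_re, Complex.re_sum S]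
  refine Real.exp_le_exp.2 ?_
  have h1 : (∑ v, q v * deform η t s v).re ≤ Q * (‖s‖ + ‖η s‖) := by
    refine (Complex.re_le_norm _).trans ((norm_sum_le _ _).trans ?_)
    rw [hQ, Finset.sum_mul]
    refine Finset.sum_le_sum fun v _ => ?_
    rw [norm_mul]
    refine mul_le_mul_of_nonneg_left ((norm_add_le _ _).trans (add_le_add ?_ ?_)) (norm_nonneg _)
    · rw [Complex.norm_real]; exact norm_le_pi_norm s v
    · rw [norm_mul, Complex.norm_I, one_mul, Complex.norm_real, norm_mul, Real.norm_eq_abs,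
        abs_of_nonneg ht.1]
      exact (mul_le_of_le_one_left (norm_nonneg _) ht.2).trans (norm_le_pi_norm (η s) v)
  have h2 : ‖η s‖ ≤ ‖η 0‖ + L * ‖s‖ := by
    have h4 := norm_le_of_fderiv_le hη hL s 0
    have h5 := norm_le_norm_add_norm_sub' (η s) (η 0)
    rw [sub_zero] at h4
    linarith
  have h3 : -∑ a ∈ S, w a * K ≤
      ∑ a ∈ S, ((w a : ℂ) * Complex.exp (affC (k a) (c a) (deform η t s))).re := by
    rw [← Finset.sum_neg_distrib]
    refine Finset.sum_le_sum fun a ha => ?_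
    rw [Complex.re_ofReal_mul]
    have := mul_le_mul_of_nonneg_left (hK a ha t ht s) (hw a ha)
    linarith
  nlinarith
end Growth

/-! ### The Gamma integral over a deformed line -/

/-- A smooth function close to `min u 0`. -/
def ramp (u : ℝ) : ℝ := -Real.log (1 + Real.exp (-u))

theorem hasDerivAt_ramp (u : ℝ) : HasDerivAt ramp (1 / (1 + Real.exp u)) u := by
  have h1 : HasDerivAt (fun u : ℝ => 1 + Real.exp (-u)) (Real.exp (-u) * -1) u :=
    ((hasDerivAt_neg u).exp).const_add 1
  have h2 := (h1.log (by positivity)).neg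
  refine h2.congr_deriv ?_
  rw [Real.exp_neg]
  field_simp
  rw [add_comm]

theorem contDiff_ramp {n : ℕ∞ω} : ContDiff ℝ n ramp := by
  unfold ramp
  refine ContDiff.neg (ContDiff.log (by fun_prop) fun u => by positivity)

theorem ramp_sub_le (u : ℝ) (hu : u ≤ 0) : |ramp u - u| ≤ 1 := by
  have h1 : ramp u - u = -Real.log (1 + Real.exp u) := by
    have : 1 + Real.exp (-u) = Real.exp (-u) * (1 + Real.exp u) := by
      rw [mul_add, ← Real.exp_add]; simp [add_comm]
    rw [ramp, this, Real.log_mul (by positivity) (by positivity), Real.log_exp]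
    ring
  have h2 : Real.exp u ≤ 1 := Real.exp_le_one_iff.2 hu
  have h3 := Real.log_le_sub_one_of_pos (x := 1 + Real.exp u) (by positivity)
  have h4 := Real.log_nonneg (x := 1 + Real.exp u) (by have := Real.exp_pos u; linarith)
  rw [h1, abs_neg, abs_of_nonneg h4]
  linarith

theorem abs_ramp_le (u : ℝ) : |ramp u| ≤ Real.exp (-u) := by
  have h3 := Real.log_le_sub_one_of_pos (x := 1 + Real.exp (-u)) (by positivity)
  have h4 := Real.log_nonneg (x := 1 + Real.exp (-u)) (by have := Real.exp_pos (-u); linarith)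
  rw [ramp, abs_neg, abs_of_nonneg h4]
  linarith

theorem exp_mul_cos_ramp_le (κ t u : ℝ) (ht : t ∈ Set.Icc (0 : ℝ) 1) :
    -(κ ^ 2 + 1) ≤ Real.exp u * Real.cos (t * (κ * ramp u)) ∧
      (0 ≤ u → Real.exp u - κ ^ 2 ≤ Real.exp u * Real.cos (t * (κ * ramp u))) := by
  have h0 : 0 ≤ u → Real.exp u - κ ^ 2 ≤ Real.exp u * Real.cos (t * (κ * ramp u)) := by
    intro hu
    have h1 := Real.one_sub_sq_div_two_le_cos (x := t * (κ * ramp u))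
    have h2 : (t * (κ * ramp u)) ^ 2 ≤ κ ^ 2 * Real.exp (-u) ^ 2 := by
      rw [mul_pow, mul_pow]
      have h3 : t ^ 2 ≤ 1 := pow_le_one₀ ht.1 ht.2
      have h4 : ramp u ^ 2 ≤ Real.exp (-u) ^ 2 := by
        rw [← sq_abs (ramp u)]
        exact pow_le_pow_left₀ (abs_nonneg _) (abs_ramp_le u) 2
      calc _ ≤ 1 * (κ ^ 2 * Real.exp (-u) ^ 2) := by gcongr
        _ = _ := one_mul _
    have h5 : Real.exp u * Real.exp (-u) ^ 2 = Real.exp (-u) := by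
      rw [sq, ← mul_assoc, ← Real.exp_add]; simp
    have h6 : Real.exp (-u) ≤ 1 := Real.exp_le_one_iff.2 (by linarith)
    have h7 : Real.exp u * (1 - κ ^ 2 * Real.exp (-u) ^ 2 / 2) ≤
        Real.exp u * Real.cos (t * (κ * ramp u)) := by
      gcongr
      linarith
    have h8 : Real.exp u * (1 - κ ^ 2 * Real.exp (-u) ^ 2 / 2) =
        Real.exp u - κ ^ 2 / 2 * Real.exp (-u) := by
      linear_combination (-(κ ^ 2 / 2)) * h5
    have h9 : κ ^ 2 / 2 * Real.exp (-u) ≤ κ ^ 2 / 2 * 1 := by gcongr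
    nlinarith [sq_nonneg κ]
  refine ⟨?_, h0⟩
  rcases le_or_gt 0 u with hu | hu
  · have := h0 hu
    have := Real.exp_pos u
    linarith
  · have h1 := Real.neg_one_le_cos (t * (κ * ramp u))
    have h2 : Real.exp u ≤ 1 := Real.exp_le_one_iff.2 hu.le
    have h3 : Real.exp u * -1 ≤ Real.exp u * Real.cos (t * (κ * ramp u)) := by gcongr
    nlinarith [sq_nonneg κ]

/-- The decay of the integrand of the Gamma integral along the contour `u + i κ ramp(u)`. -/
theorem gamma_exponent_le {hbar : ℝ} (hh : 0 < hbar) {a b κ : ℝ} (hδ : 0 < a - κ * b) :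
    ∃ K c : ℝ, 0 < c ∧ ∀ u : ℝ, a * u - b * (κ * ramp u) -
      1 / hbar * (Real.exp u * Real.cos (κ * ramp u)) ≤ K - c * |u| := by
  set δ := a - κ * b with hδ'
  refine ⟨|b * κ| + 1 / hbar * (κ ^ 2 + 1) + (a + δ) ^ 2 * hbar / 2, δ, hδ, fun u => ?_⟩
  have hsq : 0 ≤ (a + δ) ^ 2 * hbar / 2 := by positivity
  obtain ⟨h1, h2⟩ := exp_mul_cos_ramp_le κ 1 u (by simp)
  rw [one_mul] at h1 h2
  have hb : 0 ≤ |b * κ| := abs_nonneg _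
  rcases le_or_gt 0 u with hu | hu
  · have h3 := h2 hu
    rw [abs_of_nonneg hu]
    have h4 := Real.quadratic_le_exp_of_nonneg hu
    have h5 : 1 / hbar * (u ^ 2 / 2 - κ ^ 2) ≤
        1 / hbar * (Real.exp u * Real.cos (κ * ramp u)) := by
      gcongr
      nlinarith
    have h6 : (a + δ) * u - 1 / hbar * (u ^ 2 / 2) ≤ (a + δ) ^ 2 * hbar / 2 := by
      have h7 : (a + δ) ^ 2 * hbar / 2 - ((a + δ) * u - 1 / hbar * (u ^ 2 / 2)) =
          1 / (2 * hbar) * (u - (a + δ) * hbar) ^ 2 := by field_simp; ring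
      have h8 : 0 ≤ 1 / (2 * hbar) * (u - (a + δ) * hbar) ^ 2 := by positivity
      linarith
    have h9 : -(b * (κ * ramp u)) ≤ |b * κ| := by
      have h10 := abs_ramp_le u
      have h11 : Real.exp (-u) ≤ 1 := Real.exp_le_one_iff.2 (by linarith)
      calc _ ≤ |b * (κ * ramp u)| := neg_le_abs _
        _ = |b * κ| * |ramp u| := by rw [← mul_assoc, abs_mul]
        _ ≤ |b * κ| * 1 := by gcongr; linarith
        _ = _ := mul_one _
    have h12 : 0 < 1 / hbar := by positivity
    nlinarith
  · rw [abs_of_neg hu]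
    have h3 := ramp_sub_le u hu.le
    have h4 : b * κ * (u - ramp u) ≤ |b * κ| := by
      calc _ ≤ |b * κ * (u - ramp u)| := le_abs_self _
        _ = |b * κ| * |ramp u - u| := by rw [abs_mul, abs_sub_comm]
        _ ≤ |b * κ| * 1 := by gcongr
        _ = _ := mul_one _
    have h5 : -(1 / hbar * (κ ^ 2 + 1)) ≤ 1 / hbar * (Real.exp u * Real.cos (κ * ramp u)) := by
      rw [← mul_neg]
      gcongr
    nlinarith

/-- The contour `u + i κ ramp(u)` in one variable. -/
def rampContour (κ : ℝ) : (Unit → ℝ) → (Unit → ℝ) := fun x _ => κ * ramp (x ())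

theorem contDiff_rampContour (κ : ℝ) : ContDiff ℝ ∞ (rampContour κ) :=
  contDiff_pi.2 fun _ => contDiff_const.mul (contDiff_ramp.comp (contDiff_apply ℝ ℝ ()))

theorem hasFDerivAt_rampContour (κ : ℝ) (x : Unit → ℝ) : HasFDerivAt (rampContour κ)
    ((κ * (1 / (1 + Real.exp (x ())))) • ContinuousLinearMap.id ℝ (Unit → ℝ)) x := by
  refine hasFDerivAt_pi'.2 fun i => ?_
  have h1 : HasFDerivAt (fun x : Unit → ℝ => x ())
      (ContinuousLinearMap.proj (R := ℝ) (φ := fun _ : Unit => ℝ) ()) x :=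
    (ContinuousLinearMap.proj (R := ℝ) (φ := fun _ : Unit => ℝ) ()).hasFDerivAt
  have h2 := ((hasDerivAt_ramp (x ())).comp_hasFDerivAt x h1).const_mul κ
  have h3 : ContinuousLinearMap.proj i ∘SL
      ((κ * (1 / (1 + Real.exp (x ())))) • ContinuousLinearMap.id ℝ (Unit → ℝ)) =
      κ • (1 / (1 + Real.exp (x ()))) •
        ContinuousLinearMap.proj (R := ℝ) (φ := fun _ : Unit => ℝ) () := by
    ext y
    simp [mul_assoc]
  rw [h3]
  exact h2

theorem rampContour_slope (κ : ℝ) (x : Unit → ℝ) : ‖fderiv ℝ (rampContour κ) x‖ ≤ |κ| := by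
  rw [(hasFDerivAt_rampContour κ x).fderiv, norm_smul, Real.norm_eq_abs, abs_mul]
  have h1 : |1 / (1 + Real.exp (x ()))| ≤ 1 := by
    have := Real.exp_pos (x ())
    rw [abs_of_pos (by positivity), div_le_one (by positivity)]
    linarith
  calc _ ≤ |κ| * 1 * 1 := by
        gcongr
        exact ContinuousLinearMap.norm_id_le
    _ = _ := by ring

theorem jacobian_rampContour (κ : ℝ) (x : Unit → ℝ) : jacobian (rampContour κ) x =
    1 + Complex.I * ((κ * (1 / (1 + Real.exp (x ()))) : ℝ) : ℂ) := by
  rw [jacobian, Matrix.det_unique, (hasFDerivAt_rampContour κ x).fderiv]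
  simp

/-- The integrand of the Gamma integral. -/
def gammaFn (hbar : ℝ) (s : ℂ) (z : ℂ) : ℂ :=
  Complex.exp (s * z - 1 / (hbar : ℂ) * Complex.exp z)

theorem norm_gammaFn_ramp (hbar : ℝ) (s : ℂ) (κ t u : ℝ) :
    ‖gammaFn hbar s ((u : ℂ) + Complex.I * ((t * (κ * ramp u) : ℝ) : ℂ))‖ =
      Real.exp (s.re * u - s.im * (t * (κ * ramp u)) -
        1 / hbar * (Real.exp u * Real.cos (t * (κ * ramp u)))) := by
  rw [gammaFn, Complex.norm_exp]
  congr 1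
  rw [mul_comm Complex.I, ← Complex.ofReal_one, ← Complex.ofReal_div, Complex.sub_re,
    Complex.re_ofReal_mul, Complex.exp_re, Complex.mul_re]
  simp

theorem gammaFn_decay {hbar : ℝ} (hh : 0 < hbar) {s : ℂ} {κ : ℝ} (hδ : 0 < s.re - κ * s.im) :
    ∃ K c : ℝ, 0 < c ∧ ∀ u : ℝ, ‖gammaFn hbar s ((u : ℂ) + Complex.I * ((κ * ramp u : ℝ) : ℂ))‖ ≤
      K * Real.exp (-c * |u|) := by
  obtain ⟨K, c, hc, h⟩ := gamma_exponent_le hh hδ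
  refine ⟨Real.exp K, c, hc, fun u => ?_⟩
  have h1 := norm_gammaFn_ramp hbar s κ 1 u
  simp only [one_mul] at h1
  rw [h1, ← Real.exp_add]
  refine Real.exp_le_exp.2 ?_
  have := h u
  linarith

/-- The Gamma integral over the contour `u + i κ ramp(u)`. -/
def gammaContour (hbar κ : ℝ) (s : ℂ) : ℂ :=
  contourIntegral (rampContour κ) fun z => gammaFn hbar s (z ())

theorem gammaContour_eq (hbar κ : ℝ) (s : ℂ) : gammaContour hbar κ s =
    ∫ u : ℝ, gammaFn hbar s ((u : ℂ) + Complex.I * ((κ * ramp u : ℝ) : ℂ)) *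
      (1 + Complex.I * ((κ * (1 / (1 + Real.exp u)) : ℝ) : ℂ)) := by
  rw [gammaContour, contourIntegral,
    ← (volume_preserving_funUnique Unit ℝ).integral_comp
      (MeasurableEquiv.funUnique Unit ℝ).measurableEmbedding]
  refine integral_congr_ae (ae_of_all _ fun x => ?_)
  simp only [contourIntegrand, jacobian_rampContour]
  congr 2
  simp only [deform, rampContour, one_mul]
  rfl

theorem rampContour_slight (κ : ℝ) : ∃ K : ℝ, ∀ t ∈ Set.Icc (0 : ℝ) 1, ∀ s : Unit → ℝ,
    -K ≤ (Complex.exp (deform (rampContour κ) t s ())).re := by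
  refine ⟨κ ^ 2 + 1, fun t ht s => ?_⟩
  have h1 := (exp_mul_cos_ramp_le κ t (s ()) ht).1
  rw [Complex.exp_re]
  simpa [deform, rampContour] using h1

theorem affC_unit (z : Unit → ℂ) : affC (fun _ => 1) 0 z = z () := by simp [affC]

theorem affR_unit (s : Unit → ℝ) : affR (fun _ => 1) 0 s = s () := by simp [affR]

theorem norm_unit (s : Unit → ℝ) : ‖s‖ = |s ()| := by
  rw [← Real.norm_eq_abs]
  refine le_antisymm ((pi_norm_le_iff_of_nonneg (norm_nonneg _)).2 fun _ => le_rfl)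
    (norm_le_pi_norm s ())

theorem tendsto_gammaContour {hbar : ℝ} (hh : 0 < hbar) {s : ℂ} {κ : ℝ}
    (hδ : 0 < s.re - κ * s.im) : ∃ M₀ : ℝ, ∀ M, M₀ ≤ M → Tendsto (fun ε : ℝ => ∫ u : ℝ,
      gammaFn hbar s u * Complex.exp (-(ε : ℂ) * reg M (u : ℂ))) (𝓝[>] 0)
      (𝓝 (gammaContour hbar κ s)) := by
  have hslope : ∃ L, ∀ x, ‖fderiv ℝ (rampContour κ) x‖ ≤ L := ⟨|κ|, rampContour_slope κ⟩
  have hslight : ∃ K : ℝ, ∀ a ∈ (Finset.univ : Finset Unit), ∀ t ∈ Set.Icc (0 : ℝ) 1,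
      ∀ s : Unit → ℝ, -K ≤ (Complex.exp (affC (fun _ => 1) 0 (deform (rampContour κ) t s))).re := by
    obtain ⟨K, hK⟩ := rampContour_slight κ
    exact ⟨K, fun _ _ t ht s => by rw [affC_unit]; exact hK t ht s⟩
  have hf : (fun z : Unit → ℂ => gammaFn hbar s (z ())) = expSum (Finset.univ : Finset Unit)
      (fun _ _ => 1) (fun _ => 0) (fun _ => 1 / hbar) (fun _ => s) := by
    ext z
    simp [expSum, gammaFn, affC_unit]
  obtain ⟨M₀, h⟩ := tendsto_integral_regularized (Finset.univ : Finset Unit) (fun _ _ => 1)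
    (fun _ => 0) (fun _ _ => fun h => one_ne_zero (congrFun h ()))
    ⟨1, fun s => by simp [norm_unit, affR]⟩ (f := fun z => gammaFn hbar s (z ()))
    (by rw [hf]; exact contDiff_expSum _ _ _ _ _) (contDiff_rampContour κ) hslope hslight
    (by
      obtain ⟨K, c, hc, h⟩ := gammaFn_decay hh hδ
      refine ⟨K, c, hc, fun x => ?_⟩
      have := h (x ())
      rw [norm_unit]
      simpa [deform, rampContour] using this)
    (by
      have := expSum_growth (Finset.univ : Finset Unit) (fun _ _ => 1) (fun _ => 0)
        (fun _ => 1 / hbar) (fun _ _ => by positivity) (fun _ => s) (contDiff_rampContour κ) hslope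
        hslight
      rwa [← hf] at this)
  refine ⟨M₀, fun M hM => ?_⟩
  refine (h M hM).congr fun ε => ?_
  rw [← (volume_preserving_funUnique Unit ℝ).integral_comp
      (MeasurableEquiv.funUnique Unit ℝ).measurableEmbedding]
  refine integral_congr_ae (ae_of_all _ fun x => ?_)
  simp [affR_unit]

theorem integral_gammaFn {hbar : ℝ} (hh : 0 < hbar) {s : ℂ} (hs : 0 < s.re) :
    ∫ u : ℝ, gammaFn hbar s u = (hbar : ℂ) ^ s * Complex.Gamma s := by
  have h1 := Complex.integral_cpow_mul_exp_neg_mul_Ioi (a := s) (r := 1 / hbar) hs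
    (by positivity)
  have h2 : (1 / ((1 / hbar : ℝ) : ℂ)) = (hbar : ℂ) := by push_cast; simp
  rw [h2] at h1
  rw [← h1, ← Real.range_exp, ← Set.image_univ,
    integral_image_eq_integral_abs_deriv_smul MeasurableSet.univ
      (fun x _ => (Real.hasDerivAt_exp x).hasDerivWithinAt) Real.exp_injective.injOn,
    Measure.restrict_univ]
  refine integral_congr_ae (ae_of_all _ fun u => ?_)
  simp only
  have h3 : ((Real.exp u : ℝ) : ℂ) ≠ 0 := by exact_mod_cast (Real.exp_pos u).ne'
  rw [Complex.cpow_def_of_ne_zero h3, ← Complex.ofReal_log (Real.exp_pos u).le, Real.log_exp,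
    abs_of_pos (Real.exp_pos u), Complex.real_smul, Complex.ofReal_exp, ← Complex.exp_add,
    ← Complex.exp_add, gammaFn]
  congr 1
  push_cast
  ring

theorem gammaContour_of_re_pos {hbar : ℝ} (hh : 0 < hbar) {s : ℂ} {κ : ℝ} (hs : 0 < s.re)
    (hδ : 0 < s.re - κ * s.im) :
    gammaContour hbar κ s = (hbar : ℂ) ^ s * Complex.Gamma s := by
  obtain ⟨M₁, h₁⟩ := tendsto_gammaContour hh hδ
  obtain ⟨M₂, h₂⟩ := tendsto_gammaContour hh (s := s) (κ := 0) (by simpa using hs)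
  have h3 := tendsto_nhds_unique (h₁ (max M₁ M₂) (le_max_left _ _))
    (h₂ (max M₁ M₂) (le_max_right _ _))
  rw [h3, gammaContour_eq, ← integral_gammaFn hh hs]
  simp

theorem integrable_gammaFn_ramp {hbar : ℝ} (hh : 0 < hbar) {s : ℂ} {κ : ℝ}
    (hδ : 0 < s.re - κ * s.im) {g : ℝ → ℂ} (hg : Continuous g) {C : ℝ} (hC : ∀ u, ‖g u‖ ≤ C) :
    Integrable fun u : ℝ => gammaFn hbar s ((u : ℂ) + Complex.I * ((κ * ramp u : ℝ) : ℂ)) * g u := by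
  obtain ⟨K, c, hc, h⟩ := gammaFn_decay hh hδ
  have h1 : Integrable fun u : ℝ => Real.exp (-c * |u|) := by
    have := integrable_exp_neg_norm (ι := Unit) hc
    rw [← (volume_preserving_funUnique Unit ℝ).integrable_comp_emb
      (MeasurableEquiv.funUnique Unit ℝ).measurableEmbedding]
    refine this.congr (ae_of_all _ fun x => ?_)
    simp only [norm_unit]
    rfl
  have hr : Continuous ramp := (contDiff_ramp (n := 0)).continuous
  refine ((h1.const_mul K).mul_const C).mono' ?_ (ae_of_all _ fun u => ?_)
  · refine Continuous.aestronglyMeasurable (Continuous.mul ?_ hg)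
    unfold gammaFn
    fun_prop
  · rw [norm_mul]
    exact mul_le_mul (h u) (hC u) (norm_nonneg _) ((norm_nonneg _).trans (h u))

theorem gammaContour_add_one {hbar : ℝ} (hh : 0 < hbar) {s : ℂ} {κ : ℝ}
    (hδ : 0 < s.re - κ * s.im) :
    s * gammaContour hbar κ s = 1 / (hbar : ℂ) * gammaContour hbar κ (s + 1) := by
  set z : ℝ → ℂ := fun u => (u : ℂ) + Complex.I * ((κ * ramp u : ℝ) : ℂ) with hz
  set z' : ℝ → ℂ := fun u => 1 + Complex.I * ((κ * (1 / (1 + Real.exp u)) : ℝ) : ℂ) with hz'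
  have hd : ∀ u, HasDerivAt z (z' u) u := by
    intro u
    have h1 : HasDerivAt (fun u : ℝ => (u : ℂ)) 1 u := by simpa using (hasDerivAt_id u).ofReal_comp
    exact h1.add ((((hasDerivAt_ramp u).const_mul κ).ofReal_comp).const_mul Complex.I)
  have hz'c : Continuous z' := by
    rw [hz']
    refine continuous_const.add (continuous_const.mul (Complex.continuous_ofReal.comp
      (continuous_const.mul (continuous_const.div (by fun_prop) fun u => by positivity))))
  have hz'b : ∀ u, ‖z' u‖ ≤ 1 + |κ| := by
    intro u
    rw [hz']
    refine (norm_add_le _ _).trans ?_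
    rw [norm_one, norm_mul, Complex.norm_I, one_mul, Complex.norm_real, norm_mul,
      Real.norm_eq_abs, Real.norm_eq_abs]
    have h1 : |1 / (1 + Real.exp u)| ≤ 1 := by
      have := Real.exp_pos u
      rw [abs_of_pos (by positivity), div_le_one (by positivity)]
      linarith
    nlinarith [abs_nonneg κ]
  have hδ1 : 0 < (s + 1).re - κ * (s + 1).im := by simp; linarith
  have hi0 := integrable_gammaFn_ramp hh hδ (continuous_const (y := (1 : ℂ))) (C := 1) (by simp)
  have hi1 := integrable_gammaFn_ramp hh hδ hz'c hz'b
  have hi2 := integrable_gammaFn_ramp hh hδ1 hz'c hz'b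
  have hexp : ∀ w : ℂ, gammaFn hbar (s + 1) w = Complex.exp w * gammaFn hbar s w := by
    intro w
    rw [gammaFn, gammaFn, ← Complex.exp_add]
    congr 1; ring
  have hder : ∀ u, HasDerivAt (fun u => gammaFn hbar s (z u) * 1)
      (s * (gammaFn hbar s (z u) * z' u) -
        1 / (hbar : ℂ) * (gammaFn hbar (s + 1) (z u) * z' u)) u := by
    intro u
    have h1 := (((hd u).const_mul s).sub (((hd u).cexp).const_mul (1 / (hbar : ℂ)))).cexp
    simp only [mul_one]
    refine h1.congr_deriv ?_
    rw [hexp, gammaFn]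
    simp only [Pi.sub_apply]
    ring
  have h := integral_eq_zero_of_hasDerivAt_of_integrable hder
    ((hi1.const_mul s).sub (hi2.const_mul (1 / (hbar : ℂ)))) hi0
  rw [integral_sub (hi1.const_mul s) (hi2.const_mul _), integral_const_mul, integral_const_mul,
    sub_eq_zero] at h
  rw [gammaContour_eq, gammaContour_eq]
  exact h

theorem gammaContour_eq_Gamma {hbar : ℝ} (hh : 0 < hbar) {κ : ℝ} (n : ℕ) : ∀ {s : ℂ},
    0 < s.re + n → 0 < s.re - κ * s.im →
    gammaContour hbar κ s = (hbar : ℂ) ^ s * Complex.Gamma s := by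
  induction n with
  | zero => intro s hs hδ; exact gammaContour_of_re_pos hh (by simpa using hs) hδ
  | succ n ih =>
    intro s hs hδ
    have hs0 : s ≠ 0 := by rintro rfl; simp at hδ
    have hb : (hbar : ℂ) ≠ 0 := by exact_mod_cast hh.ne'
    have h1 := ih (s := s + 1) (by push_cast at hs; simp; linarith) (by simp; linarith)
    have h2 := gammaContour_add_one hh hδ
    rw [h1, Complex.Gamma_add_one s hs0, Complex.cpow_add _ _ hb, Complex.cpow_one] at h2
    refine mul_left_cancel₀ hs0 (h2.trans ?_)
    field_simp

theorem exists_tilt {s : ℂ} (hs : 0 < s.re ∨ s.im ≠ 0) : ∃ κ : ℝ, 0 < s.re - κ * s.im := by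
  by_cases h : s.im = 0
  · exact ⟨0, by simpa [h] using hs⟩
  · refine ⟨(s.re - 1) / s.im, ?_⟩
    rw [div_mul_cancel₀ _ h]
    norm_num

/-- The regularized Gamma integral converges to the analytically continued Gamma function. -/
theorem tendsto_gamma {hbar : ℝ} (hh : 0 < hbar) {s : ℂ} (hs : 0 < s.re ∨ s.im ≠ 0) :
    ∃ M₀ : ℝ, ∀ M, M₀ ≤ M → Tendsto (fun ε : ℝ => ∫ u : ℝ,
      gammaFn hbar s u * Complex.exp (-(ε : ℂ) * reg M (u : ℂ))) (𝓝[>] 0)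
      (𝓝 ((hbar : ℂ) ^ s * Complex.Gamma s)) := by
  obtain ⟨κ, hκ⟩ := exists_tilt hs
  obtain ⟨n, hn⟩ := exists_nat_gt (-s.re)
  rw [← gammaContour_eq_Gamma hh n (by linarith) hκ]
  exact tendsto_gammaContour hh hκ

/-! ### The action of the one-parameter group of `H_1` -/

theorem mem_gz {N : ℕ} {p : ℕ × ℕ} : p ∈ gz N ↔ 1 ≤ p.2 ∧ p.2 ≤ p.1 ∧ p.1 < N := by
  simp only [gz, Finset.mem_filter, Finset.mem_product, Finset.mem_Icc]
  omega

theorem mem_rect {N m : ℕ} {p : ℕ × ℕ} :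
    p ∈ rect N m ↔ 1 ≤ p.2 ∧ p.2 ≤ p.1 ∧ p.1 < N ∧ p.2 ≤ m ∧ p.1 + m < N + p.2 := by
  simp only [rect, Finset.mem_filter, mem_gz]
  omega

theorem rect_subset_gz (N m : ℕ) : rect N m ⊆ gz N := Finset.filter_subset _ _

theorem pd_of_notMem {N : ℕ} {p : ℕ × ℕ} (h : p ∉ gz N) (f : Fn N) (z : gz N → ℂ) :
    pd p f z = 0 := dif_neg h

theorem pd_eq {N : ℕ} (p : gz N) (f : Fn N) (z : gz N → ℂ) :
    pd p.1 f z = fderiv ℂ f z (Pi.single p 1) := dif_pos p.2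

/-- The direction of translation generated by `H_1`. -/
def rectVec (N m : ℕ) : gz N → ℂ := fun p => if p.1 ∈ rect N m then 1 else 0

theorem sum_diag_eq {N m : ℕ} (hmN : m < N) (D : ℕ × ℕ → ℂ) :
    -∑ i ∈ Finset.Icc 1 m, ∑ k ∈ Finset.Icc 1 (i - 1), D (N + k - i, k) +
      ∑ i ∈ Finset.Icc 1 m, ∑ k ∈ Finset.Icc i (N - 1), D (k, i) = ∑ p ∈ rect N m, D p := by
  have h1 : ∑ i ∈ Finset.Icc 1 m, ∑ k ∈ Finset.Icc i (N - 1), D (k, i) =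
      ∑ p ∈ (gz N).filter (fun p => p.2 ≤ m), D p := by
    rw [Finset.sum_sigma']
    refine Finset.sum_bij' (fun a _ => (a.2, a.1)) (fun p _ => ⟨p.2, p.1⟩) ?_ ?_ ?_ ?_ ?_ <;>
      simp [mem_gz] <;> omega
  have h2 : ∑ i ∈ Finset.Icc 1 m, ∑ k ∈ Finset.Icc 1 (i - 1), D (N + k - i, k) =
      ∑ p ∈ ((gz N).filter (fun p => p.2 ≤ m)).filter (fun p => ¬ p.1 + m < N + p.2), D p := by
    rw [Finset.sum_sigma']
    refine Finset.sum_bij' (fun a _ => (N + a.2 - a.1, a.2)) (fun p _ => ⟨N + p.2 - p.1, p.2⟩)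
      ?_ ?_ ?_ ?_ ?_
    · simp [mem_gz]; omega
    · simp [mem_gz]; omega
    · rintro ⟨i, k⟩ h
      simp only [Finset.mem_sigma, Finset.mem_Icc] at h
      simp only [Sigma.mk.injEq, heq_eq_eq, and_true]
      omega
    · rintro ⟨n, k⟩ h
      simp only [Finset.mem_filter, mem_gz] at h
      simp only [Prod.mk.injEq, and_true]
      omega
    · simp
  rw [h1, h2, ← Finset.sum_filter_add_sum_filter_not ((gz N).filter (fun p => p.2 ≤ m))
    (fun p => p.1 + m < N + p.2)]
  have h3 : rect N m = ((gz N).filter (fun p => p.2 ≤ m)).filter (fun p => p.1 + m < N + p.2) := by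
    rw [Finset.filter_filter, rect]
  rw [h3]
  ring

theorem sum_rect_pd {N m : ℕ} (f : Fn N) (z : gz N → ℂ) :
    ∑ p ∈ rect N m, pd p f z = fderiv ℂ f z (rectVec N m) := by
  have h1 : rectVec N m = ∑ p : gz N, (if p.1 ∈ rect N m then (1 : ℂ) else 0) • Pi.single p 1 := by
    ext v
    rw [Finset.sum_apply, Finset.sum_eq_single v]
    · simp [rectVec]
    · intro p _ h
      simp [Pi.single_eq_of_ne (Ne.symm h)]
    · simp
  rw [h1, map_sum]
  simp_rw [map_smul, ← pd_eq]
  rw [Finset.sum_coe_sort (gz N) fun p => (if p ∈ rect N m then (1 : ℂ) else 0) • pd p f z]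
  simp_rw [ite_smul, one_smul, zero_smul]
  rw [← Finset.sum_filter, Finset.filter_mem_eq_inter,
    Finset.inter_eq_right.2 (rect_subset_gz N m)]

theorem logG_single {N m : ℕ} (hm : 1 ≤ m) (hmN : m < N) (lam : ℕ → ℝ) (x : ℝ) (f : Fn N)
    (z : gz N → ℂ) : logG m lam (Pi.single 1 x) f z =
      x * ((∑ i ∈ Finset.Icc 1 m, mu N lam i) * f z + fderiv ℂ f z (rectVec N m)) := by
  rw [logG, Finset.sum_eq_single 1]
  · rw [Pi.single_eq_same, H, if_pos rfl, ← sum_rect_pd, ← sum_diag_eq hmN, Finset.sum_mul,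
      ← Finset.sum_neg_distrib, ← Finset.sum_add_distrib, ← Finset.sum_add_distrib]
    congr 1
    refine Finset.sum_congr rfl fun i _ => ?_
    rw [E, if_pos rfl, Ediag]
    ring
  · intro i _ hi
    simp [Pi.single_eq_of_ne hi]
  · intro h
    exact absurd (Finset.mem_Icc.2 ⟨le_rfl, by omega⟩) h

theorem hasSum_expTerm {N m : ℕ} (hm : 1 ≤ m) (hmN : m < N) (lam : ℕ → ℝ) (x : ℝ) {f : Fn N}
    (hf : ContDiff ℂ ∞ f) (z : gz N → ℂ) :
    HasSum (expTerm (logG m lam (Pi.single 1 x)) f z)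
      (Complex.exp (x * ∑ i ∈ Finset.Icc 1 m, mu N lam i) * f (z + (x : ℂ) • rectVec N m)) := by
  set X : Op N := logG m lam (Pi.single 1 x) with hX
  set μ := ∑ i ∈ Finset.Icc 1 m, mu N lam i with hμ
  have hXf : ∀ f : Fn N, X f = fun z => x * (μ * f z + fderiv ℂ f z (rectVec N m)) :=
    fun f => funext fun z => logG_single hm hmN lam x f z
  have hsm : ∀ k, ContDiff ℂ ∞ (X^[k] f) := by
    intro k
    induction k with
    | zero => exact hf
    | succ k ih =>
      rw [Function.iterate_succ_apply', hXf]
      exact contDiff_const.mul ((contDiff_const.mul ih).add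
        ((ih.fderiv_right (m := ∞) (by simp)).clm_apply contDiff_const))
  set g : ℕ → ℂ → ℂ := fun k t => Complex.exp (t * (x * μ)) *
    (X^[k] f) (z + (t * x) • rectVec N m) with hg
  have hd : ∀ k t, HasDerivAt (g k) (g (k + 1) t) t := by
    intro k t
    have h1 : HasDerivAt (fun t : ℂ => Complex.exp (t * (x * μ)))
        (Complex.exp (t * (x * μ)) * (x * μ)) t := (hasDerivAt_mul_const (x * μ)).cexp
    have h2 : HasDerivAt (fun t : ℂ => z + (t * x) • rectVec N m) ((x : ℂ) • rectVec N m) t :=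
      ((hasDerivAt_mul_const (x : ℂ)).smul_const (rectVec N m)).const_add z
    have h3 := ((hsm k).differentiable (by simp)
      (z + (t * x) • rectVec N m)).hasFDerivAt.comp_hasDerivAt t h2
    refine (h1.mul h3).congr_deriv ?_
    simp only [hg, Function.iterate_succ_apply', hXf (X^[k] f), map_smul, smul_eq_mul,
      Function.comp_apply]
    ring
  have hit : ∀ k, iteratedDeriv k (g 0) = g k := by
    intro k
    induction k with
    | zero => exact iteratedDeriv_zero
    | succ k ih =>
      rw [iteratedDeriv_succ, ih]
      exact funext fun t => (hd k t).deriv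
  have h := Complex.hasSum_taylorSeries_of_entire (f := g 0)
    (fun t => (hd 0 t).differentiableAt) 0 1
  have e1 : g 0 1 = Complex.exp (x * μ) * f (z + (x : ℂ) • rectVec N m) := by simp [hg]
  rw [e1] at h
  have e2 : expTerm X f z = fun n : ℕ =>
      ((n.factorial : ℕ) : ℂ)⁻¹ • ((1 : ℂ) - 0) ^ n • iteratedDeriv n (g 0) 0 := by
    funext k
    rw [hit]
    simp [expTerm, hg]
  rw [e2]
  exact h

/-! ### Arrows -/

/-- The arrow whose function is the Gamma variable attached to a vertex outside the rectangle. -/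
def outArrow (m : ℕ) (p : ℕ × ℕ) : Arrow := if m < p.2 then vert p.1 p.2 else horiz p.1 p.2

theorem bind_eq_map_filter {β : Type*} (V : Finset (ℕ × ℕ)) (a : ℕ → ℕ → β) (A : Finset ℕ)
    (K : ℕ → ℕ) (e : ℕ → ℕ → ℕ × ℕ) (g : ℕ × ℕ → β) (hK : ∀ k ∈ A, 1 ≤ K k)
    (he : ∀ k ∈ A, ∀ i ∈ Finset.Icc 1 (K k), e k i ∈ V ∧ g (e k i) = a k i)
    (hinj : ∀ k ∈ A, ∀ i ∈ Finset.Icc 1 (K k), ∀ k' ∈ A, ∀ i' ∈ Finset.Icc 1 (K k'),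
      e k i = e k' i' → k = k' ∧ i = i')
    (hsurj : ∀ p ∈ V, ∃ k ∈ A, ∃ i ∈ Finset.Icc 1 (K k), e k i = p) :
    (A.val.bind fun k => {a k (K k)} + (Finset.Icc 1 (K k - 1)).val.map fun i => a k i) =
      V.val.map g := by
  have h1 : ∀ k ∈ A.val, ({a k (K k)} + (Finset.Icc 1 (K k - 1)).val.map fun i => a k i) =
      (Finset.Icc 1 (K k)).val.map fun i => a k i := by
    intro k hk
    have h2 := hK k (Finset.mem_def.2 hk)
    have h3 : Finset.Icc 1 (K k) = insert (K k) (Finset.Icc 1 (K k - 1)) := by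
      ext i; simp; omega
    rw [h3, Finset.insert_val_of_notMem (by simp; omega), Multiset.map_cons,
      Multiset.singleton_add]
  rw [Multiset.bind_congr h1]
  have h2 : (A.val.bind fun k => (Finset.Icc 1 (K k)).val.map fun i => a k i) =
      (A.sigma fun k => Finset.Icc 1 (K k)).val.map fun x => a x.1 x.2 := by
    change _ = (A.val.sigma fun k => (Finset.Icc 1 (K k)).val).map fun x => a x.1 x.2
    rw [Multiset.sigma, Multiset.map_bind]
    simp only [Multiset.map_map, Function.comp_def]
  rw [h2]
  refine Multiset.map_eq_map_of_bij_of_nodup _ _ (Finset.nodup _) (Finset.nodup _)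
    (fun x _ => e x.1 x.2) ?_ ?_ ?_ ?_
  · rintro ⟨k, i⟩ h
    have h' := Finset.mem_sigma.1 (Finset.mem_def.2 h)
    exact (he k h'.1 i h'.2).1
  · rintro ⟨k, i⟩ h ⟨k', i'⟩ h2 h3
    have h' := Finset.mem_sigma.1 (Finset.mem_def.2 h)
    have h2' := Finset.mem_sigma.1 (Finset.mem_def.2 h2)
    obtain ⟨rfl, rfl⟩ := hinj k h'.1 i h'.2 k' h2'.1 i' h2'.2 h3
    rfl
  · intro p hp
    obtain ⟨k, hk, i, hi, h⟩ := hsurj p (Finset.mem_def.2 hp)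
    exact ⟨⟨k, i⟩, Finset.mem_def.1 (Finset.mem_sigma.2 ⟨hk, hi⟩), h⟩
  · rintro ⟨k, i⟩ h
    have h' := Finset.mem_sigma.1 (Finset.mem_def.2 h)
    exact (he k h'.1 i h'.2).2.symm

theorem leftArrows_eq (N m : ℕ) : leftArrows N m = {((N, 1), (N - m, 1))} + rectVert N m +
    ((gz N).filter fun p => m < p.2).val.map fun p => vert p.1 p.2 := by
  rw [leftArrows]
  congr 1
  have h := bind_eq_map_filter ((gz N).filter fun p => m < p.2) (fun k i => vert (i + k - 1) k)
    (Finset.Icc (m + 1) (N - 1)) (fun k => N - k) (fun k i => (i + k - 1, k))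
    (fun p => vert p.1 p.2) (by simp; omega) (by simp [mem_gz]; omega)
    (by simp; omega) (by
      rintro ⟨n, k⟩ h
      simp only [Finset.mem_filter, mem_gz] at h
      exact ⟨k, by simp; omega, n + 1 - k, by simp; omega, by simp; omega⟩)
  rw [← h]
  refine Multiset.bind_congr fun k hk => ?_
  have hk' := Finset.mem_Icc.1 (Finset.mem_def.2 hk)
  have : N - k + k - 1 = N - 1 := by omega
  simp only [this]

theorem rightArrows_eq (N m : ℕ) (hmN : m < N) :
    rightArrows N m = {((m, m), (N, N))} + rectHoriz N m +
    ((gz N).filter fun p => p.2 < m ∧ N + p.2 ≤ p.1 + m).val.map fun p => horiz p.1 p.2 := by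
  rw [rightArrows]
  congr 1
  have h := bind_eq_map_filter ((gz N).filter fun p => p.2 < m ∧ N + p.2 ≤ p.1 + m)
    (fun k i => horiz (N - k + i - 1) i)
    (Finset.Icc 1 (m - 1)) (fun k => k) (fun k i => (N - k + i - 1, i))
    (fun p => horiz p.1 p.2) (by simp; omega) (by simp [mem_gz]; omega)
    (by simp; omega) (by
      rintro ⟨n, k⟩ h
      simp only [Finset.mem_filter, mem_gz] at h
      exact ⟨N - (n + 1 - k), by simp; omega, k, by simp; omega, by simp; omega⟩)
  rw [← h]
  refine Multiset.bind_congr fun k hk => ?_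
  have hk' := Finset.mem_Icc.1 (Finset.mem_def.2 hk)
  have : N - k + k - 1 = N - 1 := by omega
  simp only [this]

theorem mem_out {N m : ℕ} {p : ℕ × ℕ} : p ∈ gz N \ rect N m ↔
    (1 ≤ p.2 ∧ p.2 ≤ p.1 ∧ p.1 < N) ∧ (m < p.2 ∨ p.2 < m ∧ N + p.2 ≤ p.1 + m) := by
  rw [Finset.mem_sdiff, mem_gz, mem_rect]
  omega

theorem arrows_eq (N m : ℕ) (hmN : m < N) : leftArrows N m + rightArrows N m =
    grArrows N m + (gz N \ rect N m).val.map (outArrow m) := by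
  have h1 : gz N \ rect N m = ((gz N).filter fun p => m < p.2).disjUnion
      ((gz N).filter fun p => p.2 < m ∧ N + p.2 ≤ p.1 + m) (by
        rw [Finset.disjoint_filter]; intro p _; omega) := by
    ext p
    rw [Finset.mem_disjUnion, mem_out, Finset.mem_filter, Finset.mem_filter, mem_gz]
    omega
  have h2 : (gz N \ rect N m).val.map (outArrow m) =
      (((gz N).filter fun p => m < p.2).val.map fun p => vert p.1 p.2) +
      ((gz N).filter fun p => p.2 < m ∧ N + p.2 ≤ p.1 + m).val.map fun p => horiz p.1 p.2 := by
    rw [h1, Finset.disjUnion_val, Multiset.map_add]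
    congr 1
    · refine Multiset.map_congr rfl fun p hp => ?_
      have := (Finset.mem_filter.1 (Finset.mem_def.2 hp)).2
      rw [outArrow, if_pos this]
    · refine Multiset.map_congr rfl fun p hp => ?_
      have := (Finset.mem_filter.1 (Finset.mem_def.2 hp)).2
      rw [outArrow, if_neg (by omega)]
  rw [leftArrows_eq, rightArrows_eq N m hmN, h2, grArrows]
  abel

theorem mem_rectVert {N m : ℕ} {a : Arrow} : a ∈ rectVert N m ↔
    ∃ k i, (1 ≤ k ∧ k ≤ m) ∧ (1 ≤ i ∧ i + m < N) ∧ a = vert (i + k - 1) k := by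
  simp only [rectVert, Multiset.mem_map, Finset.mem_val, Finset.mem_product, Finset.mem_Icc,
    Prod.exists]
  constructor
  · rintro ⟨k, i, h, rfl⟩; exact ⟨k, i, h.1, by omega, rfl⟩
  · rintro ⟨k, i, h1, h2, rfl⟩; exact ⟨k, i, ⟨h1, by omega⟩, rfl⟩

theorem mem_rectHoriz {N m : ℕ} {a : Arrow} : a ∈ rectHoriz N m ↔
    ∃ k i, (1 ≤ k ∧ k + m ≤ N) ∧ (1 ≤ i ∧ i < m) ∧ a = horiz (k + i - 1) i := by
  simp only [rectHoriz, Multiset.mem_map, Finset.mem_val, Finset.mem_product, Finset.mem_Icc,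
    Prod.exists]
  constructor
  · rintro ⟨k, i, h, rfl⟩; exact ⟨k, i, by omega, by omega, rfl⟩
  · rintro ⟨k, i, h1, h2, rfl⟩; exact ⟨k, i, by omega, rfl⟩

theorem mem_grArrows {N m : ℕ} {a : Arrow} : a ∈ grArrows N m ↔ a = ((m, m), (N, N)) ∨
    a = ((N, 1), (N - m, 1)) ∨ a ∈ rectVert N m ∨ a ∈ rectHoriz N m := by
  simp [grArrows]

/-- Control of a function on the vertices of the graph of `Gr_{m,N}` by its increments along the
arrows. -/
theorem grArrows_bound {N m : ℕ} (hm : 1 ≤ m) (hmN : m < N) {X : ℕ × ℕ → ℝ} {T : ℝ} (hT : 0 ≤ T)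
    (h : ∀ a ∈ grArrows N m, X a.2 - X a.1 ≤ T) {p : ℕ × ℕ} (hp : p ∈ rect N m) :
    X p ≤ X (N, 1) + 2 * N * T ∧ X (N, N) - 2 * N * T ≤ X p := by
  have hv : ∀ i k, 1 ≤ k → k ≤ m → 1 ≤ i → i + m < N →
      X (i + k - 1, k) ≤ X (i + k, k) + T := by
    intro i k h1 h2 h3 h4
    have := h _ (mem_grArrows.2 (.inr (.inr (.inl
      (mem_rectVert.2 ⟨k, i, ⟨h1, h2⟩, ⟨h3, h4⟩, rfl⟩)))))
    simp only [vert] at this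
    rw [show i + k - 1 + 1 = i + k by omega] at this
    linarith
  have hh : ∀ i k, 1 ≤ k → k < m → 1 ≤ i → i + m ≤ N →
      X (i + k, k + 1) ≤ X (i + k - 1, k) + T := by
    intro i k h1 h2 h3 h4
    have := h _ (mem_grArrows.2 (.inr (.inr (.inr
      (mem_rectHoriz.2 ⟨i, k, ⟨h3, h4⟩, ⟨h1, h2⟩, rfl⟩)))))
    simp only [horiz] at this
    rw [show i + k - 1 + 1 = i + k by omega] at this
    linarith
  have hs := h _ (mem_grArrows.2 (.inl rfl))
  have ht := h _ (mem_grArrows.2 (.inr (.inl rfl)))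
  simp only at hs ht
  obtain ⟨n, k⟩ := p
  rw [mem_rect] at hp
  simp only at hp
  constructor
  · have h1 : ∀ j : ℕ, j + m < N → X (N - m - j, 1) ≤ X (N - m, 1) + j * T := by
      intro j
      induction j with
      | zero => intro _; simp
      | succ j ih =>
        intro hj
        have h2 := hv (N - m - (j + 1)) 1 le_rfl hm (by omega) (by omega)
        rw [show N - m - (j + 1) + 1 - 1 = N - m - (j + 1) by omega,
          show N - m - (j + 1) + 1 = N - m - j by omega] at h2
        have := ih (by omega)
        push_cast
        linarith
    have h2 : ∀ j : ℕ, j < m → ∀ i, 1 ≤ i → i + m ≤ N →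
        X (i + j, 1 + j) ≤ X (i, 1) + j * T := by
      intro j
      induction j with
      | zero => intro _ i _ _; simp
      | succ j ih =>
        intro hj i hi1 hi2
        have h3 := hh i (1 + j) (by omega) (by omega) hi1 hi2
        have := ih (by omega) i hi1 hi2
        rw [show i + (1 + j) - 1 = i + j by omega, show i + (1 + j) = i + (j + 1) by omega,
          show 1 + j + 1 = 1 + (j + 1) by omega] at h3
        push_cast
        linarith
    have h3 := h2 (k - 1) (by omega) (n + 1 - k) (by omega) (by omega)
    have h4 := h1 (N - m - (n + 1 - k)) (by omega)
    rw [show N - m - (N - m - (n + 1 - k)) = n + 1 - k by omega] at h4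
    rw [show n + 1 - k + (k - 1) = n by omega, show 1 + (k - 1) = k by omega] at h3
    have h5 : ((k - 1 : ℕ) : ℝ) + ((N - m - (n + 1 - k) : ℕ) : ℝ) + 1 ≤ 2 * N := by
      exact_mod_cast (by omega : (k - 1) + (N - m - (n + 1 - k)) + 1 ≤ 2 * N)
    have h6 := mul_le_mul_of_nonneg_right h5 hT
    linarith
  · have h1 : ∀ j : ℕ, j < m → X (m, m) - j * T ≤ X (m - j, m - j) := by
      intro j
      induction j with
      | zero => intro _; simp
      | succ j ih =>
        intro hj
        have h2 := hh 1 (m - (j + 1)) (by omega) (by omega) le_rfl (by omega)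
        rw [show 1 + (m - (j + 1)) - 1 = m - (j + 1) by omega,
          show 1 + (m - (j + 1)) = m - j by omega, show m - (j + 1) + 1 = m - j by omega] at h2
        have := ih (by omega)
        push_cast
        linarith
    have h2 : ∀ j : ℕ, ∀ k, 1 ≤ k → k ≤ m → j + m < N → X (k, k) - j * T ≤ X (k + j, k) := by
      intro j
      induction j with
      | zero => intro k _ _ _; simp
      | succ j ih =>
        intro k hk1 hk2 hj
        have h3 := hv (j + 1) k hk1 hk2 (by omega) (by omega)
        have := ih k hk1 hk2 (by omega)
        rw [show j + 1 + k - 1 = k + j by omega, show j + 1 + k = k + (j + 1) by omega] at h3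
        push_cast
        linarith
    have h3 := h2 (n - k) k (by omega) (by omega) (by omega)
    have h4 := h1 (m - k) (by omega)
    rw [show m - (m - k) = k by omega] at h4
    rw [show k + (n - k) = n by omega] at h3
    have h5 : ((m - k : ℕ) : ℝ) + ((n - k : ℕ) : ℝ) + 1 ≤ 2 * N := by
      exact_mod_cast (by omega : (m - k) + (n - k) + 1 ≤ 2 * N)
    have h6 := mul_le_mul_of_nonneg_right h5 hT
    linarith

/-! ### Affine functions attached to arrows -/

section Vertices
variable {V : Finset (ℕ × ℕ)}

/-- The value at the vertex `p`, with the boundary values `c`. -/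
def vcoord (c : ℕ × ℕ → ℝ) (z : V → ℂ) (p : ℕ × ℕ) : ℂ := if h : p ∈ V then z ⟨p, h⟩ else c p

/-- The real version of `vcoord`. -/
def vcoordR (c : ℕ × ℕ → ℝ) (s : V → ℝ) (p : ℕ × ℕ) : ℝ := if h : p ∈ V then s ⟨p, h⟩ else c p

/-- The coefficients of the function `x_b - x_a` of the arrow `a → b`. -/
def arrowK (V : Finset (ℕ × ℕ)) (a : Arrow) (v : V) : ℝ :=
  (if v.1 = a.2 then 1 else 0) - (if v.1 = a.1 then 1 else 0)

/-- The constant term of the function of an arrow. -/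
def arrowC (V : Finset (ℕ × ℕ)) (c : ℕ × ℕ → ℝ) (a : Arrow) : ℝ :=
  (if a.2 ∈ V then 0 else c a.2) - (if a.1 ∈ V then 0 else c a.1)

theorem vcoord_eq_sum (c : ℕ × ℕ → ℝ) (z : V → ℂ) (p : ℕ × ℕ) :
    vcoord c z p = ((if p ∈ V then 0 else c p : ℝ) : ℂ) +
      ∑ v : V, ((if v.1 = p then 1 else 0 : ℝ) : ℂ) * z v := by
  rw [vcoord]
  by_cases h : p ∈ V
  · rw [dif_pos h, if_pos h, Finset.sum_eq_single ⟨p, h⟩]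
    · simp
    · intro v _ hv
      have : v.1 ≠ p := fun e => hv (Subtype.ext e)
      simp [this]
    · simp
  · rw [dif_neg h, if_neg h, Finset.sum_eq_zero]
    · simp
    · intro v _
      have : v.1 ≠ p := fun e => h (e ▸ v.2)
      simp [this]

theorem affC_arrow (c : ℕ × ℕ → ℝ) (a : Arrow) (z : V → ℂ) :
    affC (arrowK V a) (arrowC V c a) z = vcoord c z a.2 - vcoord c z a.1 := by
  rw [vcoord_eq_sum, vcoord_eq_sum, affC, arrowC, add_sub_add_comm, ← Finset.sum_sub_distrib]
  simp only [arrowK]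
  push_cast
  simp_rw [sub_mul]

theorem vcoord_ofReal (c : ℕ × ℕ → ℝ) (s : V → ℝ) (p : ℕ × ℕ) :
    vcoord c (fun v => (s v : ℂ)) p = (vcoordR c s p : ℝ) := by
  rw [vcoord, vcoordR]; split_ifs <;> rfl

theorem affR_arrow (c : ℕ × ℕ → ℝ) (a : Arrow) (s : V → ℝ) :
    affR (arrowK V a) (arrowC V c a) s = vcoordR c s a.2 - vcoordR c s a.1 := by
  have h := affC_arrow c a (fun v : V => (s v : ℂ))
  rw [affC_ofReal, vcoord_ofReal, vcoord_ofReal] at h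
  exact_mod_cast h

theorem arrowK_ne_zero {a : Arrow} (h : a.1 ≠ a.2) (h' : a.1 ∈ V ∨ a.2 ∈ V) :
    arrowK V a ≠ 0 := by
  rcases h' with h' | h'
  · intro e
    have := congrFun e ⟨a.1, h'⟩
    simp [arrowK, h] at this
  · intro e
    have := congrFun e ⟨a.2, h'⟩
    simp [arrowK, Ne.symm h] at this

end Vertices

theorem sum_toType {β : Type*} [AddCommMonoid β] (A : Multiset Arrow) (f : Arrow → β) :
    ∑ a : A.ToType, f a.1 = (A.map f).sum := by
  rw [Finset.sum_eq_multiset_sum, Multiset.map_univ]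

theorem potential_eq_sum (A : Multiset Arrow) (X : ℕ × ℕ → ℂ) :
    potential A X = ∑ a : A.ToType, Complex.exp (X a.1.2 - X a.1.1) :=
  (sum_toType A fun a => Complex.exp (X a.2 - X a.1)).symm

theorem coord_eq_vcoord {N : ℕ} (z : gz N → ℂ) (p : ℕ × ℕ) :
    coord z p = vcoord (fun _ => 0) z p := by
  rw [coord, vcoord, Complex.ofReal_zero]

/-- The boundary values of the stationary phase integral. -/
def sourceValue (N : ℕ) (x : ℝ) : ℕ × ℕ → ℝ := fun p => if p = (N, 1) then x else 0

theorem coordF_eq_vcoord {N m : ℕ} (x : ℝ) (z : rect N m → ℂ) (p : ℕ × ℕ) :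
    coordF x z p = vcoord (sourceValue N x) z p := by
  rw [coordF, vcoord, sourceValue]
  split_ifs <;> simp

theorem outArrow_cases (m : ℕ) (p : ℕ × ℕ) :
    (m < p.2 ∧ outArrow m p = ((p.1 + 1, p.2), p)) ∨
    (¬ m < p.2 ∧ outArrow m p = (p, (p.1 + 1, p.2 + 1))) := by
  by_cases h : m < p.2
  · exact .inl ⟨h, by rw [outArrow, if_pos h, vert]⟩
  · exact .inr ⟨h, by rw [outArrow, if_neg h, horiz]⟩

theorem outArrow_ne (m : ℕ) (p : ℕ × ℕ) : (outArrow m p).1 ≠ (outArrow m p).2 := by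
  rcases outArrow_cases m p with ⟨-, h⟩ | ⟨-, h⟩ <;> rw [h] <;> intro e <;>
    have := congrArg Prod.fst e <;> simp at this

theorem outArrow_mem {m : ℕ} {p : ℕ × ℕ} {V : Finset (ℕ × ℕ)} (hp : p ∈ V) :
    (outArrow m p).1 ∈ V ∨ (outArrow m p).2 ∈ V := by
  rcases outArrow_cases m p with ⟨-, h⟩ | ⟨-, h⟩ <;> rw [h]
  · exact .inr hp
  · exact .inl hp

theorem grArrows_ends {N m : ℕ} (hm : 1 ≤ m) (hmN : m < N) {a : Arrow} (ha : a ∈ grArrows N m) :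
    a.1 ≠ a.2 ∧ (a.1 ∈ rect N m ∨ a.1 = (N, 1)) ∧ (a.2 ∈ rect N m ∨ a.2 = (N, N)) ∧
      (a.1 ∈ rect N m ∨ a.2 ∈ rect N m) := by
  rcases mem_grArrows.1 ha with rfl | rfl | h | h
  · simp [mem_rect]; omega
  · simp [mem_rect]; omega
  · obtain ⟨k, i, h1, h2, rfl⟩ := mem_rectVert.1 h
    simp [vert, mem_rect]; omega
  · obtain ⟨k, i, h1, h2, rfl⟩ := mem_rectHoriz.1 h
    simp [horiz, mem_rect]; omega

/-! ### The integrand on the rectangle -/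

section Rect
variable {N m : ℕ}

/-- The exponential of the phase function, up to a constant, with the boundary values `c`. -/
def rectFn (N m : ℕ) (hbar : ℝ) (c : ℕ × ℕ → ℝ) (q : rect N m → ℝ) : (rect N m → ℂ) → ℂ :=
  expSum (Finset.univ : Finset (grArrows N m).ToType) (fun a => arrowK (rect N m) a.1)
    (fun a => arrowC (rect N m) c a.1) (fun _ => 1 / hbar) (fun v => Complex.I * q v)

theorem rect_norm_le (hm : 1 ≤ m) (hmN : m < N) (c : ℕ × ℕ → ℝ) {T : ℝ} (hT : 0 ≤ T)
    {s : rect N m → ℝ}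
    (h : ∀ a ∈ grArrows N m, affR (arrowK (rect N m) a) (arrowC (rect N m) c a) s ≤ T) :
    ‖s‖ ≤ (|c (N, 1)| + |c (N, N)| + 2 * N) * (1 + T) := by
  have h1 : ∀ p ∈ rect N m, _ := fun p hp => grArrows_bound hm hmN (X := vcoordR c s) hT
    (fun a ha => by rw [← affR_arrow]; exact h a ha) hp
  have h2 : vcoordR c s (N, 1) = c (N, 1) := dif_neg (by simp [mem_rect])
  have h3 : vcoordR c s (N, N) = c (N, N) := dif_neg (by simp [mem_rect])
  refine (pi_norm_le_iff_of_nonneg (by positivity)).2 fun v => ?_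
  have h4 := h1 v.1 v.2
  have h5 : vcoordR c s v.1 = s v := dif_pos v.2
  rw [h2, h3, h5] at h4
  have h6 := neg_abs_le (c (N, N))
  have h7 := le_abs_self (c (N, 1))
  have h8 := abs_nonneg (c (N, N))
  have h9 := abs_nonneg (c (N, 1))
  have h10 : 0 ≤ |c (N, N)| * T := by positivity
  have h11 : 0 ≤ |c (N, 1)| * T := by positivity
  have h12 : (0 : ℝ) ≤ N := by positivity
  rw [Real.norm_eq_abs, abs_le]
  constructor <;> nlinarith

theorem rect_proper (hm : 1 ≤ m) (hmN : m < N) (c : ℕ × ℕ → ℝ) : ∃ C : ℝ, ∀ s : rect N m → ℝ,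
    ‖s‖ ≤ C * (1 + ∑ a : (grArrows N m).ToType,
      |affR (arrowK (rect N m) a.1) (arrowC (rect N m) c a.1) s|) := by
  refine ⟨_, fun s => rect_norm_le hm hmN c (Finset.sum_nonneg fun _ _ => abs_nonneg _)
    fun a ha => ?_⟩
  rw [sum_toType _ fun a => |affR (arrowK (rect N m) a) (arrowC (rect N m) c a) s|]
  refine (le_abs_self _).trans (Multiset.single_le_sum ?_ _ (Multiset.mem_map_of_mem _ ha))
  intro x hx
  obtain ⟨b, -, rfl⟩ := Multiset.mem_map.1 hx
  exact abs_nonneg _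

theorem norm_rectFn_ofReal (hbar : ℝ) (c : ℕ × ℕ → ℝ) (q : rect N m → ℝ) (s : rect N m → ℝ) :
    ‖rectFn N m hbar c q fun v => (s v : ℂ)‖ =
      Real.exp (-(1 / hbar * ∑ a : (grArrows N m).ToType,
        Real.exp (affR (arrowK (rect N m) a.1) (arrowC (rect N m) c a.1) s))) := by
  rw [rectFn, expSum, Complex.norm_exp]
  congr 1
  simp_rw [affC_ofReal, ← Complex.ofReal_exp, ← Complex.ofReal_mul, ← Complex.ofReal_sum]
  rw [Complex.sub_re, Complex.ofReal_re, Complex.re_sum, Finset.sum_eq_zero, zero_sub,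
    Finset.mul_sum]
  intro v _
  rw [mul_assoc, ← Complex.ofReal_mul, Complex.I_mul_re, Complex.ofReal_im, neg_zero]

theorem rectFn_decay (hm : 1 ≤ m) (hmN : m < N) {hbar : ℝ} (hh : 0 < hbar) (c : ℕ × ℕ → ℝ)
    (q : rect N m → ℝ) : ∃ K c' : ℝ, 0 < c' ∧ ∀ s : rect N m → ℝ,
      ‖rectFn N m hbar c q fun v => (s v : ℂ)‖ ≤ K * Real.exp (-c' * ‖s‖) := by
  set D := |c (N, 1)| + |c (N, N)| + 2 * (N : ℝ) with hD
  have hN : (0 : ℝ) < N := by exact_mod_cast (by omega : 0 < N)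
  have hD0 : 0 < D := by positivity
  refine ⟨Real.exp (1 / hbar), 1 / (hbar * D), by positivity, fun s => ?_⟩
  rw [norm_rectFn_ofReal, ← Real.exp_add]
  refine Real.exp_le_exp.2 ?_
  set T := ∑ a : (grArrows N m).ToType,
        Real.exp (affR (arrowK (rect N m) a.1) (arrowC (rect N m) c a.1) s) with hT
  have h1 : ‖s‖ ≤ D * (1 + T) := by
    refine rect_norm_le hm hmN c (Finset.sum_nonneg fun _ _ => (Real.exp_pos _).le) fun a ha => ?_
    have hTs : T = ((grArrows N m).map fun a =>
        Real.exp (affR (arrowK (rect N m) a) (arrowC (rect N m) c a) s)).sum :=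
      sum_toType _ fun a => Real.exp (affR (arrowK (rect N m) a) (arrowC (rect N m) c a) s)
    change _ ≤ T
    rw [hTs]
    have h2 := Real.add_one_le_exp (affR (arrowK (rect N m) a) (arrowC (rect N m) c a) s)
    refine le_trans (by linarith) (Multiset.single_le_sum ?_ _ (Multiset.mem_map_of_mem _ ha))
    intro x hx
    obtain ⟨b, -, rfl⟩ := Multiset.mem_map.1 hx
    exact (Real.exp_pos _).le
  have h3 : 1 / (hbar * D) * ‖s‖ ≤ 1 / hbar * (1 + T) := by
    calc _ ≤ 1 / (hbar * D) * (D * (1 + T)) := by gcongr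
      _ = _ := by field_simp
  linarith

theorem contDiff_rectFn (hbar : ℝ) (c : ℕ × ℕ → ℝ) (q : rect N m → ℝ) {n : ℕ∞ω} :
    ContDiff ℂ n (rectFn N m hbar c q) := contDiff_expSum _ _ _ _ _

/-- The regularization of the integrand on the rectangle. -/
def rectReg (N m : ℕ) (c : ℕ × ℕ → ℝ) (M ε : ℝ) (s : rect N m → ℝ) : ℂ :=
  Complex.exp (-(ε : ℂ) * ∑ a : (grArrows N m).ToType,
    reg M (affR (arrowK (rect N m) a.1) (arrowC (rect N m) c a.1) s : ℝ))

theorem tendsto_rectFn (hm : 1 ≤ m) (hmN : m < N) {hbar : ℝ} (hh : 0 < hbar) (c : ℕ × ℕ → ℝ)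
    (q : rect N m → ℝ) {η : (rect N m → ℝ) → (rect N m → ℝ)} (hη : ContDiff ℝ ∞ η)
    (hslope : ∃ L, ∀ s, ‖fderiv ℝ η s‖ ≤ L)
    (hslight : ∃ K, ∀ a ∈ grArrows N m, ∀ t ∈ Set.Icc (0 : ℝ) 1, ∀ s,
      -K ≤ (Complex.exp (vcoord c (deform η t s) a.2 - vcoord c (deform η t s) a.1)).re)
    (hdecay : ∃ K c' : ℝ, 0 < c' ∧ ∀ s, ‖rectFn N m hbar c q (deform η 1 s)‖ ≤
      K * Real.exp (-c' * ‖s‖)) :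
    ∃ M₀ : ℝ, ∀ M, M₀ ≤ M → Tendsto (fun ε : ℝ => ∫ s : rect N m → ℝ,
      rectFn N m hbar c q (fun v => (s v : ℂ)) * rectReg N m c M ε s) (𝓝[>] 0)
      (𝓝 (contourIntegral η (rectFn N m hbar c q))) := by
  have hsl : ∃ K, ∀ a ∈ (Finset.univ : Finset (grArrows N m).ToType), ∀ t ∈ Set.Icc (0 : ℝ) 1,
      ∀ s, -K ≤ (Complex.exp (affC (arrowK (rect N m) a.1) (arrowC (rect N m) c a.1)
        (deform η t s))).re := by
    obtain ⟨K, hK⟩ := hslight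
    refine ⟨K, fun a _ t ht s => ?_⟩
    rw [affC_arrow]
    exact hK a.1 (Multiset.coe_mem) t ht s
  exact tendsto_integral_regularized Finset.univ _ _
    (fun a _ => arrowK_ne_zero (grArrows_ends hm hmN Multiset.coe_mem).1
      (grArrows_ends hm hmN Multiset.coe_mem).2.2.2)
    (rect_proper hm hmN c) (contDiff_rectFn hbar c q) hη hslope hsl hdecay
    (expSum_growth _ _ _ _ (fun _ _ => by positivity) _ hη hslope hsl)

theorem deform_const_zero {ι : Type} (t : ℝ) (s : ι → ℝ) :
    deform (fun _ => 0) t s = fun v => (s v : ℂ) := by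
  ext v; simp [deform]

theorem jacobian_const_zero {ι : Type} [Fintype ι] [DecidableEq ι] (s : ι → ℝ) :
    jacobian (fun _ => (0 : ι → ℝ)) s = 1 := by
  rw [jacobian, ← Matrix.det_one (n := ι)]
  congr 1
  ext v w
  simp [Matrix.one_apply]

theorem contourIntegral_const_zero {ι : Type} [Fintype ι] [DecidableEq ι] (f : (ι → ℂ) → ℂ) :
    contourIntegral (fun _ => (0 : ι → ℝ)) f = ∫ s : ι → ℝ, f fun v => (s v : ℂ) := by
  simp only [contourIntegral, contourIntegrand, deform_const_zero, jacobian_const_zero, mul_one]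

theorem slight_const_zero {V : Finset (ℕ × ℕ)} (c : ℕ × ℕ → ℝ) (t : ℝ) (s : V → ℝ) (a : Arrow) :
    -0 ≤ (Complex.exp (vcoord c (deform (fun _ => 0) t s) a.2 -
      vcoord c (deform (fun _ => 0) t s) a.1)).re := by
  rw [deform_const_zero, vcoord_ofReal, vcoord_ofReal, ← Complex.ofReal_sub, ← Complex.ofReal_exp,
    Complex.ofReal_re, neg_zero]
  exact (Real.exp_pos _).le

theorem tendsto_rectFn_real (hm : 1 ≤ m) (hmN : m < N) {hbar : ℝ} (hh : 0 < hbar)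
    (c : ℕ × ℕ → ℝ) (q : rect N m → ℝ) :
    ∃ M₀ : ℝ, ∀ M, M₀ ≤ M → Tendsto (fun ε : ℝ => ∫ s : rect N m → ℝ,
      rectFn N m hbar c q (fun v => (s v : ℂ)) * rectReg N m c M ε s) (𝓝[>] 0)
      (𝓝 (∫ s : rect N m → ℝ, rectFn N m hbar c q fun v => (s v : ℂ))) := by
  rw [← contourIntegral_const_zero]
  refine tendsto_rectFn hm hmN hh c q contDiff_const ⟨0, fun s => by simp⟩
    ⟨0, fun a _ t _ s => slight_const_zero c t s a⟩ ?_
  simp_rw [deform_const_zero]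
  exact rectFn_decay hm hmN hh c q

end Rect

/-! ### The stationary phase integral -/

section Phase
variable {N m : ℕ}

/-- The differences `λ_n - λ_{n+1}`, at the vertices of the rectangle. -/
def rectQ (N m : ℕ) (lam : ℕ → ℝ) (v : rect N m) : ℝ := lam v.1.1 - lam (v.1.1 + 1)

theorem sum_rect_rows (hmN : m < N) (g : ℕ × ℕ → ℂ) :
    ∑ n ∈ Finset.Icc 1 (N - m), ∑ i ∈ Finset.Icc 1 (min m n), g (n, i) +
      ∑ n ∈ Finset.Icc 1 (m - 1), ∑ i ∈ Finset.Icc (n + 1) (min (N - m + n) m), g (N - m + n, i) =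
    ∑ p ∈ rect N m, g p := by
  rw [← Finset.sum_filter_add_sum_filter_not (rect N m) (fun p => p.1 ≤ N - m)]
  congr 1
  · rw [Finset.sum_sigma']
    refine Finset.sum_bij' (fun a _ => (a.1, a.2)) (fun p _ => ⟨p.1, p.2⟩) ?_ ?_ ?_ ?_ ?_
    · simp [mem_rect]; omega
    · simp [mem_rect]; omega
    · simp
    · simp
    · simp
  · rw [Finset.sum_sigma']
    refine Finset.sum_bij' (fun a _ => (N - m + a.1, a.2)) (fun p _ => ⟨p.1 - (N - m), p.2⟩)
      ?_ ?_ ?_ ?_ ?_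
    · simp [mem_rect]; omega
    · simp [mem_rect]; omega
    · simp
    · rintro ⟨n, k⟩ h
      simp only [Finset.mem_filter, mem_rect] at h
      simp only [Prod.mk.injEq, and_true]
      omega
    · simp

theorem exp_phase (hmN : m < N) (hbar : ℝ) (lam : ℕ → ℝ) (x : ℝ) (z : rect N m → ℂ) :
    Complex.exp (phase N m hbar lam x z) =
      Complex.exp (Complex.I * (∑ k ∈ Finset.Icc 1 m, (lam (N - m + k) : ℂ)) * x) *
        rectFn N m hbar (sourceValue N x) (rectQ N m lam) z := by
  rw [rectFn, expSum, ← Complex.exp_add, phase, potential_eq_sum]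
  congr 1
  have h1 := sum_rect_rows (N := N) (m := m) hmN fun p =>
    ((lam p.1 : ℂ) - lam (p.1 + 1)) * coordF x z p
  simp only [← Finset.mul_sum] at h1
  rw [← Finset.sum_coe_sort (rect N m)] at h1
  have h2 : ∑ v : rect N m, Complex.I * (rectQ N m lam v : ℂ) * z v =
      Complex.I * ∑ v : rect N m, ((lam v.1.1 : ℂ) - lam (v.1.1 + 1)) * coordF x z v.1 := by
    rw [Finset.mul_sum]
    refine Finset.sum_congr rfl fun v _ => ?_
    have : coordF x z v.1 = z v := dif_pos v.2
    rw [this, rectQ]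
    push_cast
    ring
  rw [h2, ← h1]
  simp_rw [affC_arrow, ← coordF_eq_vcoord]
  rw [← Finset.mul_sum]
  push_cast
  ring

theorem norm_phase_factor (lam : ℕ → ℝ) (x : ℝ) :
    ‖Complex.exp (Complex.I * (∑ k ∈ Finset.Icc 1 m, (lam (N - m + k) : ℂ)) * x)‖ = 1 := by
  rw [mul_assoc, ← Complex.ofReal_sum, ← Complex.ofReal_mul, Complex.norm_exp_I_mul_ofReal]

theorem isPhaseContour_zero (hm : 1 ≤ m) (hmN : m < N) {hbar : ℝ} (hh : 0 < hbar) (lam : ℕ → ℝ)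
    (x : ℝ) : IsPhaseContour N m hbar lam x fun _ => 0 where
  smooth := contDiff_const
  slope := ⟨0, fun s => by simp⟩
  slight := ⟨0, fun a _ t _ s => by
    rw [coordF_eq_vcoord, coordF_eq_vcoord]
    exact slight_const_zero _ t s a⟩
  decay := by
    simp_rw [deform_const_zero, exp_phase hmN, norm_mul, norm_phase_factor, one_mul]
    exact rectFn_decay hm hmN hh _ _

theorem IsPhaseContour.integrable {hbar : ℝ} {lam : ℕ → ℝ} (hmN : m < N)
    {x : ℝ} {η : (rect N m → ℝ) → (rect N m → ℝ)} (h : IsPhaseContour N m hbar lam x η) :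
    Integrable (contourIntegrand η fun z => Complex.exp (phase N m hbar lam x z)) := by
  obtain ⟨L, hL⟩ := h.slope
  obtain ⟨K, c, hc, hK⟩ := h.decay
  refine integrable_contourIntegrand (U := Set.univ) ?_ h.smooth (fun _ => trivial) hL hc hK
  simp_rw [exp_phase hmN]
  exact (continuous_const.mul (contDiff_rectFn (n := 0) _ _ _).continuous).continuousOn

theorem IsPhaseContour.contourIntegral_eq {hbar : ℝ} (hh : 0 < hbar) {lam : ℕ → ℝ} (hm : 1 ≤ m)
    (hmN : m < N) {x : ℝ} {η : (rect N m → ℝ) → (rect N m → ℝ)}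
    (h : IsPhaseContour N m hbar lam x η) :
    contourIntegral η (fun z => Complex.exp (phase N m hbar lam x z)) =
      Complex.exp (Complex.I * (∑ k ∈ Finset.Icc 1 m, (lam (N - m + k) : ℂ)) * x) *
        ∫ s : rect N m → ℝ, rectFn N m hbar (sourceValue N x) (rectQ N m lam)
          fun v => (s v : ℂ) := by
  obtain ⟨M₁, h₁⟩ := tendsto_rectFn hm hmN hh (sourceValue N x) (rectQ N m lam) h.smooth h.slope
    (by simpa only [coordF_eq_vcoord] using h.slight)
    (by simpa only [exp_phase hmN, norm_mul, norm_phase_factor, one_mul] using h.decay)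
  obtain ⟨M₂, h₂⟩ := tendsto_rectFn_real hm hmN hh (sourceValue N x) (rectQ N m lam)
  rw [← tendsto_nhds_unique (h₁ (max M₁ M₂) (le_max_left _ _))
    (h₂ (max M₁ M₂) (le_max_right _ _)), contourIntegral, contourIntegral, ← integral_const_mul]
  refine integral_congr_ae (ae_of_all _ fun s => ?_)
  simp only [contourIntegrand, exp_phase hmN]
  ring

/-- The boundary values after the translation of the rectangle to the origin. -/
def sinkValue (N : ℕ) (x : ℝ) : ℕ × ℕ → ℝ := fun p => if p = (N, N) then -x else 0

theorem sum_rectQ (hmN : m < N) (lam : ℕ → ℝ) :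
    ∑ v : rect N m, (rectQ N m lam v : ℂ) =
      ∑ k ∈ Finset.Icc 1 m, (lam k : ℂ) - ∑ k ∈ Finset.Icc 1 m, (lam (N - m + k) : ℂ) := by
  rw [← Finset.sum_sub_distrib]
  have h1 : ∀ d k : ℕ, ∑ n ∈ Finset.Ico k (k + d), ((lam n : ℂ) - lam (n + 1)) =
      lam k - lam (k + d) := by
    intro d k
    induction d with
    | zero => simp
    | succ d ih =>
      rw [← add_assoc, Finset.sum_Ico_succ_top (by omega), ih]
      ring
  have h2 : ∀ k ∈ Finset.Icc 1 m, (lam k : ℂ) - lam (N - m + k) =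
      ∑ n ∈ Finset.Ico k (k + (N - m)), ((lam n : ℂ) - lam (n + 1)) := by
    intro k _
    rw [h1, add_comm k]
  rw [Finset.sum_congr rfl h2, Finset.sum_sigma']
  simp only [rectQ]
  push_cast
  rw [Finset.sum_coe_sort (rect N m) fun p => (lam p.1 : ℂ) - lam (p.1 + 1)]
  refine Finset.sum_bij' (fun p _ => ⟨p.2, p.1⟩) (fun a _ => (a.2, a.1)) ?_ ?_ ?_ ?_ ?_ <;>
    simp [mem_rect] <;> omega

/-- Translation of the rectangle. -/
theorem integral_rectFn_sink (hm : 1 ≤ m) (hmN : m < N) (hbar : ℝ) (lam : ℕ → ℝ) (x : ℝ) :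
    Complex.exp (Complex.I * (∑ k ∈ Finset.Icc 1 m, (lam k : ℂ)) * x) *
      ∫ s : rect N m → ℝ, rectFn N m hbar (sinkValue N x) (rectQ N m lam) (fun v => (s v : ℂ)) =
    Complex.exp (Complex.I * (∑ k ∈ Finset.Icc 1 m, (lam (N - m + k) : ℂ)) * x) *
      ∫ s : rect N m → ℝ, rectFn N m hbar (sourceValue N x) (rectQ N m lam)
        fun v => (s v : ℂ) := by
  rw [← integral_add_right_eq_self (μ := volume) (fun s : rect N m → ℝ =>
    rectFn N m hbar (sourceValue N x) (rectQ N m lam) fun v => (s v : ℂ)) (fun _ => x),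
    ← integral_const_mul, ← integral_const_mul]
  refine integral_congr_ae (ae_of_all _ fun s => ?_)
  simp only [rectFn, expSum, ← Complex.exp_add]
  have h1 : ∀ a : (grArrows N m).ToType,
      affC (arrowK (rect N m) a.1) (arrowC (rect N m) (sinkValue N x) a.1) (fun v => (s v : ℂ)) =
      affC (arrowK (rect N m) a.1) (arrowC (rect N m) (sourceValue N x) a.1)
        (fun v => (((s + fun _ => x : rect N m → ℝ) v : ℝ) : ℂ)) := by
    intro a
    obtain ⟨h2, h3, h4, h5⟩ := grArrows_ends hm hmN (Multiset.coe_mem (x := a))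
    rw [affC_ofReal, affC_ofReal, affR_arrow, affR_arrow]
    congr 1
    have hN : (N, N) ≠ (N, 1) := by simp; omega
    have e1 : ∀ (c : ℕ × ℕ → ℝ) (s : rect N m → ℝ), vcoordR c s (N, 1) = c (N, 1) := fun c s =>
      dif_neg (by simp [mem_rect])
    have e2 : ∀ (c : ℕ × ℕ → ℝ) (s : rect N m → ℝ), vcoordR c s (N, N) = c (N, N) := fun c s =>
      dif_neg (by simp [mem_rect])
    have e3 : ∀ p ∈ rect N m, vcoordR (sourceValue N x) (s + fun _ => x) p =
        vcoordR (sinkValue N x) s p + x := by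
      intro p hp
      simp [vcoordR, hp]
    rcases h3 with h3 | h3 <;> rcases h4 with h4 | h4
    · rw [e3 _ h3, e3 _ h4]; ring
    · rw [e3 _ h3, h4, e2, e2]; simp [sinkValue, sourceValue, hN]; ring
    · rw [e3 _ h4, h3, e1, e1]; simp [sinkValue, sourceValue, hN.symm]
    · rw [h3, h4] at h5; simp [mem_rect] at h5
  simp_rw [h1]
  congr 1
  have h2 := sum_rectQ hmN lam
  have h3 : ∑ v : rect N m, Complex.I * (rectQ N m lam v : ℂ) * (((s + fun _ => x : rect N m → ℝ) v : ℝ) : ℂ) =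
      ∑ v : rect N m, Complex.I * (rectQ N m lam v : ℂ) * (s v : ℂ) +
        Complex.I * (∑ v : rect N m, (rectQ N m lam v : ℂ)) * x := by
    rw [Finset.mul_sum, Finset.sum_mul, ← Finset.sum_add_distrib]
    refine Finset.sum_congr rfl fun v _ => ?_
    simp only [Pi.add_apply]
    push_cast
    ring
  rw [h3, h2]
  ring

end Phase

/-! ### Coordinates adapted to the arrows outside the rectangle -/

section Out
variable {N m : ℕ}

/-- The vertices outside the rectangle. -/
abbrev Out (N m : ℕ) := {v : gz N // v.1 ∉ rect N m}

/-- The coefficients of the variable attached to a vertex outside the rectangle. -/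
def outK (m : ℕ) (p : gz N) : gz N → ℝ := arrowK (gz N) (outArrow m p.1)

theorem outK_self (p : gz N) : |outK m p p| = 1 := by
  rcases outArrow_cases m p.1 with ⟨-, h⟩ | ⟨-, h⟩ <;> simp [outK, arrowK, h, Prod.ext_iff]

theorem outK_eq_zero {p v : gz N} (h1 : v ≠ p) (h2 : v.1.1 ≠ p.1.1 + 1) : outK m p v = 0 := by
  have h3 : v.1 ≠ p.1 := fun e => h1 (Subtype.ext e)
  rcases outArrow_cases m p.1 with ⟨-, h⟩ | ⟨-, h⟩ <;>
    simp [outK, arrowK, h, h3, Prod.ext_iff (x := v.1) (y := (_, _)), h2]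

/-- The matrix of the coordinates adapted to the arrows outside the rectangle. -/
def outMatrix (N m : ℕ) : Matrix (gz N) (gz N) ℝ := fun p v =>
  if p.1 ∈ rect N m then (if p = v then 1 else 0) else outK m p v

theorem abs_det_outMatrix : |(outMatrix N m).det| = 1 := by
  have h1 : (outMatrix N m).BlockTriangular fun v => v.1.1 := by
    intro p v h
    have h2 : p ≠ v := by rintro rfl; exact lt_irrefl _ h
    simp only [outMatrix]
    split_ifs
    · rfl
    · exact outK_eq_zero h2.symm (by simp only at h; omega)
  rw [h1.det, Finset.abs_prod]
  refine Finset.prod_eq_one fun a _ => ?_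
  have h2 : (outMatrix N m).toSquareBlock (fun v => v.1.1) a =
      Matrix.diagonal fun v => outMatrix N m v.1 v.1 := by
    ext p v
    simp only [Matrix.toSquareBlock_def, Matrix.of_apply, Matrix.diagonal_apply]
    by_cases h : p = v
    · rw [if_pos h, h]
    · have h3 : p.1 ≠ v.1 := fun e => h (Subtype.ext e)
      rw [if_neg h, outMatrix, if_neg h3]
      split_ifs
      · rfl
      · exact outK_eq_zero h3.symm (by rw [v.2, p.2]; omega)
  rw [h2, Matrix.det_diagonal, Finset.abs_prod]
  refine Finset.prod_eq_one fun v _ => ?_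
  by_cases h : v.1.1 ∈ rect N m
  · simp [outMatrix, h]
  · simpa [outMatrix, h] using outK_self v.1

theorem det_outMatrix_ne_zero : (outMatrix N m).det ≠ 0 := by
  intro h
  have := abs_det_outMatrix (N := N) (m := m)
  simp [h] at this

/-- The change to the coordinates adapted to the arrows outside the rectangle. -/
def outEquiv (N m : ℕ) : (gz N → ℝ) ≃L[ℝ] (gz N → ℝ) :=
  (Matrix.toLinearEquiv' (outMatrix N m)
    ((outMatrix N m).invertibleOfIsUnitDet det_outMatrix_ne_zero.isUnit)).toContinuousLinearEquiv

theorem outEquiv_apply (s : gz N → ℝ) : outEquiv N m s = (outMatrix N m).mulVec s := rfl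

theorem outEquiv_rect (s : gz N → ℝ) {v : gz N} (hv : v.1 ∈ rect N m) : outEquiv N m s v = s v := by
  simp [outEquiv_apply, Matrix.mulVec, dotProduct, outMatrix, hv]

theorem outEquiv_out (s : gz N → ℝ) {v : gz N} (hv : v.1 ∉ rect N m) :
    outEquiv N m s v = affR (outK m v) 0 s := by
  simp [outEquiv_apply, Matrix.mulVec, dotProduct, outMatrix, hv, affR]

theorem measurePreserving_outEquiv : MeasurePreserving (outEquiv N m) := by
  refine ⟨(outEquiv N m).continuous.measurable, ?_⟩
  have h := Real.map_matrix_volume_pi_eq_smul_volume_pi (det_outMatrix_ne_zero (N := N) (m := m))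
  rw [abs_inv, abs_det_outMatrix] at h
  rw [inv_one, ENNReal.ofReal_one, one_smul] at h
  exact h

/-- The restriction to the rectangle. -/
def toRect {α : Type*} (z : gz N → α) (v : rect N m) : α := z ⟨v.1, rect_subset_gz N m v.2⟩

theorem integral_rect_out (G : (rect N m → ℝ) → ℂ) (g : Out N m → ℝ → ℂ) :
    ∫ s : gz N → ℝ, G (toRect s) * ∏ p : Out N m, g p (affR (outK m p.1) 0 s) =
      (∫ s, G s) * ∏ p, ∫ u, g p u := by
  have h1 : ∀ s : gz N → ℝ, G (toRect s) * ∏ p : Out N m, g p (affR (outK m p.1) 0 s) =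
      (fun y : gz N → ℝ => G (toRect y) * ∏ p : Out N m, g p (y p.1)) (outEquiv N m s) := by
    intro s
    simp only
    congr 1
    · congr 1
      ext v
      exact (outEquiv_rect s v.2).symm
    · exact Finset.prod_congr rfl fun p _ => by rw [outEquiv_out s p.2]
  rw [integral_congr_ae (ae_of_all _ h1)]
  rw [measurePreserving_outEquiv.integral_comp (outEquiv N m).toHomeomorph.measurableEmbedding
    (fun y : gz N → ℝ => G (toRect y) * ∏ p : Out N m, g p (y p.1))]
  let e : {v : gz N // v.1 ∈ rect N m} ≃ rect N m :=
    ⟨fun v => ⟨v.1.1, v.2⟩, fun v => ⟨⟨v.1, rect_subset_gz N m v.2⟩, v.2⟩, fun _ => rfl,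
      fun _ => rfl⟩
  have h2 := (volume_preserving_piEquivPiSubtypeProd (fun _ : gz N => ℝ)
    (fun v => v.1 ∈ rect N m)).integral_comp' (fun y : ({v : gz N // v.1 ∈ rect N m} → ℝ) ×
      (Out N m → ℝ) => G (fun v => y.1 (e.symm v)) * ∏ p, g p (y.2 p))
  have h3 := (volume_measurePreserving_piCongrLeft (fun _ : rect N m => ℝ) e).integral_comp' G
  have h4 : ∀ s : {v : gz N // v.1 ∈ rect N m} → ℝ,
      MeasurableEquiv.piCongrLeft (fun _ : rect N m => ℝ) e s = fun v => s (e.symm v) := by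
    intro s
    ext v
    obtain ⟨w, rfl⟩ := e.surjective v
    rw [MeasurableEquiv.coe_piCongrLeft, Equiv.piCongrLeft_apply_apply, e.symm_apply_apply]
  simp_rw [h4] at h3
  rw [← h3, ← integral_fintype_prod_volume_eq_prod, ← integral_prod_mul, ← Measure.volume_eq_prod]
  exact h2

theorem vcoord_toRect (c : ℕ × ℕ → ℝ) (z : gz N → ℂ) {p : ℕ × ℕ} (hp : p ∈ rect N m ∨ p ∉ gz N) :
    vcoord (V := rect N m) c (toRect z) p = vcoord c z p := by
  rcases hp with hp | hp
  · rw [vcoord, vcoord, dif_pos hp, dif_pos (rect_subset_gz N m hp), toRect]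
  · rw [vcoord, vcoord, dif_neg hp, dif_neg fun h => hp (rect_subset_gz N m h)]

theorem affC_toRect (hm : 1 ≤ m) (hmN : m < N) (c : ℕ × ℕ → ℝ) (z : gz N → ℂ) {a : Arrow}
    (ha : a ∈ grArrows N m) : affC (arrowK (rect N m) a) (arrowC (rect N m) c a) (toRect z) =
      affC (arrowK (gz N) a) (arrowC (gz N) c a) z := by
  obtain ⟨-, h1, h2, -⟩ := grArrows_ends hm hmN ha
  rw [affC_arrow, affC_arrow, vcoord_toRect, vcoord_toRect]
  · exact h1.imp_right fun h => by rw [h, mem_gz]; simp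
  · exact h2.imp_right fun h => by rw [h, mem_gz]; simp

theorem affR_toRect (hm : 1 ≤ m) (hmN : m < N) (c : ℕ × ℕ → ℝ) (s : gz N → ℝ) {a : Arrow}
    (ha : a ∈ grArrows N m) : affR (arrowK (rect N m) a) (arrowC (rect N m) c a) (toRect s) =
      affR (arrowK (gz N) a) (arrowC (gz N) c a) s := by
  have h := affC_toRect hm hmN c (fun v => (s v : ℂ)) ha
  rw [affC_ofReal] at h
  have h' : affC (arrowK (rect N m) a) (arrowC (rect N m) c a) (toRect fun v => (s v : ℂ)) =
    (affR (arrowK (rect N m) a) (arrowC (rect N m) c a) (toRect s) : ℝ) := affC_ofReal _ _ _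
  rw [h'] at h
  exact_mod_cast h

/-- The product of the integrand on the rectangle with Gamma integrands. -/
def pairFn (N m : ℕ) (hbar : ℝ) (c : ℕ × ℕ → ℝ) (q : rect N m → ℝ) (σ : Out N m → ℂ)
    (z : gz N → ℂ) : ℂ :=
  rectFn N m hbar c q (toRect z) * ∏ p : Out N m, gammaFn hbar (σ p) (affC (outK m p.1) 0 z)

/-- The index set of the exponentials in `pairFn`. -/
abbrev PairIndex (N m : ℕ) := (grArrows N m).ToType ⊕ Out N m

/-- The linear forms in the exponentials of `pairFn`. -/
def pairK (N m : ℕ) : PairIndex N m → gz N → ℝ :=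
  Sum.elim (fun a => arrowK (gz N) a.1) fun p => outK m p.1

/-- The constant terms in the exponentials of `pairFn`. -/
def pairC (N m : ℕ) (c : ℕ × ℕ → ℝ) : PairIndex N m → ℝ :=
  Sum.elim (fun a => arrowC (gz N) c a.1) fun _ => 0

theorem sum_rect_eq {β : Type*} [AddCommMonoid β] (f : rect N m → β) :
    ∑ v, f v = ∑ v : gz N, if h : v.1 ∈ rect N m then f ⟨v.1, h⟩ else 0 := by
  have h1 : ∀ v : rect N m, f v = if h : v.1 ∈ rect N m then f ⟨v.1, h⟩ else 0 := fun v => by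
    rw [dif_pos v.2]
  rw [Finset.sum_congr rfl fun v _ => h1 v,
    Finset.sum_coe_sort (rect N m) fun p => if h : p ∈ rect N m then f ⟨p, h⟩ else 0,
    Finset.sum_coe_sort (gz N) fun p => if h : p ∈ rect N m then f ⟨p, h⟩ else 0]
  exact Finset.sum_subset (rect_subset_gz N m) fun p _ h => dif_neg h

theorem pairFn_eq_expSum (hm : 1 ≤ m) (hmN : m < N) (hbar : ℝ) (c : ℕ × ℕ → ℝ) (q : rect N m → ℝ)
    (σ : Out N m → ℂ) : ∃ Q : gz N → ℂ, pairFn N m hbar c q σ =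
      expSum (Finset.univ : Finset (PairIndex N m)) (pairK N m) (pairC N m c)
        (fun _ => 1 / hbar) Q := by
  refine ⟨fun v => (if h : v.1 ∈ rect N m then Complex.I * q ⟨v.1, h⟩ else 0) +
    ∑ p : Out N m, σ p * outK m p.1 v, funext fun z => ?_⟩
  rw [pairFn, rectFn, expSum, expSum]
  simp only [gammaFn]
  rw [← Complex.exp_sum, ← Complex.exp_add]
  congr 1
  rw [Fintype.sum_sum_type, Finset.sum_sub_distrib]
  have h1 : ∀ a : (grArrows N m).ToType, affC (arrowK (rect N m) a.1) (arrowC (rect N m) c a.1)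
      (toRect z) = affC (pairK N m (.inl a)) (pairC N m c (.inl a)) z := fun a =>
    affC_toRect hm hmN c z Multiset.coe_mem
  simp_rw [h1, add_mul, Finset.sum_add_distrib]
  have h2 : ∑ v : rect N m, Complex.I * (q v : ℂ) * toRect z v = ∑ v : gz N,
      (if h : v.1 ∈ rect N m then Complex.I * (q ⟨v.1, h⟩ : ℂ) else 0) * z v := by
    rw [sum_rect_eq]
    refine Finset.sum_congr rfl fun v _ => ?_
    split_ifs
    · rfl
    · simp
  have h3 : ∑ v : gz N, (∑ p : Out N m, σ p * (outK m p.1 v : ℂ)) * z v =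
      ∑ p : Out N m, σ p * affC (outK m p.1) 0 z := by
    simp_rw [Finset.sum_mul, affC, Complex.ofReal_zero, zero_add, Finset.mul_sum, mul_assoc]
    exact Finset.sum_comm
  rw [h2, h3]
  push_cast
  simp only [pairK, pairC, Sum.elim_inr]
  ring

end Out

/-! ### The limit of the regularized pairing -/

section Pairing
variable {N m : ℕ}

theorem norm_le_rect_add_out (N m : ℕ) : ∃ C : ℝ, 0 < C ∧ ∀ s : gz N → ℝ,
    ‖s‖ ≤ C * (‖(toRect s : rect N m → ℝ)‖ + ∑ p : Out N m, |affR (outK m p.1) 0 s|) := by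
  refine ⟨‖((outEquiv N m).symm : (gz N → ℝ) →L[ℝ] (gz N → ℝ))‖ + 1, by positivity, fun s => ?_⟩
  have h0 : 0 ≤ ∑ p : Out N m, |affR (outK m p.1) 0 s| :=
    Finset.sum_nonneg fun _ _ => abs_nonneg _
  have h1 : ‖outEquiv N m s‖ ≤
      ‖(toRect s : rect N m → ℝ)‖ + ∑ p : Out N m, |affR (outK m p.1) 0 s| := by
    refine (pi_norm_le_iff_of_nonneg (by positivity)).2 fun v => ?_
    by_cases hv : v.1 ∈ rect N m
    · rw [outEquiv_rect s hv]
      have := norm_le_pi_norm (toRect s : rect N m → ℝ) ⟨v.1, hv⟩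
      exact this.trans (by linarith)
    · rw [outEquiv_out s hv, Real.norm_eq_abs]
      have := Finset.single_le_sum (f := fun p : Out N m => |affR (outK m p.1) 0 s|)
        (fun _ _ => abs_nonneg _) (Finset.mem_univ ⟨v, hv⟩)
      have h2 := norm_nonneg (toRect s : rect N m → ℝ)
      simp only at this
      linarith
  have h2 := ((outEquiv N m).symm : (gz N → ℝ) →L[ℝ] (gz N → ℝ)).le_opNorm (outEquiv N m s)
  have h3 : ((outEquiv N m).symm : (gz N → ℝ) →L[ℝ] (gz N → ℝ)) (outEquiv N m s) = s :=
    (outEquiv N m).symm_apply_apply s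
  rw [h3] at h2
  refine h2.trans (mul_le_mul (by linarith) h1 (norm_nonneg _) (by positivity))

theorem pair_proper (hm : 1 ≤ m) (hmN : m < N) (c : ℕ × ℕ → ℝ) : ∃ C : ℝ, ∀ s : gz N → ℝ,
    ‖s‖ ≤ C * (1 + ∑ i : PairIndex N m, |affR (pairK N m i) (pairC N m c i) s|) := by
  obtain ⟨C₁, h0, h1⟩ := norm_le_rect_add_out N m
  obtain ⟨C₂, h2⟩ := rect_proper hm hmN c
  refine ⟨C₁ * (max C₂ 1), fun s => (h1 s).trans ?_⟩
  rw [mul_assoc]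
  refine mul_le_mul_of_nonneg_left ?_ h0.le
  have h3 := h2 (toRect s)
  have h4 : ∀ a : (grArrows N m).ToType, affR (arrowK (rect N m) a.1) (arrowC (rect N m) c a.1)
      (toRect s) = affR (pairK N m (.inl a)) (pairC N m c (.inl a)) s := fun a =>
    affR_toRect hm hmN c s Multiset.coe_mem
  simp_rw [h4] at h3
  rw [Fintype.sum_sum_type]
  set A := ∑ a : (grArrows N m).ToType,
    |affR (pairK N m (.inl a)) (pairC N m c (.inl a)) s| with hA
  have hA0 : 0 ≤ A := Finset.sum_nonneg fun _ _ => abs_nonneg _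
  have h5 : 0 ≤ ∑ p : Out N m, |affR (pairK N m (.inr p)) (pairC N m c (.inr p)) s| :=
    Finset.sum_nonneg fun _ _ => abs_nonneg _
  have h6 : ∑ p : Out N m, |affR (outK m p.1) 0 s| =
    ∑ p : Out N m, |affR (pairK N m (.inr p)) (pairC N m c (.inr p)) s| := rfl
  rw [h6]
  have h7 : C₂ * (1 + A) ≤ max C₂ 1 * (1 + A) :=
    mul_le_mul_of_nonneg_right (le_max_left _ _) (by linarith)
  have h8 := mul_le_mul_of_nonneg_right (le_max_right C₂ 1) h5
  linarith

theorem pairK_ne_zero (hm : 1 ≤ m) (hmN : m < N) (i : PairIndex N m) : pairK N m i ≠ 0 := by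
  rcases i with a | p
  · obtain ⟨h1, -, -, h2⟩ := grArrows_ends hm hmN (Multiset.coe_mem (x := a))
    exact arrowK_ne_zero h1 (h2.imp (fun h => rect_subset_gz N m h) fun h => rect_subset_gz N m h)
  · exact arrowK_ne_zero (outArrow_ne m _) (outArrow_mem p.1.2)

theorem affC_pair (c : ℕ × ℕ → ℝ) (i : PairIndex N m) : ∃ a : Arrow, ∃ d : ℝ,
    a ∈ grArrows N m + (gz N \ rect N m).val.map (outArrow m) ∧ ∀ z : gz N → ℂ,
      affC (pairK N m i) (pairC N m c i) z = coord z a.2 - coord z a.1 + d := by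
  have h : ∀ (a : Arrow) (z : gz N → ℂ), coord z a.2 - coord z a.1 = affC (arrowK (gz N) a) 0 z := by
    intro a z
    have := affC_arrow (V := gz N) (fun _ => 0) a z
    rw [coord_eq_vcoord, coord_eq_vcoord, ← this]
    simp [arrowC]
  rcases i with a | p
  · refine ⟨a.1, arrowC (gz N) c a.1, Multiset.mem_add.2 (.inl Multiset.coe_mem), fun z => ?_⟩
    rw [h]
    simp [affC, pairK, pairC, add_comm]
  · refine ⟨outArrow m p.1, 0, Multiset.mem_add.2 (.inr (Multiset.mem_map_of_mem _ ?_)),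
      fun z => ?_⟩
    · exact Finset.mem_def.1 (Finset.mem_sdiff.2 ⟨p.1.2, p.2⟩)
    · rw [h]
      simp [affC, pairK, pairC, outK]

theorem pair_slight (hmN : m < N) (c : ℕ × ℕ → ℝ) {η : (gz N → ℝ) → (gz N → ℝ)}
    (h : ∃ K, ∀ a ∈ leftArrows N m + rightArrows N m, ∀ t ∈ Set.Icc (0 : ℝ) 1, ∀ s,
      -K ≤ (Complex.exp (coord (deform η t s) a.2 - coord (deform η t s) a.1)).re) :
    ∃ K, ∀ i ∈ (Finset.univ : Finset (PairIndex N m)), ∀ t ∈ Set.Icc (0 : ℝ) 1, ∀ s,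
      -K ≤ (Complex.exp (affC (pairK N m i) (pairC N m c i) (deform η t s))).re := by
  obtain ⟨K, hK⟩ := h
  rw [arrows_eq N m hmN] at hK
  choose a d ha hd using affC_pair (N := N) (m := m) c
  refine ⟨∑ i, |K| * Real.exp (d i), fun i _ t ht s => ?_⟩
  have h1 := hK (a i) (ha i) t ht s
  rw [hd, Complex.exp_add, ← Complex.ofReal_exp, Complex.re_mul_ofReal]
  have h2 := Finset.single_le_sum (f := fun i => |K| * Real.exp (d i))
    (fun _ _ => by positivity) (Finset.mem_univ i)
  have h3 := mul_le_mul_of_nonneg_right (h1) (Real.exp_pos (d i)).le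
  have h4 := mul_le_mul_of_nonneg_right (le_abs_self K) (Real.exp_pos (d i)).le
  linarith

theorem contDiff_pairFn (hm : 1 ≤ m) (hmN : m < N) (hbar : ℝ) (c : ℕ × ℕ → ℝ) (q : rect N m → ℝ)
    (σ : Out N m → ℂ) {n : ℕ∞ω} : ContDiff ℂ n (pairFn N m hbar c q σ) := by
  obtain ⟨Q, hQ⟩ := pairFn_eq_expSum hm hmN hbar c q σ
  rw [hQ]
  exact contDiff_expSum _ _ _ _ _

theorem contourIntegral_pairFn (hm : 1 ≤ m) (hmN : m < N) {hbar : ℝ} (hh : 0 < hbar)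
    (c : ℕ × ℕ → ℝ) (q : rect N m → ℝ) {σ : Out N m → ℂ}
    (hσ : ∀ p, 0 < (σ p).re ∨ (σ p).im ≠ 0)
    {η : (gz N → ℝ) → (gz N → ℝ)} (hη : ContDiff ℝ ∞ η) (hslope : ∃ L, ∀ s, ‖fderiv ℝ η s‖ ≤ L)
    (hslight : ∃ K, ∀ a ∈ leftArrows N m + rightArrows N m, ∀ t ∈ Set.Icc (0 : ℝ) 1, ∀ s,
      -K ≤ (Complex.exp (coord (deform η t s) a.2 - coord (deform η t s) a.1)).re)
    (hdecay : ∃ K c' : ℝ, 0 < c' ∧ ∀ s, ‖pairFn N m hbar c q σ (deform η 1 s)‖ ≤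
      K * Real.exp (-c' * ‖s‖)) :
    contourIntegral η (pairFn N m hbar c q σ) =
      (∫ s : rect N m → ℝ, rectFn N m hbar c q fun v => (s v : ℂ)) *
        ∏ p, (hbar : ℂ) ^ σ p * Complex.Gamma (σ p) := by
  have hsl := pair_slight hmN c hslight
  obtain ⟨M₁, h₁⟩ := tendsto_integral_regularized Finset.univ _ _
    (fun i _ => pairK_ne_zero hm hmN i) (pair_proper hm hmN c) (contDiff_pairFn hm hmN hbar c q σ)
    hη hslope hsl hdecay (by
      obtain ⟨Q, hQ⟩ := pairFn_eq_expSum hm hmN hbar c q σ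
      rw [hQ]
      exact expSum_growth _ _ _ _ (fun _ _ => by positivity) _ hη hslope hsl)
  obtain ⟨M₂, h₂⟩ := tendsto_rectFn_real hm hmN hh c q
  choose M₃ h₃ using fun p => tendsto_gamma hh (hσ p)
  have hS : 0 ≤ ∑ p, |M₃ p| := Finset.sum_nonneg fun _ _ => abs_nonneg _
  set M' := |M₁| + |M₂| + ∑ p, |M₃ p| with hM'
  have k1 : M₁ ≤ M' := by have := le_abs_self M₁; have := abs_nonneg M₂; linarith
  have k2 : M₂ ≤ M' := by have := le_abs_self M₂; have := abs_nonneg M₁; linarith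
  have k3 : ∀ p, M₃ p ≤ M' := by
    intro p
    have := Finset.single_le_sum (f := fun p => |M₃ p|) (fun _ _ => abs_nonneg _)
      (Finset.mem_univ p)
    have := le_abs_self (M₃ p)
    have := abs_nonneg M₂; have := abs_nonneg M₁
    linarith
  refine tendsto_nhds_unique (h₁ M' k1) (((h₂ M' k2).mul
    (tendsto_finsetProd Finset.univ fun p _ => h₃ p M' (k3 p))).congr fun ε => ?_)
  rw [← integral_rect_out]
  refine integral_congr_ae (ae_of_all _ fun s => ?_)
  simp only [pairFn]
  rw [Fintype.sum_sum_type, mul_add, Complex.exp_add, Finset.prod_mul_distrib, ← Complex.exp_sum,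
    rectReg, Finset.mul_sum (s := (Finset.univ : Finset (Out N m)))]
  have h4 : ∀ a : (grArrows N m).ToType, affR (arrowK (rect N m) a.1) (arrowC (rect N m) c a.1)
      (toRect s) = affR (pairK N m (.inl a)) (pairC N m c (.inl a)) s := fun a =>
    affR_toRect hm hmN c s Multiset.coe_mem
  simp_rw [h4, affC_ofReal]
  have h5 : (toRect fun v => (s v : ℂ) : rect N m → ℂ) = fun v => ((toRect s v : ℝ) : ℂ) := rfl
  rw [h5]
  simp only [pairK, pairC, Sum.elim_inr]
  ring

/-- The contour along which the variables of the Gamma integrals are tilted. -/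
def tiltContour (κ : Out N m → ℝ) (s : gz N → ℝ) : gz N → ℝ :=
  (outEquiv N m).symm fun v => if h : v.1 ∈ rect N m then 0 else κ ⟨v, h⟩ * ramp (outEquiv N m s v)

theorem tiltContour_rect (κ : Out N m → ℝ) (s : gz N → ℝ) {v : gz N} (hv : v.1 ∈ rect N m) :
    tiltContour κ s v = 0 := by
  rw [← outEquiv_rect (tiltContour κ s) hv, tiltContour, ContinuousLinearEquiv.apply_symm_apply, dif_pos hv]

theorem tiltContour_out (κ : Out N m → ℝ) (s : gz N → ℝ) (p : Out N m) :
    affR (outK m p.1) 0 (tiltContour κ s) = κ p * ramp (affR (outK m p.1) 0 s) := by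
  rw [← outEquiv_out (tiltContour κ s) p.2, tiltContour, ContinuousLinearEquiv.apply_symm_apply,
    dif_neg p.2, outEquiv_out _ p.2]

theorem contDiff_tiltContour (κ : Out N m → ℝ) : ContDiff ℝ ∞ (tiltContour κ) := by
  refine (outEquiv N m).symm.contDiff.comp (contDiff_pi.2 fun v => ?_)
  split_ifs
  · exact contDiff_const
  · exact contDiff_const.mul (contDiff_ramp.comp ((contDiff_apply ℝ ℝ v).comp
      (outEquiv N m).contDiff))

theorem abs_ramp_sub_ramp_le (a b : ℝ) : |ramp a - ramp b| ≤ |a - b| := by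
  have h := convex_univ.norm_image_sub_le_of_norm_deriv_le (f := ramp) (C := 1)
    (fun u _ => (hasDerivAt_ramp u).differentiableAt) (fun u _ => by
      rw [(hasDerivAt_ramp u).deriv, Real.norm_eq_abs, abs_of_pos (by positivity),
        div_le_one (by positivity)]
      linarith [Real.exp_pos u]) (Set.mem_univ b) (Set.mem_univ a)
  simpa using h

theorem tiltContour_slope (κ : Out N m → ℝ) : ∃ L, ∀ s, ‖fderiv ℝ (tiltContour κ) s‖ ≤ L := by
  have h1 : LipschitzWith (∑ p, ‖κ p‖₊) fun (y : gz N → ℝ) (v : gz N) =>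
      if h : v.1 ∈ rect N m then 0 else κ ⟨v, h⟩ * ramp (y v) := by
    refine LipschitzWith.of_dist_le_mul fun y y' => (dist_pi_le_iff (by positivity)).2 fun v => ?_
    split_ifs with hv
    · rw [dist_self]; positivity
    · rw [Real.dist_eq, ← mul_sub, abs_mul]
      push_cast
      refine mul_le_mul ?_ ?_ (abs_nonneg _) (Finset.sum_nonneg fun _ _ => norm_nonneg _)
      · exact Finset.single_le_sum (f := fun p => ‖κ p‖) (fun _ _ => norm_nonneg _)
          (Finset.mem_univ (⟨v, hv⟩ : Out N m))
      · refine (abs_ramp_sub_ramp_le _ _).trans ?_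
        rw [← Real.dist_eq]
        exact dist_le_pi_dist y y' v
  exact ⟨_, fun s => norm_fderiv_le_of_lipschitz ℝ
    ((outEquiv N m).symm.lipschitz.comp (h1.comp (outEquiv N m).lipschitz))⟩

theorem coord_deform_tiltContour_rect (κ : Out N m → ℝ) (t : ℝ) (s : gz N → ℝ) {p : ℕ × ℕ}
    (hp : p ∈ rect N m ∨ p ∉ gz N) : coord (deform (tiltContour κ) t s) p =
      (vcoordR (fun _ => 0) s p : ℝ) := by
  rw [coord_eq_vcoord, vcoord, vcoordR]
  rcases hp with hp | hp
  · rw [dif_pos (rect_subset_gz N m hp), dif_pos (rect_subset_gz N m hp), deform,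
      tiltContour_rect κ s hp]
    simp
  · rw [dif_neg hp, dif_neg hp]

theorem affC_deform_tiltContour (κ : Out N m → ℝ) (t : ℝ) (s : gz N → ℝ) (p : Out N m) :
    affC (outK m p.1) 0 (deform (tiltContour κ) t s) = (affR (outK m p.1) 0 s : ℝ) +
      ((t * (κ p * ramp (affR (outK m p.1) 0 s)) : ℝ) : ℂ) * Complex.I := by
  rw [affC_deform, tiltContour_out]

theorem tiltContour_slight (hm : 1 ≤ m) (hmN : m < N) (κ : Out N m → ℝ) :
    ∃ K, ∀ a ∈ leftArrows N m + rightArrows N m, ∀ t ∈ Set.Icc (0 : ℝ) 1, ∀ s,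
      -K ≤ (Complex.exp (coord (deform (tiltContour κ) t s) a.2 -
        coord (deform (tiltContour κ) t s) a.1)).re := by
  have h0 : ∀ p, 0 ≤ (κ p) ^ 2 + 1 := fun p => by positivity
  refine ⟨∑ p, ((κ p) ^ 2 + 1), fun a ha t ht s => ?_⟩
  rw [arrows_eq N m hmN] at ha
  rcases Multiset.mem_add.1 ha with ha | ha
  · obtain ⟨-, h1, h2, -⟩ := grArrows_ends hm hmN ha
    rw [coord_deform_tiltContour_rect, coord_deform_tiltContour_rect, ← Complex.ofReal_sub,
      ← Complex.ofReal_exp, Complex.ofReal_re]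
    · exact (neg_nonpos.2 (Finset.sum_nonneg fun p _ => h0 p)).trans (Real.exp_pos _).le
    · exact h1.imp_right fun h => by rw [h, mem_gz]; simp
    · exact h2.imp_right fun h => by rw [h, mem_gz]; simp
  · obtain ⟨p, hp, rfl⟩ := Multiset.mem_map.1 ha
    obtain ⟨hp1, hp2⟩ := Finset.mem_sdiff.1 (Finset.mem_def.2 hp)
    have h1 := affC_arrow (V := gz N) (fun _ => 0) (outArrow m p) (deform (tiltContour κ) t s)
    have h2 : arrowC (gz N) (fun _ => 0) (outArrow m p) = 0 := by simp [arrowC]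
    rw [coord_eq_vcoord, coord_eq_vcoord, ← h1, h2]
    have h3 := affC_deform_tiltContour κ t s ⟨⟨p, hp1⟩, hp2⟩
    rw [outK] at h3
    rw [h3, Complex.exp_re]
    have h4 := (exp_mul_cos_ramp_le (κ ⟨⟨p, hp1⟩, hp2⟩) t
      (affR (arrowK (gz N) (outArrow m p)) 0 s) ht).1
    have h5 := Finset.single_le_sum (f := fun p => (κ p) ^ 2 + 1) (fun p _ => h0 p)
      (Finset.mem_univ (⟨⟨p, hp1⟩, hp2⟩ : Out N m))
    simp
    linarith

theorem tiltContour_decay (hm : 1 ≤ m) (hmN : m < N) {hbar : ℝ} (hh : 0 < hbar)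
    (c : ℕ × ℕ → ℝ) (q : rect N m → ℝ) {σ : Out N m → ℂ} {κ : Out N m → ℝ}
    (hκ : ∀ p, 0 < (σ p).re - κ p * (σ p).im) :
    ∃ K c' : ℝ, 0 < c' ∧ ∀ s, ‖pairFn N m hbar c q σ (deform (tiltContour κ) 1 s)‖ ≤
      K * Real.exp (-c' * ‖s‖) := by
  obtain ⟨K₁, c₁, hc₁, h₁⟩ := rectFn_decay hm hmN hh c q
  choose K₂ c₂ hc₂ h₂ using fun p => gammaFn_decay hh (hκ p)
  obtain ⟨C, hC, h₃⟩ := norm_le_rect_add_out N m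
  obtain ⟨δ, hδ, hδ₁, hδ₂⟩ : ∃ δ : ℝ, 0 < δ ∧ δ ≤ c₁ ∧ ∀ p, δ ≤ c₂ p := by
    obtain ⟨δ, h1, h2⟩ : ∃ δ : ℝ, 0 < δ ∧ ∀ i : Option (Out N m), δ ≤ i.elim c₁ c₂ := by
      obtain ⟨i, -, hi⟩ := Finset.exists_min_image Finset.univ
        (fun i : Option (Out N m) => i.elim c₁ c₂) Finset.univ_nonempty
      refine ⟨i.elim c₁ c₂, ?_, fun j => hi j (Finset.mem_univ j)⟩
      cases i
      · exact hc₁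
      · exact hc₂ _
    exact ⟨δ, h1, h2 none, fun p => h2 (some p)⟩
  have hK₁ : 0 ≤ K₁ := by
    have := (norm_nonneg _).trans (h₁ 0)
    exact nonneg_of_mul_nonneg_left this (Real.exp_pos _)
  have hK₂ : ∀ p, 0 ≤ K₂ p := fun p => by
    have := (norm_nonneg _).trans (h₂ p 0)
    exact nonneg_of_mul_nonneg_left this (Real.exp_pos _)
  refine ⟨K₁ * ∏ p, K₂ p, δ / C, by positivity, fun s => ?_⟩
  have e1 : (toRect (deform (tiltContour κ) 1 s) : rect N m → ℂ) =
      fun v => ((toRect s v : ℝ) : ℂ) := by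
    ext v
    simp [toRect, deform, tiltContour_rect κ s (v := ⟨v.1, rect_subset_gz N m v.2⟩) v.2]
  rw [pairFn, e1, norm_mul, norm_prod]
  have h4 : ∏ p : Out N m, ‖gammaFn hbar (σ p) (affC (outK m p.1) 0 (deform (tiltContour κ) 1 s))‖ ≤
      ∏ p : Out N m, (K₂ p * Real.exp (-δ * |affR (outK m p.1) 0 s|)) := by
    refine Finset.prod_le_prod (fun _ _ => norm_nonneg _) fun p _ => ?_
    rw [affC_deform_tiltContour, one_mul, mul_comm _ Complex.I]
    refine (h₂ p _).trans (mul_le_mul_of_nonneg_left (Real.exp_le_exp.2 ?_) (hK₂ p))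
    have := mul_le_mul_of_nonneg_right (hδ₂ p) (abs_nonneg (affR (outK m p.1) 0 s))
    linarith
  have h5 : ‖rectFn N m hbar c q fun v => ((toRect s v : ℝ) : ℂ)‖ ≤
      K₁ * Real.exp (-δ * ‖(toRect s : rect N m → ℝ)‖) := by
    refine (h₁ _).trans (mul_le_mul_of_nonneg_left (Real.exp_le_exp.2 ?_) hK₁)
    have := mul_le_mul_of_nonneg_right hδ₁ (norm_nonneg (toRect s : rect N m → ℝ))
    linarith
  refine (mul_le_mul h5 h4 (Finset.prod_nonneg fun _ _ => norm_nonneg _) (by positivity)).trans ?_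
  rw [Finset.prod_mul_distrib, ← Real.exp_sum, mul_mul_mul_comm, ← Real.exp_add]
  refine mul_le_mul_of_nonneg_left (Real.exp_le_exp.2 ?_)
    (mul_nonneg hK₁ (Finset.prod_nonneg fun p _ => hK₂ p))
  rw [← Finset.mul_sum, ← mul_add]
  have h6 := h₃ s
  have h7 : δ / C * ‖s‖ ≤ δ * (‖(toRect s : rect N m → ℝ)‖ +
      ∑ p : Out N m, |affR (outK m p.1) 0 s|) := by
    calc _ ≤ δ / C * (C * (‖(toRect s : rect N m → ℝ)‖ +
      ∑ p : Out N m, |affR (outK m p.1) 0 s|)) := by gcongr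
      _ = _ := by field_simp
  linarith

end Pairing

/-! ### The integrand of the Whittaker function -/

section Integrand
variable {N m : ℕ}

theorem contDiff_coord (p : ℕ × ℕ) {n : ℕ∞ω} : ContDiff ℂ n fun z : gz N → ℂ => coord z p := by
  unfold coord
  split_ifs
  · exact contDiff_apply ℂ ℂ _
  · exact contDiff_const

theorem contDiff_potential (A : Multiset Arrow) {n : ℕ∞ω} :
    ContDiff ℂ n fun z : gz N → ℂ => potential A (coord z) := by
  simp_rw [potential_eq_sum]
  exact ContDiff.sum fun a _ => ((contDiff_coord _).sub (contDiff_coord _)).cexp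

theorem contDiff_psiR (hbar : ℝ) (lam : ℕ → ℝ) {n : ℕ∞ω} :
    ContDiff ℂ n (psiR N m hbar lam) := by
  refine contDiff_const.mul (ContDiff.cexp ((ContDiff.neg (ContDiff.sum fun k _ =>
    contDiff_const.mul (contDiff_coord _))).sub (contDiff_const.mul (contDiff_potential _))))

theorem contDiff_psiL (hbar : ℝ) (lam : ℕ → ℝ) {n : ℕ∞ω} :
    ContDiff ℂ n (psiL N m hbar lam) := by
  refine contDiff_const.mul (ContDiff.cexp (((ContDiff.neg (ContDiff.sum fun k _ =>
    contDiff_const.mul (ContDiff.sum fun i _ => contDiff_coord _))).add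
      (ContDiff.sum fun k _ => contDiff_const.mul (contDiff_coord _))).sub
      (contDiff_const.mul (contDiff_potential _))))

/-- The exponent of the Gamma function attached to a vertex outside the rectangle. -/
def outExp (N m : ℕ) (lam : ℕ → ℝ) (p : ℕ × ℕ) : ℂ :=
  if m < p.2 then (rho N p.2 : ℂ) - Complex.I * lam (p.1 + 1)
  else (rho N (p.1 + 1 - p.2) : ℂ) + Complex.I * lam (p.1 + 1)

@[to_additive]
theorem prod_out_eq {β : Type*} [CommMonoid β] (f : ℕ × ℕ → β) :
    ∏ p : Out N m, f p.1.1 = ∏ p ∈ gz N \ rect N m, f p := by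
  refine Finset.prod_bij' (fun p _ => p.1.1)
    (fun p h => ⟨⟨p, (Finset.mem_sdiff.1 h).1⟩, (Finset.mem_sdiff.1 h).2⟩) ?_ ?_ ?_ ?_ ?_
  · intro p _; exact Finset.mem_sdiff.2 ⟨p.1.2, p.2⟩
  all_goals simp

@[to_additive]
theorem prod_sdiff_rect {β : Type*} [CommMonoid β] (hmN : m < N) (f : ℕ × ℕ → β) :
    ∏ p ∈ gz N \ rect N m, f p =
      (∏ k ∈ Finset.Icc (m + 1) (N - 1), ∏ n ∈ Finset.Ico k N, f (n, k)) *
      ∏ e ∈ Finset.Icc (N - m + 1) (N - 1), ∏ n ∈ Finset.Ico e N, f (n, n + 1 - e) := by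
  rw [← Finset.prod_filter_mul_prod_filter_not (gz N \ rect N m) (fun p => m < p.2)]
  congr 1
  · rw [Finset.prod_sigma']
    refine Finset.prod_bij' (fun p _ => ⟨p.2, p.1⟩) (fun a _ => (a.2, a.1)) ?_ ?_ ?_ ?_ ?_
    · simp [mem_gz, mem_rect]; omega
    · simp [mem_gz, mem_rect]; omega
    all_goals simp
  · rw [Finset.prod_sigma']
    refine Finset.prod_bij' (fun p _ => ⟨p.1 + 1 - p.2, p.1⟩) (fun a _ => (a.2, a.2 + 1 - a.1))
      ?_ ?_ ?_ ?_ ?_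
    · rintro ⟨n, k⟩ h
      simp only [Finset.mem_filter, mem_out] at h
      simp only [Finset.mem_sigma, Finset.mem_Icc, Finset.mem_Ico]
      omega
    · rintro ⟨e, n⟩ h
      simp only [Finset.mem_sigma, Finset.mem_Icc, Finset.mem_Ico] at h
      simp only [Finset.mem_filter, mem_out]
      omega
    · rintro ⟨n, k⟩ h
      simp only [Finset.mem_filter, mem_out] at h
      simp only [Prod.mk.injEq, true_and]
      omega
    · rintro ⟨e, n⟩ h
      simp only [Finset.mem_sigma, Finset.mem_Icc, Finset.mem_Ico] at h
      simp only [Sigma.mk.injEq, heq_eq_eq, and_true]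
      omega
    · rintro ⟨n, k⟩ h
      simp only [Finset.mem_filter, mem_out] at h
      simp only
      congr 2
      omega

theorem sum_Ico_sub_succ (f : ℕ → ℂ) {a b : ℕ} (h : a ≤ b) :
    ∑ n ∈ Finset.Ico a b, (f n - f (n + 1)) = f a - f b := by
  induction b, h using Nat.le_induction with
  | base => simp
  | succ b h ih => rw [Finset.sum_Ico_succ_top h, ih]; ring

/-- Summation by parts along the arrows outside the rectangle. -/
theorem sum_out_by_parts (hmN : m < N) (lam : ℕ → ℝ) {X : ℕ × ℕ → ℂ}
    (hX : ∀ i, X (N, i) = 0) :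
    ∑ p ∈ gz N \ rect N m, Complex.I * ((lam p.1 : ℂ) - lam (p.1 + 1)) * X p +
      (∑ e ∈ Finset.Icc (N - m + 1) (N - 1), (-(Complex.I * lam e) - rho N e) * X (e, 1) -
      ∑ k ∈ Finset.Icc (m + 1) (N - 1), mu N lam k * X (k, k)) =
    ∑ p ∈ gz N \ rect N m, outExp N m lam p * (X (outArrow m p).2 - X (outArrow m p).1) := by
  rw [← sub_eq_zero, add_sub_right_comm, ← Finset.sum_sub_distrib, sum_sdiff_rect hmN]
  have h1 : ∀ k ∈ Finset.Icc (m + 1) (N - 1), ∑ n ∈ Finset.Ico k N,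
      (Complex.I * ((lam n : ℂ) - lam (n + 1)) * X (n, k) - outExp N m lam (n, k) *
        (X (outArrow m (n, k)).2 - X (outArrow m (n, k)).1)) = mu N lam k * X (k, k) := by
    intro k hk
    have hk' := Finset.mem_Icc.1 hk
    have := sum_Ico_sub_succ (fun n => (Complex.I * lam n - rho N k) * X (n, k))
      (show k ≤ N by omega)
    simp only [hX, mul_zero, sub_zero] at this
    rw [mu, ← this]
    refine Finset.sum_congr rfl fun n _ => ?_
    have hmk : m < k := by omega
    simp only [outExp, outArrow, hmk, if_true, vert]
    ring
  have h2 : ∀ e ∈ Finset.Icc (N - m + 1) (N - 1), ∑ n ∈ Finset.Ico e N,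
      (Complex.I * ((lam n : ℂ) - lam (n + 1)) * X (n, n + 1 - e) - outExp N m lam (n, n + 1 - e) *
        (X (outArrow m (n, n + 1 - e)).2 - X (outArrow m (n, n + 1 - e)).1)) =
      (Complex.I * lam e + rho N e) * X (e, 1) := by
    intro e he
    have he' := Finset.mem_Icc.1 he
    have := sum_Ico_sub_succ (fun n => (Complex.I * lam n + rho N e) * X (n, n + 1 - e))
      (show e ≤ N by omega)
    simp only [hX, mul_zero, sub_zero, Nat.add_sub_cancel_left] at this
    rw [← this]
    refine Finset.sum_congr rfl fun n hn => ?_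
    have hn' := Finset.mem_Ico.1 hn
    have hmk : ¬ m < n + 1 - e := by omega
    have h3 : n + 1 - (n + 1 - e) = e := by omega
    have h4 : n + 1 - e + 1 = n + 1 + 1 - e := by omega
    simp only [outExp, outArrow, hmk, if_false, horiz, h3, h4]
    ring
  rw [Finset.sum_congr rfl h1, Finset.sum_congr rfl h2]
  have h3 : ∑ e ∈ Finset.Icc (N - m + 1) (N - 1), (-(Complex.I * lam e) - rho N e) * X (e, 1) =
      -∑ e ∈ Finset.Icc (N - m + 1) (N - 1), (Complex.I * lam e + rho N e) * X (e, 1) := by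
    rw [← Finset.sum_neg_distrib]
    exact Finset.sum_congr rfl fun e _ => by ring
  rw [h3]
  ring

theorem coord_add_rectVec (z : gz N → ℂ) (x : ℂ) (p : ℕ × ℕ) :
    coord (z + x • rectVec N m) p = coord z p + if p ∈ rect N m then x else 0 := by
  rw [coord, coord]
  by_cases h : p ∈ gz N
  · simp [dif_pos h, rectVec]
  · have : p ∉ rect N m := fun h' => h (rect_subset_gz N m h')
    simp [h, this]

theorem vcoord_sinkValue (x : ℝ) (z : gz N → ℂ) (p : ℕ × ℕ) :
    vcoord (sinkValue N x) z p = coord z p + if p = (N, N) then -(x : ℂ) else 0 := by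
  rw [vcoord, coord, sinkValue]
  by_cases h : p ∈ gz N
  · have : p ≠ (N, N) := by rintro rfl; simp [mem_gz] at h
    simp [h, this]
  · simp only [dif_neg h]
    split_ifs <;> simp

theorem potential_left_sink (hmN : m < N) (hm : 1 ≤ m) (x : ℝ) (z : gz N → ℂ) :
    potential (leftArrows N m) (coord z) =
      potential (leftArrows N m) (vcoord (sinkValue N x) z) := by
  rw [potential, potential]
  congr 1
  refine Multiset.map_congr rfl fun a ha => ?_
  have h : a.1 ≠ (N, N) ∧ a.2 ≠ (N, N) := by
    rw [leftArrows_eq] at ha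
    simp only [Multiset.mem_add, Multiset.mem_singleton, Multiset.mem_map, Finset.mem_val,
      Finset.mem_filter, mem_gz] at ha
    rcases ha with (rfl | ha) | ⟨p, h1, rfl⟩
    · simp; omega
    · obtain ⟨k, i, h1, h2, rfl⟩ := mem_rectVert.1 ha
      simp [vert]; omega
    · simp [vert, Prod.ext_iff]; omega
  rw [vcoord_sinkValue, vcoord_sinkValue, if_neg h.1, if_neg h.2, add_zero, add_zero]

theorem potential_right_sink (hmN : m < N) (hm : 1 ≤ m) (x : ℝ) (z : gz N → ℂ) :
    potential (rightArrows N m) (coord (z + (x : ℂ) • rectVec N m)) =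
      potential (rightArrows N m) (vcoord (sinkValue N x) z) := by
  rw [potential, potential]
  congr 1
  refine Multiset.map_congr rfl fun a ha => ?_
  have h : (a.1 ≠ (N, N) ∧ a.2 ≠ (N, N) ∧ (a.1 ∈ rect N m ↔ a.2 ∈ rect N m)) ∨
      (a.2 = (N, N) ∧ a.1 ≠ (N, N) ∧ a.1 ∈ rect N m ∧ a.2 ∉ rect N m) := by
    rw [rightArrows_eq N m hmN] at ha
    simp only [Multiset.mem_add, Multiset.mem_singleton, Multiset.mem_map, Finset.mem_val,
      Finset.mem_filter, mem_gz] at ha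
    rcases ha with (rfl | ha) | ⟨p, h1, rfl⟩
    · right; simp [mem_rect]; omega
    · left
      obtain ⟨k, i, h1, h2, rfl⟩ := mem_rectHoriz.1 ha
      simp [horiz, mem_rect]; omega
    · left; simp [horiz, mem_rect, Prod.ext_iff]; omega
  congr 1
  simp only [vcoord_sinkValue, coord_add_rectVec]
  rcases h with ⟨h1, h2, h3⟩ | ⟨h1, h2, h3, h4⟩
  · rw [if_neg h1, if_neg h2]
    by_cases h4 : a.1 ∈ rect N m
    · rw [if_pos h4, if_pos (h3.1 h4)]; ring
    · rw [if_neg h4, if_neg fun h => h4 (h3.2 h)]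
  · rw [if_pos h1, if_neg h2, if_pos h3, if_neg h4]; ring

theorem affC_outK (z : gz N → ℂ) (p : gz N) : affC (outK m p) 0 z =
    coord z (outArrow m p.1).2 - coord z (outArrow m p.1).1 := by
  have := affC_arrow (V := gz N) (fun _ => 0) (outArrow m p.1) z
  rw [coord_eq_vcoord, coord_eq_vcoord, ← this, outK]
  simp [arrowC]

theorem potential_sink (hmN : m < N) (hm : 1 ≤ m) (x : ℝ) (z : gz N → ℂ) :
    potential (leftArrows N m) (coord z) +
      potential (rightArrows N m) (coord (z + (x : ℂ) • rectVec N m)) =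
    (∑ a : (grArrows N m).ToType, Complex.exp (affC (arrowK (rect N m) a.1)
      (arrowC (rect N m) (sinkValue N x) a.1) (toRect z))) +
      ∑ p : Out N m, Complex.exp (affC (outK m p.1) 0 z) := by
  rw [potential_left_sink hmN hm x, potential_right_sink hmN hm]
  have h1 : ∀ X, potential (leftArrows N m) X + potential (rightArrows N m) X =
      potential (leftArrows N m + rightArrows N m) X := by
    intro X; simp [potential]
  have h2 : ∀ A B X, potential (A + B) X = potential A X + potential B X := by
    intro A B X; simp [potential]
  rw [h1, arrows_eq N m hmN, h2, potential_eq_sum]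
  congr 1
  · refine Finset.sum_congr rfl fun a _ => ?_
    rw [affC_toRect hm hmN _ _ Multiset.coe_mem, affC_arrow]
  · rw [potential, Multiset.map_map, ← Finset.sum_eq_multiset_sum]
    simp_rw [affC_outK]
    rw [sum_out_eq fun p => Complex.exp (coord z (outArrow m p).2 - coord z (outArrow m p).1)]
    refine Finset.sum_congr rfl fun p hp => ?_
    rw [mem_out] at hp
    have h4 : (outArrow m p).1 ≠ (N, N) ∧ (outArrow m p).2 ≠ (N, N) := by
      rcases outArrow_cases m p with ⟨h, e⟩ | ⟨h, e⟩ <;> rw [e] <;> simp [Prod.ext_iff] <;> omega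
    simp only [Function.comp_apply]
    rw [vcoord_sinkValue, vcoord_sinkValue, if_neg h4.1, if_neg h4.2, add_zero, add_zero]

theorem conj_coord (z : gz N → ℂ) (p : ℕ × ℕ) :
    (starRingEnd ℂ) (coord (fun v => (starRingEnd ℂ) (z v)) p) = coord z p := by
  rw [coord, coord]
  split_ifs <;> simp

theorem conj_psiL (hbar : ℝ) (lam : ℕ → ℝ) (z : gz N → ℂ) :
    (starRingEnd ℂ) (psiL N m hbar lam fun v => (starRingEnd ℂ) (z v)) =
      (starRingEnd ℂ) (1 / normC N (N - m + 1) hbar lam) *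
      Complex.exp (∑ p ∈ gz N, (Complex.I * ((lam p.1 : ℂ) - lam (p.1 + 1)) + 1) * coord z p
      + ∑ k ∈ Finset.Icc 1 (m - 1), (-(Complex.I * lam (N - k)) - rho N (N - k)) *
          coord z (N - k, 1)
      - 1 / (hbar : ℂ) * potential (leftArrows N m) (coord z)) := by
  have hmu : ∀ n, (starRingEnd ℂ) (mu N lam n) = -(Complex.I * lam n) - rho N n := by
    intro n; simp [mu]
  have hrho : ∀ n, ((rho N n : ℝ) : ℂ) - (rho N (n + 1) : ℝ) = 1 := by
    intro n; simp only [rho]; push_cast; ring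
  have h1 : ∑ p ∈ gz N, (Complex.I * ((lam p.1 : ℂ) - lam (p.1 + 1)) + 1) * coord z p =
      -∑ n ∈ Finset.Icc 1 (N - 1), ((-(Complex.I * lam n) - rho N n : ℂ) -
        (-(Complex.I * lam (n + 1)) - rho N (n + 1))) * ∑ i ∈ Finset.Icc 1 n, coord z (n, i) := by
    simp_rw [Finset.mul_sum]
    rw [Finset.sum_sigma', ← Finset.sum_neg_distrib]
    refine Finset.sum_bij' (fun p _ => ⟨p.1, p.2⟩) (fun a _ => (a.1, a.2)) ?_ ?_ ?_ ?_ ?_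
    · simp [mem_gz]; omega
    · simp [mem_gz]; omega
    · simp
    · simp
    · rintro ⟨n, k⟩ _
      simp only
      linear_combination -coord z (n, k) * hrho n
  rw [h1, psiL, map_mul, ← Complex.exp_conj]
  simp only [map_sub, map_add, map_neg, map_mul, map_sum, hmu, conj_coord, map_div₀, map_one,
    Complex.conj_ofReal, potential_eq_sum, ← Complex.exp_conj]

/-- The constant by which the integrand of the Whittaker function differs from `pairFn`. -/
def pairConst (N m : ℕ) (hbar : ℝ) (lam : ℕ → ℝ) (x : ℝ) : ℂ :=
  (starRingEnd ℂ) (1 / normC N (N - m + 1) hbar lam) * (1 / normC N (m + 1) hbar lam) *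
    Complex.exp (x * ∑ i ∈ Finset.Icc 1 m, mu N lam i)

theorem psiIntegrand_eq (hm : 1 ≤ m) (hmN : m < N) (hbar : ℝ) (lam : ℕ → ℝ) (x : ℝ) :
    psiIntegrand N m hbar lam (Pi.single 1 x) = fun z => pairConst N m hbar lam x *
      pairFn N m hbar (sinkValue N x) (rectQ N m lam) (fun p => outExp N m lam p.1.1) z := by
  funext z
  have h1 : expAct (logG m lam (Pi.single 1 x)) (psiR N m hbar lam) z = _ :=
    (hasSum_expTerm hm hmN lam x (contDiff_psiR hbar lam) z).tsum_eq
  rw [psiIntegrand, pairingIntegrand, h1, conj_psiL, pairFn, rectFn, expSum]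
  simp only [gammaFn]
  rw [psiR, ← Complex.exp_sum, ← Complex.exp_sum, pairConst]
  have h2 : ∀ P cL EL X cR ER : ℂ, P * (cL * EL) * (X * (cR * ER)) =
      cL * cR * X * (P * EL * ER) := by intros; ring
  rw [h2, ← Complex.exp_add, ← Complex.exp_add, ← Complex.exp_add]
  congr 2
  have f1 : ∑ v, -z v = -∑ p ∈ gz N, coord z p := by
    rw [← Finset.sum_coe_sort (gz N), Finset.sum_neg_distrib]
    congr 1
    exact Finset.sum_congr rfl fun v _ => by rw [coord, dif_pos v.2]
  have f2 : ∑ p ∈ gz N, (Complex.I * ((lam p.1 : ℂ) - lam (p.1 + 1)) + 1) * coord z p =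
      ∑ p ∈ gz N \ rect N m, Complex.I * ((lam p.1 : ℂ) - lam (p.1 + 1)) * coord z p +
      ∑ p ∈ rect N m, Complex.I * ((lam p.1 : ℂ) - lam (p.1 + 1)) * coord z p +
      ∑ p ∈ gz N, coord z p := by
    rw [Finset.sum_sdiff (rect_subset_gz N m), ← Finset.sum_add_distrib]
    exact Finset.sum_congr rfl fun p _ => by ring
  have f3 : ∑ p ∈ rect N m, Complex.I * ((lam p.1 : ℂ) - lam (p.1 + 1)) * coord z p =
      ∑ v : rect N m, Complex.I * (rectQ N m lam v : ℂ) * toRect z v := by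
    rw [← Finset.sum_coe_sort (rect N m)]
    refine Finset.sum_congr rfl fun v _ => ?_
    rw [coord, dif_pos (rect_subset_gz N m v.2), rectQ, toRect]
    push_cast
    ring
  have f4 : ∑ k ∈ Finset.Icc 1 (m - 1), (-(Complex.I * lam (N - k)) - rho N (N - k)) *
      coord z (N - k, 1) = ∑ e ∈ Finset.Icc (N - m + 1) (N - 1),
        (-(Complex.I * lam e) - rho N e) * coord z (e, 1) := by
    refine Finset.sum_bij' (fun k _ => N - k) (fun e _ => N - e) ?_ ?_ ?_ ?_ ?_ <;>
      simp <;> omega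
  have f5 : ∑ k ∈ Finset.Icc (m + 1) (N - 1), mu N lam k *
      coord (z + (x : ℂ) • rectVec N m) (k, k) =
      ∑ k ∈ Finset.Icc (m + 1) (N - 1), mu N lam k * coord z (k, k) := by
    refine Finset.sum_congr rfl fun k hk => ?_
    have := Finset.mem_Icc.1 hk
    rw [coord_add_rectVec, if_neg, add_zero]
    simp [mem_rect]; omega
  have f6 := sum_out_by_parts (m := m) hmN lam (X := coord z) fun i => dif_neg (by simp [mem_gz])
  have f7 := potential_sink hmN hm x z
  have f8 := sum_out_eq (N := N) (m := m) fun p =>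
    outExp N m lam p * (coord z (outArrow m p).2 - coord z (outArrow m p).1)
  simp_rw [← affC_outK] at f8
  rw [← f8] at f6
  rw [f1, f2, f3, f4, f5, Finset.sum_sub_distrib, ← Finset.mul_sum, ← Finset.mul_sum]
  push_cast
  linear_combination f6 - 1 / (hbar : ℂ) * f7

end Integrand

/-! ### Normalization factors and the Whittaker function -/

section Norm
variable {N m : ℕ}

theorem gamma_cond {lam : ℕ → ℝ} (hlam : ∀ j : ℕ, N + 3 ≤ 2 * j → j ≤ N → lam j ≠ 0) {i j : ℕ}
    (hij : i < j) (hj : j ≤ N) : 0 < rho N i ∨ lam j ≠ 0 := by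
  by_cases h : N + 3 ≤ 2 * j
  · exact .inr (hlam j h hj)
  · left
    have h2 : ((2 * i : ℕ) : ℝ) < (N + 1 : ℕ) := Nat.cast_lt.2 (by omega)
    push_cast at h2
    rw [rho]
    linarith

theorem normFactor_ne_zero {hbar : ℝ} (hh : 0 < hbar) {s : ℂ} (hs : 0 < s.re ∨ s.im ≠ 0) :
    (hbar : ℂ) ^ s * Complex.Gamma s ≠ 0 := by
  refine mul_ne_zero ?_ (Complex.Gamma_ne_zero fun n e => ?_)
  · simp [Complex.cpow_eq_zero_iff, hh.ne']
  · rcases hs with hs | hs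
    · rw [e] at hs
      simp at hs
      exact absurd hs (not_lt.2 (Nat.cast_nonneg n))
    · rw [e] at hs
      simp at hs

theorem normC_ne_zero {hbar : ℝ} (hh : 0 < hbar) {lam : ℕ → ℝ}
    (hlam : ∀ j : ℕ, N + 3 ≤ 2 * j → j ≤ N → lam j ≠ 0) (l : ℕ) : normC N l hbar lam ≠ 0 := by
  refine Finset.prod_ne_zero_iff.2 fun j hj => Finset.prod_ne_zero_iff.2 fun i hi =>
    normFactor_ne_zero hh ?_
  have := gamma_cond hlam (Finset.mem_Ico.1 hi).2 (Finset.mem_Icc.1 hj).2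
  simpa using this

theorem outExp_cond {lam : ℕ → ℝ} (hlam : ∀ j : ℕ, N + 3 ≤ 2 * j → j ≤ N → lam j ≠ 0)
    (p : Out N m) : 0 < (outExp N m lam p.1.1).re ∨ (outExp N m lam p.1.1).im ≠ 0 := by
  have hp := mem_out.1 (Finset.mem_sdiff.2 ⟨p.1.2, p.2⟩)
  rw [outExp]
  split_ifs
  · have := gamma_cond hlam (i := p.1.1.2) (j := p.1.1.1 + 1) (by omega) (by omega)
    simpa using this
  · have := gamma_cond hlam (i := p.1.1.1 + 1 - p.1.1.2) (j := p.1.1.1 + 1) (by omega) (by omega)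
    simpa using this

theorem prod_outExp (hmN : m < N) {hbar : ℝ} (hh : 0 < hbar) (lam : ℕ → ℝ) :
    ∏ p : Out N m, ((hbar : ℂ) ^ outExp N m lam p.1.1 * Complex.Gamma (outExp N m lam p.1.1)) =
      normC N (m + 1) hbar lam * (starRingEnd ℂ) (normC N (N - m + 1) hbar lam) := by
  rw [prod_out_eq fun p => (hbar : ℂ) ^ outExp N m lam p * Complex.Gamma (outExp N m lam p),
    prod_sdiff_rect hmN]
  congr 1
  · rw [normC, Finset.prod_sigma', Finset.prod_sigma']
    refine Finset.prod_bij' (fun a _ => ⟨a.2 + 1, a.1⟩) (fun a _ => ⟨a.2, a.1 - 1⟩) ?_ ?_ ?_ ?_ ?_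
    · simp; omega
    · simp; omega
    · simp
    · rintro ⟨j, i⟩ h
      simp only [Finset.mem_sigma, Finset.mem_Icc, Finset.mem_Ico] at h
      simp only [Sigma.mk.injEq, heq_eq_eq, and_true]
      omega
    · rintro ⟨k, n⟩ h
      simp only [Finset.mem_sigma, Finset.mem_Icc, Finset.mem_Ico] at h
      have : m < k := by omega
      simp [outExp, this]
  · rw [normC, map_prod]
    simp_rw [map_prod]
    rw [Finset.prod_sigma', Finset.prod_sigma']
    refine Finset.prod_bij' (fun a _ => ⟨a.2 + 1, a.1⟩) (fun a _ => ⟨a.2, a.1 - 1⟩) ?_ ?_ ?_ ?_ ?_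
    · simp; omega
    · simp; omega
    · simp
    · rintro ⟨j, i⟩ h
      simp only [Finset.mem_sigma, Finset.mem_Icc, Finset.mem_Ico] at h
      simp only [Sigma.mk.injEq, heq_eq_eq, and_true]
      omega
    · rintro ⟨e, n⟩ h
      simp only [Finset.mem_sigma, Finset.mem_Icc, Finset.mem_Ico] at h
      have h1 : ¬ m < n + 1 - e := by omega
      have h2 : n + 1 - (n + 1 - e) = e := by omega
      have h3 : (hbar : ℂ).arg ≠ Real.pi := by
        rw [Complex.arg_ofReal_of_nonneg hh.le]; exact Real.pi_pos.ne
      have h4 : (starRingEnd ℂ) ((rho N e : ℂ) - Complex.I * lam (n + 1)) =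
          (rho N e : ℂ) + Complex.I * lam (n + 1) := by simp
      simp only [outExp, h1, if_false, h2, map_mul]
      rw [← Complex.Gamma_conj, ← h4, Complex.cpow_conj _ _ h3, Complex.conj_ofReal]

theorem sum_rho (N m : ℕ) : ∑ i ∈ Finset.Icc 1 m, (rho N i : ℂ) = m * ((N : ℂ) - m) / 2 := by
  induction m with
  | zero => simp
  | succ m ih =>
    rw [Finset.sum_Icc_succ_top (by omega), ih, rho]
    push_cast
    ring

theorem pairConst_ne_zero {hbar : ℝ} (hh : 0 < hbar) {lam : ℕ → ℝ}
    (hlam : ∀ j : ℕ, N + 3 ≤ 2 * j → j ≤ N → lam j ≠ 0) (x : ℝ) :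
    pairConst N m hbar lam x ≠ 0 := by
  simp [pairConst, normC_ne_zero hh hlam, Complex.exp_ne_zero]

theorem exists_isPairingContour (hm : 1 ≤ m) (hmN : m < N) {hbar : ℝ} (hh : 0 < hbar) {lam : ℕ → ℝ}
    (hlam : ∀ j : ℕ, N + 3 ≤ 2 * j → j ≤ N → lam j ≠ 0) (x : ℝ) :
    ∃ η, IsPairingContour N m hbar lam (Pi.single 1 x) η := by
  choose κ hκ using fun p : Out N m => exists_tilt (outExp_cond hlam p)
  refine ⟨tiltContour κ, contDiff_tiltContour κ, tiltContour_slope κ, tiltContour_slight hm hmN κ,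
    ?_⟩
  obtain ⟨K, c, hc, h⟩ := tiltContour_decay hm hmN hh (sinkValue N x) (rectQ N m lam) hκ
  refine ⟨‖pairConst N m hbar lam x‖ * K, c, hc, fun s => ?_⟩
  rw [psiIntegrand_eq hm hmN, norm_mul, mul_assoc]
  exact mul_le_mul_of_nonneg_left (h s) (norm_nonneg _)

theorem IsPairingContour.integrable (hm : 1 ≤ m) (hmN : m < N) {hbar : ℝ} {lam : ℕ → ℝ} {x : ℝ}
    {η : (gz N → ℝ) → (gz N → ℝ)} (h : IsPairingContour N m hbar lam (Pi.single 1 x) η) :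
    Integrable (contourIntegrand η (psiIntegrand N m hbar lam (Pi.single 1 x))) := by
  obtain ⟨L, hL⟩ := h.slope
  obtain ⟨K, c, hc, hK⟩ := h.decay
  refine integrable_contourIntegrand (U := Set.univ) ?_ h.smooth (fun _ => trivial) hL hc hK
  rw [psiIntegrand_eq hm hmN]
  exact (continuous_const.mul (contDiff_pairFn (n := 0) hm hmN _ _ _ _).continuous).continuousOn

theorem Psi_eq (hm : 1 ≤ m) (hmN : m < N) {hbar : ℝ} (hh : 0 < hbar) {lam : ℕ → ℝ}
    (hlam : ∀ j : ℕ, N + 3 ≤ 2 * j → j ≤ N → lam j ≠ 0) {x : ℝ} {η : (gz N → ℝ) → (gz N → ℝ)}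
    (h : IsPairingContour N m hbar lam (Pi.single 1 x) η) :
    Psi N m hbar lam η (Pi.single 1 x) =
      Complex.exp (Complex.I * (∑ k ∈ Finset.Icc 1 m, (lam (N - m + k) : ℂ)) * x) *
        ∫ s : rect N m → ℝ, rectFn N m hbar (sourceValue N x) (rectQ N m lam)
          fun v => (s v : ℂ) := by
  have hC := pairConst_ne_zero (m := m) hh hlam x
  have h1 := contourIntegral_pairFn hm hmN hh (sinkValue N x) (rectQ N m lam)
    (fun p => outExp_cond hlam p) h.smooth h.slope h.slight (by
      obtain ⟨K, c, hc, hK⟩ := h.decay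
      refine ⟨‖pairConst N m hbar lam x‖⁻¹ * K, c, hc, fun s => ?_⟩
      have := hK s
      rw [psiIntegrand_eq hm hmN, norm_mul] at this
      rw [mul_assoc, ← div_eq_inv_mul, le_div_iff₀' (norm_pos_iff.2 hC)]
      exact this)
  have h2 : pairing η (psiL N m hbar lam) (expAct (logG m lam (Pi.single 1 x))
      (psiR N m hbar lam)) = pairConst N m hbar lam x * contourIntegral η
        (pairFn N m hbar (sinkValue N x) (rectQ N m lam) fun p => outExp N m lam p.1.1) := by
    change contourIntegral η (psiIntegrand N m hbar lam (Pi.single 1 x)) = _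
    rw [psiIntegrand_eq hm hmN, contourIntegral, contourIntegral, ← integral_const_mul]
    refine integral_congr_ae (ae_of_all _ fun s => ?_)
    simp only [contourIntegrand]
    ring
  rw [← integral_rectFn_sink hm hmN, Psi, h2, h1, prod_outExp hmN hh, pairConst]
  have h3 := normC_ne_zero hh hlam (m + 1)
  have h4 := normC_ne_zero hh hlam (N - m + 1)
  have h5 : (starRingEnd ℂ) (normC N (N - m + 1) hbar lam) ≠ 0 := by simpa using h4
  have h6 : Complex.exp (Complex.I * (∑ k ∈ Finset.Icc 1 m, (lam k : ℂ)) * x) =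
      Complex.exp ((x : ℂ) * (m * ((N : ℂ) - m) / 2)) *
        Complex.exp (x * ∑ i ∈ Finset.Icc 1 m, mu N lam i) := by
    rw [← Complex.exp_add, ← sum_rho]
    congr 1
    simp only [mu]
    rw [Finset.sum_sub_distrib, ← Finset.mul_sum]
    ring
  rw [h6, Pi.single_eq_same, map_div₀, map_one]
  field_simp

end Norm

/-! ### Calculus of the partial derivatives -/

section Calculus
variable {N : ℕ}

theorem pd_mul (p : ℕ × ℕ) {f g : Fn N} (hf : Differentiable ℂ f) (hg : Differentiable ℂ g)
    (z : gz N → ℂ) : pd p (fun z => f z * g z) z = f z * pd p g z + g z * pd p f z := by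
  by_cases h : p ∈ gz N
  · simp only [pd, dif_pos h]
    rw [fderiv_fun_mul (hf z) (hg z)]
    simp
  · simp [pd_of_notMem h]

theorem pd_add (p : ℕ × ℕ) {f g : Fn N} (hf : Differentiable ℂ f) (hg : Differentiable ℂ g)
    (z : gz N → ℂ) : pd p (fun z => f z + g z) z = pd p f z + pd p g z := by
  by_cases h : p ∈ gz N
  · simp only [pd, dif_pos h]
    rw [fderiv_fun_add (hf z) (hg z)]
    simp
  · simp [pd_of_notMem h]

theorem pd_sum {α : Type*} (p : ℕ × ℕ) (S : Finset α) {f : α → Fn N}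
    (hf : ∀ a ∈ S, Differentiable ℂ (f a)) (z : gz N → ℂ) :
    pd p (fun z => ∑ a ∈ S, f a z) z = ∑ a ∈ S, pd p (f a) z := by
  by_cases h : p ∈ gz N
  · simp only [pd, dif_pos h]
    rw [fderiv_fun_sum fun a ha => hf a ha z]
    simp
  · simp [pd_of_notMem h]

theorem pd_const (p : ℕ × ℕ) (c : ℂ) (z : gz N → ℂ) : pd p (fun _ => c) z = 0 := by
  by_cases h : p ∈ gz N
  · simp [pd, dif_pos h]
  · exact pd_of_notMem h _ _

theorem pd_smul (p : ℕ × ℕ) (c : ℂ) (f : Fn N) (z : gz N → ℂ) :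
    pd p (c • f) z = c * pd p f z := by
  by_cases h : p ∈ gz N
  · simp only [pd, dif_pos h]
    rw [fderiv_const_smul_field]
    simp
  · simp [pd_of_notMem h]

theorem pd_const_mul (p : ℕ × ℕ) (c : ℂ) (f : Fn N) (z : gz N → ℂ) :
    pd p (fun z => c * f z) z = c * pd p f z := pd_smul p c f z

theorem pd_cexp (p : ℕ × ℕ) {f : Fn N} (hf : Differentiable ℂ f) (z : gz N → ℂ) :
    pd p (fun z => Complex.exp (f z)) z = Complex.exp (f z) * pd p f z := by
  by_cases h : p ∈ gz N
  · simp only [pd, dif_pos h]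
    rw [(hf z).hasFDerivAt.cexp.fderiv]
    simp
  · simp [pd_of_notMem h]

theorem differentiable_coord (p : ℕ × ℕ) : Differentiable ℂ fun z : gz N → ℂ => coord z p :=
  (contDiff_coord (n := 1) p).differentiable (by simp)

theorem pd_coord {p : ℕ × ℕ} (hp : p ∈ gz N) (q : ℕ × ℕ) (z : gz N → ℂ) :
    pd p (fun z : gz N → ℂ => coord z q) z = if p = q then 1 else 0 := by
  simp only [pd, dif_pos hp]
  by_cases hq : q ∈ gz N
  · have h1 : (fun z : gz N → ℂ => coord z q) =
        (ContinuousLinearMap.proj (R := ℂ) (φ := fun _ : gz N => ℂ) ⟨q, hq⟩) := by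
      funext z; simp [coord, hq]
    rw [h1, ContinuousLinearMap.fderiv, ContinuousLinearMap.proj_apply, Pi.single_apply]
    simp [Subtype.ext_iff, eq_comm]
  · have h1 : (fun z : gz N → ℂ => coord z q) = fun _ => 0 := by
      funext z; simp [coord, hq]
    have h2 : p ≠ q := fun e => hq (e ▸ hp)
    rw [h1, if_neg h2]
    simp

theorem pd_exp_sub {p : ℕ × ℕ} (hp : p ∈ gz N) (b a : ℕ × ℕ) (z : gz N → ℂ) :
    pd p (fun z : gz N → ℂ => Complex.exp (coord z b - coord z a)) z =
      Complex.exp (coord z b - coord z a) *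
        ((if p = b then 1 else 0) - if p = a then 1 else 0) := by
  rw [pd_cexp p (f := fun z => coord z b - coord z a)
    ((differentiable_coord b).sub (differentiable_coord a))]
  have h1 : (fun z : gz N → ℂ => coord z b - coord z a) =
      fun z => coord z b + (-1) * coord z a := by
    funext z; ring
  rw [h1, pd_add p (differentiable_coord b) ((differentiable_coord a).const_mul _), pd_const_mul,
    pd_coord hp, pd_coord hp]
  ring

/-- The function `f` is entire and does not depend on the variables at the vertices in `S`. -/
def NoDep (S : Set (ℕ × ℕ)) (f : Fn N) : Prop :=
  Differentiable ℂ f ∧ ∀ p ∈ S, ∀ z, pd p f z = 0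

theorem NoDep.mono {S T : Set (ℕ × ℕ)} {f : Fn N} (h : NoDep S f) (hT : T ⊆ S) : NoDep T f :=
  ⟨h.1, fun p hp => h.2 p (hT hp)⟩

theorem noDep_const (S : Set (ℕ × ℕ)) (c : ℂ) : NoDep S fun _ : gz N → ℂ => c :=
  ⟨differentiable_const c, fun p _ z => pd_const p c z⟩

theorem NoDep.mul {S : Set (ℕ × ℕ)} {f g : Fn N} (hf : NoDep S f) (hg : NoDep S g) :
    NoDep S fun z => f z * g z :=
  ⟨hf.1.mul hg.1, fun p hp z => by rw [pd_mul p hf.1 hg.1, hf.2 p hp, hg.2 p hp]; ring⟩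

theorem NoDep.add {S : Set (ℕ × ℕ)} {f g : Fn N} (hf : NoDep S f) (hg : NoDep S g) :
    NoDep S fun z => f z + g z :=
  ⟨hf.1.add hg.1, fun p hp z => by rw [pd_add p hf.1 hg.1, hf.2 p hp, hg.2 p hp, add_zero]⟩

theorem noDep_sum {α : Type*} {S : Set (ℕ × ℕ)} (A : Finset α) {f : α → Fn N}
    (hf : ∀ a ∈ A, NoDep S (f a)) : NoDep S fun z => ∑ a ∈ A, f a z :=
  ⟨Differentiable.fun_sum fun a ha => (hf a ha).1, fun p hp z => by
    rw [pd_sum p A fun a ha => (hf a ha).1]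
    exact Finset.sum_eq_zero fun a ha => (hf a ha).2 p hp z⟩

theorem noDep_coord {S : Set (ℕ × ℕ)} {q : ℕ × ℕ} (hq : q ∉ S) :
    NoDep S fun z : gz N → ℂ => coord z q :=
  ⟨differentiable_coord q, fun p hp z => by
    by_cases h : p ∈ gz N
    · rw [pd_coord h, if_neg]
      rintro rfl
      exact hq hp
    · exact pd_of_notMem h _ _⟩

theorem NoDep.neg {S : Set (ℕ × ℕ)} {f : Fn N} (hf : NoDep S f) : NoDep S fun z => -f z := by
  have := (noDep_const S (-1)).mul hf
  simpa using this

theorem NoDep.cexp {S : Set (ℕ × ℕ)} {f : Fn N} (hf : NoDep S f) :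
    NoDep S fun z => Complex.exp (f z) :=
  ⟨hf.1.cexp, fun p hp z => by rw [pd_cexp p hf.1, hf.2 p hp, mul_zero]⟩

theorem noDep_exp_sub {S : Set (ℕ × ℕ)} {b a : ℕ × ℕ} (hb : b ∉ S) (ha : a ∉ S) :
    NoDep S fun z : gz N → ℂ => Complex.exp (coord z b - coord z a) := by
  simpa only [sub_eq_add_neg] using ((noDep_coord hb).add (noDep_coord ha).neg).cexp

/-! ### Commutators of homogeneous operators -/

/-- Operators that commute with scalars. -/
def IsHomogeneous (A : Op N) : Prop := ∀ (c : ℂ) (f : Fn N), A (c • f) = c • A f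

theorem IsHomogeneous.map_zero {A : Op N} (hA : IsHomogeneous A) : A 0 = 0 := by
  have := hA 0 0
  simpa using this

theorem isHomogeneous_comm {A B : Op N} (hA : IsHomogeneous A) (hB : IsHomogeneous B) :
    IsHomogeneous (comm A B) := by
  intro c f
  funext z
  simp only [comm, hA c, hB c, Pi.smul_apply, smul_eq_mul]
  ring

theorem isHomogeneous_Eup (i : ℕ) : IsHomogeneous (Eup i : Op N) := by
  intro c f
  funext z
  simp only [Eup, pd_smul, Pi.smul_apply, smul_eq_mul, ← mul_sub, ← Finset.mul_sum]
  rw [mul_neg, Finset.mul_sum]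
  congr 1
  exact Finset.sum_congr rfl fun n _ => by ring

theorem isHomogeneous_Edown (lam : ℕ → ℝ) (i : ℕ) : IsHomogeneous (Edown lam i : Op N) := by
  intro c f
  funext z
  simp only [Edown, pd_smul, Pi.smul_apply, smul_eq_mul, ← mul_sub, ← Finset.mul_sum]
  rw [Finset.mul_sum]
  exact Finset.sum_congr rfl fun n _ => by ring

theorem isHomogeneous_Eupper (i d : ℕ) : IsHomogeneous (Eupper i d : Op N) := by
  induction d with
  | zero => exact isHomogeneous_Eup i
  | succ d ih => exact isHomogeneous_comm ih (isHomogeneous_Eup _)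

theorem isHomogeneous_Elower (lam : ℕ → ℝ) (j d : ℕ) : IsHomogeneous (Elower lam j d : Op N) := by
  induction d with
  | zero => exact isHomogeneous_Edown lam j
  | succ d ih => exact isHomogeneous_comm (isHomogeneous_Edown lam _) ih

theorem comm_eq_zero_of_eigen {A B : Op N} (hA : IsHomogeneous A) (hB : IsHomogeneous B)
    {f : Fn N} {a b : ℂ} (ha : A f = a • f) (hb : B f = b • f) : comm A B f = 0 := by
  funext z
  simp only [comm, ha, hb, hA b, hB a, Pi.smul_apply, smul_eq_mul, Pi.zero_apply]
  ring

/-- On a common eigenvector of the `E_{i,i+1}` the iterated commutators vanish. -/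
theorem Eupper_eigen {f : Fn N} {c : ℕ → ℂ} {i : ℕ} : ∀ {d : ℕ},
    (∀ k, i ≤ k → k ≤ i + d → Eup k f = c k • f) →
      Eupper i d f = (if d = 0 then c i else 0) • f := by
  intro d
  induction d with
  | zero => intro h; simpa [Eupper] using h i le_rfl le_rfl
  | succ d ih =>
    intro h
    rw [if_neg (Nat.succ_ne_zero d), zero_smul]
    exact comm_eq_zero_of_eigen (isHomogeneous_Eupper i d) (isHomogeneous_Eup _)
      (ih fun k h1 h2 => h k h1 (by omega)) (h (i + d + 1) (by omega) (by omega))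

/-- On a common eigenvector of the `E_{i+1,i}` the iterated commutators vanish. -/
theorem Elower_eigen {lam : ℕ → ℝ} {f : Fn N} {c : ℕ → ℂ} {i : ℕ} : ∀ {d : ℕ},
    (∀ k, i ≤ k → k ≤ i + d → Edown lam k f = c k • f) →
      Elower lam i d f = (if d = 0 then c i else 0) • f := by
  intro d
  induction d with
  | zero => intro h; simpa [Elower] using h i le_rfl le_rfl
  | succ d ih =>
    intro h
    rw [if_neg (Nat.succ_ne_zero d), zero_smul]
    exact comm_eq_zero_of_eigen (isHomogeneous_Edown lam _) (isHomogeneous_Elower lam i d)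
      (h (i + d + 1) (by omega) (by omega)) (ih fun k h1 h2 => h k h1 (by omega))

theorem sum_Icc_sub_pred (f : ℕ → ℂ) {a b : ℕ} (ha : 1 ≤ a) (h : a ≤ b + 1) :
    ∑ n ∈ Finset.Icc a b, (f n - f (n - 1)) = f b - f (a - 1) := by
  obtain ⟨a, rfl⟩ : ∃ a', a = a' + 1 := ⟨a - 1, by omega⟩
  have h' : a ≤ b := by omega
  induction b, h' using Nat.le_induction with
  | base => simp
  | succ b hb ih =>
    rw [Finset.sum_Icc_succ_top (by omega), ih (by omega)]
    simp

end Calculus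

/-! ### The left Whittaker vector -/

section Left
variable {N m : ℕ}

/-- The vertices at which the vertical arrows of the left Whittaker vector end. -/
def leftVerts (N m : ℕ) : Finset (ℕ × ℕ) := (gz N).filter fun p => p.1 + m + 2 ≤ N + p.2

theorem mem_leftVerts {p : ℕ × ℕ} : p ∈ leftVerts N m ↔
    (1 ≤ p.2 ∧ p.2 ≤ p.1 ∧ p.1 < N) ∧ p.1 + m + 2 ≤ N + p.2 := by
  rw [leftVerts, Finset.mem_filter, mem_gz]

theorem potential_add (A B : Multiset Arrow) (X : ℕ × ℕ → ℂ) :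
    potential (A + B) X = potential A X + potential B X := by
  simp [potential]

theorem potential_map {α : Type*} (S : Finset α) (g : α → Arrow) (X : ℕ × ℕ → ℂ) :
    potential (S.val.map g) X = ∑ p ∈ S, Complex.exp (X (g p).2 - X (g p).1) := by
  rw [potential, Multiset.map_map]
  rfl

theorem potential_singleton (a : Arrow) (X : ℕ × ℕ → ℂ) :
    potential {a} X = Complex.exp (X a.2 - X a.1) := by
  simp [potential]

theorem potential_leftArrows (hmN : m < N) (z : gz N → ℂ) :
    potential (leftArrows N m) (coord z) = Complex.exp (coord z (N - m, 1) - coord z (N, 1)) +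
      ∑ p ∈ leftVerts N m, Complex.exp (coord z p - coord z (p.1 + 1, p.2)) := by
  rw [leftArrows_eq, potential_add, potential_add, potential_singleton, rectVert, potential_map,
    potential_map, add_assoc]
  congr 1
  rw [← Finset.sum_filter_add_sum_filter_not (leftVerts N m) (fun p => ¬ m < p.2)]
  congr 1
  · refine Finset.sum_bij' (fun a _ => (a.2 + a.1 - 1, a.1)) (fun p _ => (p.2, p.1 + 1 - p.2))
      ?_ ?_ ?_ ?_ ?_
    · simp [mem_leftVerts]; omega
    · simp [mem_leftVerts]; omega
    · rintro ⟨k, i⟩ h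
      simp only [Finset.mem_product, Finset.mem_Icc] at h
      simp only [Prod.mk.injEq, true_and]
      omega
    · rintro ⟨n, k⟩ h
      simp only [Finset.mem_filter, mem_leftVerts] at h
      simp only [Prod.mk.injEq, and_true]
      omega
    · simp [vert]
  · refine Finset.sum_congr ?_ fun p _ => by simp [vert]
    ext p
    simp only [Finset.mem_filter, mem_leftVerts, mem_gz]
    omega

/-- The term of the arrow ending at `(n, k)` in the left Whittaker vector. -/
def leftTerm (N m : ℕ) (z : gz N → ℂ) (n k : ℕ) : ℂ :=
  if (n, k) ∈ leftVerts N m then Complex.exp (coord z (n, k) - coord z (n + 1, k)) else 0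

/-- The exponent of the left Whittaker vector. -/
def leftPhase (N m : ℕ) (hbar : ℝ) (lam : ℕ → ℝ) : Fn N := fun z =>
  ∑ p ∈ gz N, (-(mu N lam p.1 - mu N lam (p.1 + 1)) +
      if p.2 = 1 ∧ N - m + 1 ≤ p.1 then mu N lam p.1 else 0) * coord z p +
    (-(1 / (hbar : ℂ))) * (Complex.exp (coord z (N - m, 1) - coord z (N, 1)) +
      ∑ p ∈ leftVerts N m, Complex.exp (coord z p - coord z (p.1 + 1, p.2)))

theorem psiL_eq (hmN : m < N) (hbar : ℝ) (lam : ℕ → ℝ) : psiL N m hbar lam = fun z =>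
    1 / normC N (N - m + 1) hbar lam * Complex.exp (leftPhase N m hbar lam z) := by
  funext z
  rw [psiL, leftPhase, potential_leftArrows hmN]
  congr 2
  have h1 : ∑ p ∈ gz N, (-(mu N lam p.1 - mu N lam (p.1 + 1)) +
      if p.2 = 1 ∧ N - m + 1 ≤ p.1 then mu N lam p.1 else 0) * coord z p =
      -∑ n ∈ Finset.Icc 1 (N - 1), (mu N lam n - mu N lam (n + 1)) *
          ∑ i ∈ Finset.Icc 1 n, coord z (n, i)
      + ∑ k ∈ Finset.Icc 1 (m - 1), mu N lam (N - k) * coord z (N - k, 1) := by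
    simp_rw [add_mul, Finset.sum_add_distrib]
    congr 1
    · simp_rw [Finset.mul_sum]
      rw [Finset.sum_sigma', ← Finset.sum_neg_distrib]
      refine Finset.sum_bij' (fun p _ => ⟨p.1, p.2⟩) (fun a _ => (a.1, a.2)) ?_ ?_ ?_ ?_ ?_
      · simp [mem_gz]; omega
      · simp [mem_gz]; omega
      · simp
      · simp
      · intro p _
        simp only
        ring
    · simp_rw [ite_mul, zero_mul]
      rw [← Finset.sum_filter]
      symm
      refine Finset.sum_bij' (fun k _ => (N - k, 1)) (fun p _ => N - p.1) ?_ ?_ ?_ ?_ ?_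
      · simp [mem_gz]; omega
      · simp [mem_gz]; omega
      · simp; omega
      · rintro ⟨n, k⟩ h
        simp only [Finset.mem_filter, mem_gz] at h
        simp only [Prod.mk.injEq]
        omega
      · simp
  rw [h1]
  ring

theorem differentiable_exp_sub (b a : ℕ × ℕ) :
    Differentiable ℂ fun z : gz N → ℂ => Complex.exp (coord z b - coord z a) :=
  ((differentiable_coord b).sub (differentiable_coord a)).cexp

theorem differentiable_leftPhase (hbar : ℝ) (lam : ℕ → ℝ) :
    Differentiable ℂ (leftPhase N m hbar lam) :=
  (Differentiable.fun_sum fun p _ => (differentiable_coord p).const_mul _).add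
    (((differentiable_exp_sub _ _).add
      (Differentiable.fun_sum fun _ _ => differentiable_exp_sub _ _)).const_mul _)

theorem pd_leftPhase (hbar : ℝ) (lam : ℕ → ℝ) {n k : ℕ} (hp : (n, k) ∈ gz N)
    (z : gz N → ℂ) : pd (n, k) (leftPhase N m hbar lam) z =
      -(mu N lam n - mu N lam (n + 1)) +
      (if k = 1 ∧ N - m + 1 ≤ n then mu N lam n else 0) - 1 / (hbar : ℂ) *
        (leftTerm N m z n k - leftTerm N m z (n - 1) k +
          if n = N - m ∧ k = 1 then Complex.exp (coord z (N - m, 1)) else 0) := by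
  have hp' := mem_gz.1 hp
  simp only at hp'
  have h0 : coord z (N, 1) = 0 := dif_neg (by simp [mem_gz])
  have h1 : ((n, k) : ℕ × ℕ) ≠ (N, 1) := by simp; omega
  unfold leftPhase
  have d1 : Differentiable ℂ fun z : gz N → ℂ => ∑ p ∈ gz N,
      (-(mu N lam p.1 - mu N lam (p.1 + 1)) +
        if p.2 = 1 ∧ N - m + 1 ≤ p.1 then mu N lam p.1 else 0) * coord z p :=
    Differentiable.fun_sum fun p _ => (differentiable_coord p).const_mul _
  have d2 : Differentiable ℂ fun z : gz N → ℂ =>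
      ∑ p ∈ leftVerts N m, Complex.exp (coord z p - coord z (p.1 + 1, p.2)) :=
    Differentiable.fun_sum fun p _ => differentiable_exp_sub p (p.1 + 1, p.2)
  rw [pd_add _ d1 (((differentiable_exp_sub (N - m, 1) (N, 1)).fun_add d2).const_mul _),
    pd_const_mul, pd_add _ (differentiable_exp_sub (N - m, 1) (N, 1)) d2,
    pd_sum _ _ fun p _ => (differentiable_coord p).const_mul _,
    pd_sum _ _ fun p _ => differentiable_exp_sub p (p.1 + 1, p.2), pd_exp_sub hp, h0, if_neg h1]
  simp_rw [pd_const_mul, pd_coord hp, pd_exp_sub hp, mul_sub, Finset.sum_sub_distrib]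
  have h2 : ∑ q ∈ leftVerts N m, Complex.exp (coord z q - coord z (q.1 + 1, q.2)) *
      (if (n, k) = q then 1 else 0) = leftTerm N m z n k := by
    simp_rw [mul_ite, mul_one, mul_zero]
    rw [Finset.sum_ite_eq, leftTerm]
  have h3 : ∑ q ∈ leftVerts N m, Complex.exp (coord z q - coord z (q.1 + 1, q.2)) *
      (if (n, k) = (q.1 + 1, q.2) then 1 else 0) = leftTerm N m z (n - 1) k := by
    have h4 : ∀ q : ℕ × ℕ, ((n, k) = (q.1 + 1, q.2)) ↔ (n - 1, k) = q := by
      rintro ⟨a, b⟩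
      simp only [Prod.mk.injEq]
      omega
    simp_rw [h4, mul_ite, mul_one, mul_zero]
    rw [Finset.sum_ite_eq, leftTerm]
  rw [h2, h3]
  simp only [mul_ite, mul_one, mul_zero, Finset.sum_ite_eq, hp, if_true, Prod.mk.injEq, sub_zero]
  ring

theorem pd_psiL (hmN : m < N) (hbar : ℝ) (lam : ℕ → ℝ) (p : ℕ × ℕ) (z : gz N → ℂ) :
    pd p (psiL N m hbar lam) z = psiL N m hbar lam z * pd p (leftPhase N m hbar lam) z := by
  rw [psiL_eq hmN, pd_const_mul, pd_cexp p (differentiable_leftPhase hbar lam)]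
  ring

/-- The contribution of the boundary terms to the sums over the first column. -/
def leftExtra (N m : ℕ) (hbar : ℝ) (lam : ℕ → ℝ) (z : gz N → ℂ) (R i : ℕ) : ℂ :=
  if i = 1 then ∑ r ∈ Finset.Icc (N - m + 1) R, mu N lam r -
    1 / (hbar : ℂ) * (if N - m ≤ R then Complex.exp (coord z (N - m, 1)) else 0) else 0

theorem leftTerm_eq_zero {z : gz N → ℂ} {n k : ℕ} (h : n < k) : leftTerm N m z n k = 0 :=
  if_neg (by rw [mem_leftVerts]; simp only; omega)

theorem sum_pd_leftPhase (hmN : m < N) (hbar : ℝ) (lam : ℕ → ℝ) (z : gz N → ℂ) {i R : ℕ}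
    (hi : 1 ≤ i) (hR : i ≤ R + 1) (hRN : R < N) :
    ∑ r ∈ Finset.Icc i R, pd (r, i) (leftPhase N m hbar lam) z =
      -(mu N lam i - mu N lam (R + 1)) - 1 / (hbar : ℂ) * leftTerm N m z R i +
        leftExtra N m hbar lam z R i := by
  obtain ⟨j, rfl⟩ : ∃ j, i = j + 1 := ⟨i - 1, by omega⟩
  have h' : j ≤ R := by omega
  induction R, h' using Nat.le_induction with
  | base =>
    rw [Finset.Icc_eq_empty (by omega), Finset.sum_empty, leftTerm_eq_zero (by omega), leftExtra]
    split_ifs with h1 h2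
    · omega
    · rw [Finset.Icc_eq_empty (by omega), Finset.sum_empty]; ring
    · ring
  | succ R hjR ih =>
    rw [Finset.sum_Icc_succ_top (by omega), ih (by omega) (by omega),
      pd_leftPhase hbar lam (by rw [mem_gz]; simp only; omega)]
    simp only [leftExtra, Nat.add_sub_cancel]
    by_cases h1 : j + 1 = 1
    · simp only [h1, if_true, true_and, and_true]
      by_cases h2 : N - m + 1 ≤ R + 1
      · rw [Finset.sum_Icc_succ_top h2]
        have h3 : N - m ≤ R := by omega
        have h4 : N - m ≤ R + 1 := by omega
        have h5 : R + 1 ≠ N - m := by omega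
        simp only [h2, h3, h4, h5, if_true, if_false]
        ring
      · rw [Finset.Icc_eq_empty (by omega), Finset.Icc_eq_empty (by omega)]
        have h3 : ¬ N - m ≤ R := by omega
        by_cases h4 : N - m ≤ R + 1
        · have h5 : R + 1 = N - m := by omega
          have h6 : ¬ N ≤ R + m := by omega
          simp only [h5, if_true, le_refl]
          simp [h6]
          ring
        · have h5 : R + 1 ≠ N - m := by omega
          simp only [h2, h3, h4, h5, if_false]
          ring
    · simp only [h1, if_false, false_and, and_false]
      ring

theorem Edown_eq (lam : ℕ → ℝ) {i : ℕ} (hi : 1 ≤ i) (hiN : i < N) (f : Fn N) (z : gz N → ℂ) :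
    Edown lam i f z = ∑ R ∈ Finset.Icc i (N - 1),
      Complex.exp (coord z (R + 1, i + 1) - coord z (R, i)) *
        ((mu N lam i - mu N lam (i + 1)) * f z + (∑ r ∈ Finset.Icc i R, pd (r, i) f z -
          ∑ r ∈ Finset.Icc (i + 1) R, pd (r, i + 1) f z)) := by
  rw [Edown]
  refine Finset.sum_bij' (fun n _ => n + i - 1) (fun R _ => R + 1 - i) ?_ ?_ ?_ ?_ ?_
  · simp; omega
  · simp; omega
  · simp; omega
  · simp; omega
  · intro n hn
    have hn' := Finset.mem_Icc.1 hn
    have h1 : n + i - 1 + 1 = n + i := by omega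
    have h2 : ∑ r ∈ Finset.Icc (i + 1) (n + i - 1), pd (r, i + 1) f z =
        ∑ r ∈ Finset.Icc i (n + i - 1), pd (r, i + 1) f z := by
      refine Finset.sum_subset (Finset.Icc_subset_Icc_left (by omega)) fun r h3 h4 => ?_
      refine pd_of_notMem ?_ f z
      simp only [Finset.mem_Icc] at h3 h4
      rw [mem_gz]
      simp only
      omega
    rw [h1, h2, ← Finset.sum_sub_distrib]
    congr 2
    refine Finset.sum_bij' (fun k _ => i + k - 1) (fun r _ => r + 1 - i) ?_ ?_ ?_ ?_ ?_ <;>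
      simp <;> omega

theorem Edown_psiL (hmN : m < N) (hbar : ℝ) (lam : ℕ → ℝ) {i : ℕ} (hi : 1 ≤ i)
    (hiN : i < N) (z : gz N → ℂ) : Edown lam i (psiL N m hbar lam) z =
      (∑ R ∈ Finset.Icc i (N - 1), Complex.exp (coord z (R + 1, i + 1) - coord z (R, i)) *
        leftExtra N m hbar lam z R i + if m < i then -(hbar : ℂ)⁻¹ else 0) *
        psiL N m hbar lam z := by
  rw [Edown_eq lam hi hiN]
  set T : ℕ → ℂ := fun R => if i < R ∧ R + m < N + i then
    Complex.exp (coord z (R, i + 1) - coord z (R, i)) else 0 with hT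
  have h1 : ∀ R ∈ Finset.Icc i (N - 1), Complex.exp (coord z (R + 1, i + 1) - coord z (R, i)) *
        ((mu N lam i - mu N lam (i + 1)) * psiL N m hbar lam z +
          (∑ r ∈ Finset.Icc i R, pd (r, i) (psiL N m hbar lam) z -
          ∑ r ∈ Finset.Icc (i + 1) R, pd (r, i + 1) (psiL N m hbar lam) z)) =
      (Complex.exp (coord z (R + 1, i + 1) - coord z (R, i)) * leftExtra N m hbar lam z R i -
        (hbar : ℂ)⁻¹ * (T (R + 1) - T R)) * psiL N m hbar lam z := by
    intro R hR
    have hR' := Finset.mem_Icc.1 hR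
    simp_rw [pd_psiL hmN, ← Finset.mul_sum]
    rw [sum_pd_leftPhase hmN hbar lam z hi (by omega) (by omega),
      sum_pd_leftPhase hmN hbar lam z (by omega) (by omega) (by omega)]
    have h2 : leftExtra N m hbar lam z R (i + 1) = 0 := if_neg (by omega)
    have h3 : Complex.exp (coord z (R + 1, i + 1) - coord z (R, i)) * leftTerm N m z R i =
        T (R + 1) := by
      simp only [leftTerm, hT, mem_leftVerts, mul_ite, mul_zero, ← Complex.exp_add]
      refine if_congr (by omega) ?_ rfl
      congr 1
      ring
    have h4 : Complex.exp (coord z (R + 1, i + 1) - coord z (R, i)) * leftTerm N m z R (i + 1) =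
        T R := by
      simp only [leftTerm, hT, mem_leftVerts, mul_ite, mul_zero, ← Complex.exp_add]
      refine if_congr (by omega) ?_ rfl
      congr 1
      ring
    rw [h2, ← h3, ← h4]
    ring
  rw [Finset.sum_congr rfl h1, ← Finset.sum_mul, Finset.sum_sub_distrib, ← Finset.mul_sum]
  have h5 : ∑ R ∈ Finset.Icc i (N - 1), (T (R + 1) - T R) = T N := by
    have := sum_Icc_sub_pred (fun R => T (R + 1)) hi (b := N - 1) (by omega)
    have h6 : T i = 0 := by simp [hT]
    simp only [show N - 1 + 1 = N by omega, show i - 1 + 1 = i by omega, h6, sub_zero] at this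
    rw [← this]
    refine Finset.sum_congr rfl fun R hR => ?_
    have hR' := Finset.mem_Icc.1 hR
    rw [show R - 1 + 1 = R by omega]
  have h7 : T N = if m < i then 1 else 0 := by
    have e : ∀ k, coord z (N, k) = 0 := fun k => dif_neg (by simp [mem_gz])
    simp only [hT, e, sub_zero, Complex.exp_zero]
    exact if_congr (by omega) rfl rfl
  rw [h5, h7]
  split_ifs <;> ring

theorem Edown_psiL_of_two_le (hmN : m < N) (hbar : ℝ) (lam : ℕ → ℝ) {i : ℕ} (hi : 2 ≤ i)
    (hiN : i < N) : Edown lam i (psiL N m hbar lam) =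
      (if m < i then -(hbar : ℂ)⁻¹ else 0) • psiL N m hbar lam := by
  funext z
  rw [Edown_psiL hmN hbar lam (by omega) hiN, Finset.sum_eq_zero, zero_add, Pi.smul_apply,
    smul_eq_mul]
  intro R _
  rw [leftExtra, if_neg (by omega), mul_zero]

theorem Ediag_psiL (hmN : m < N) (hbar : ℝ) (lam : ℕ → ℝ) {i : ℕ} (hi : 2 ≤ i) (him : i ≤ m)
    (z : gz N → ℂ) : Ediag lam i (psiL N m hbar lam) z = 0 := by
  rw [Ediag]
  simp_rw [pd_psiL hmN, ← Finset.mul_sum]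
  have h1 := sum_pd_leftPhase hmN hbar lam z (i := i) (R := N - 1) (by omega) (by omega) (by omega)
  have h2 : leftTerm N m z (N - 1) i = 0 := if_neg (by rw [mem_leftVerts]; simp only; omega)
  have h3 : leftExtra N m hbar lam z (N - 1) i = 0 := if_neg (by omega)
  have h4 : ∑ k ∈ Finset.Icc 1 (i - 1), pd (N + k - i, k) (leftPhase N m hbar lam) z =
      mu N lam N := by
    have h5 : ∀ k ∈ Finset.Icc 1 (i - 1), pd (N + k - i, k) (leftPhase N m hbar lam) z =
        (mu N lam (N + k + 1 - i) - mu N lam (N + (k - 1) + 1 - i)) +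
          if k = 1 then mu N lam (N + 1 - i) else 0 := by
      intro k hk
      have hk' := Finset.mem_Icc.1 hk
      rw [pd_leftPhase hbar lam (by rw [mem_gz]; simp only; omega)]
      have e1 : leftTerm N m z (N + k - i) k = 0 := if_neg (by rw [mem_leftVerts]; simp only; omega)
      have e2 : leftTerm N m z (N + k - i - 1) k = 0 :=
        if_neg (by rw [mem_leftVerts]; simp only; omega)
      have e3 : ¬ (N + k - i = N - m ∧ k = 1) := by omega
      rw [e1, e2, if_neg e3, show N + k - i + 1 = N + k + 1 - i by omega,
        show N + (k - 1) + 1 - i = N + k - i by omega]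
      by_cases h6 : k = 1
      · subst h6
        rw [if_pos ⟨rfl, by omega⟩, if_pos rfl]
        ring
      · rw [if_neg fun h => h6 h.1, if_neg h6]
        ring
    rw [Finset.sum_congr rfl h5, Finset.sum_add_distrib,
      sum_Icc_sub_pred (fun k => mu N lam (N + k + 1 - i)) le_rfl (by omega), Finset.sum_ite_eq',
      if_pos (by simp; omega)]
    rw [show N + (i - 1) + 1 - i = N by omega, show N + (1 - 1) + 1 - i = N + 1 - i by omega]
    ring
  rw [h1, h2, h3, h4, show N - 1 + 1 = N by omega]
  ring

end Left

/-! ### The equations of the left Whittaker vector -/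

section LeftEquations
variable {N m : ℕ}

theorem Edown_mul (lam : ℕ → ℝ) {i : ℕ} (hi : 1 ≤ i) (hiN : i < N) {g f : Fn N}
    (hg : Differentiable ℂ g) (hf : Differentiable ℂ f) (z : gz N → ℂ) :
    Edown lam i (fun z => g z * f z) z = g z * Edown lam i f z +
      (∑ R ∈ Finset.Icc i (N - 1), Complex.exp (coord z (R + 1, i + 1) - coord z (R, i)) *
        (∑ r ∈ Finset.Icc i R, pd (r, i) g z - ∑ r ∈ Finset.Icc (i + 1) R, pd (r, i + 1) g z)) *
        f z := by
  rw [Edown_eq lam hi hiN, Edown_eq lam hi hiN, Finset.mul_sum, Finset.sum_mul,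
    ← Finset.sum_add_distrib]
  refine Finset.sum_congr rfl fun R _ => ?_
  simp_rw [pd_mul _ hg hf, Finset.sum_add_distrib, ← Finset.mul_sum]
  ring

theorem coord_top (z : gz N → ℂ) (k : ℕ) : coord z (N, k) = 0 := dif_neg (by simp [mem_gz])

/-- The vertices in the columns to the right of the `j`-th one. -/
def colsAfter (j : ℕ) : Set (ℕ × ℕ) := {p | j < p.2}

theorem sum_pd_chain {d b c : ℕ} {W : ℕ → Fn N} (hW : ∀ n, NoDep (colsAfter d) (W n))
    (hcd : d < c) (z : gz N → ℂ) {a R : ℕ} (ha : c ≤ a) (hab : c = d + 1 → a ≤ b + 1) (hR : R < N) :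
    ∑ r ∈ Finset.Icc a R, pd (r, c) (fun z : gz N → ℂ =>
      ∑ n ∈ Finset.Icc b (N - 1), Complex.exp (coord z (n + 1, d + 1)) * W n z) z =
    if c = d + 1 then ∑ r ∈ Finset.Icc (b + 1) R, Complex.exp (coord z (r, d + 1)) * W (r - 1) z
    else 0 := by
  have h1 : ∀ r ∈ Finset.Icc a R, pd (r, c) (fun z : gz N → ℂ =>
      ∑ n ∈ Finset.Icc b (N - 1), Complex.exp (coord z (n + 1, d + 1)) * W n z) z =
      if c = d + 1 ∧ b + 1 ≤ r then Complex.exp (coord z (r, d + 1)) * W (r - 1) z else 0 := by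
    intro r hr
    have hr' := Finset.mem_Icc.1 hr
    have hp : (r, c) ∈ gz N := by rw [mem_gz]; simp only; omega
    have h2 : ∀ n, pd (r, c) (fun z : gz N → ℂ => Complex.exp (coord z (n + 1, d + 1)) * W n z) z =
        if c = d + 1 ∧ r = n + 1 then Complex.exp (coord z (r, d + 1)) * W (r - 1) z else 0 := by
      intro n
      rw [pd_mul _ (differentiable_coord _).cexp (hW n).1, (hW n).2 _ hcd,
        pd_cexp _ (differentiable_coord _), pd_coord hp]
      simp only [Prod.mk.injEq, mul_zero, zero_add, mul_ite, mul_one]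
      by_cases h3 : c = d + 1 ∧ r = n + 1
      · rw [if_pos ⟨h3.2, h3.1⟩, if_pos h3, h3.2, Nat.add_sub_cancel]
        ring
      · rw [if_neg fun h => h3 ⟨h.2, h.1⟩, if_neg h3]
    rw [pd_sum _ _ fun n _ => (differentiable_coord (n + 1, d + 1)).cexp.fun_mul (hW n).1]
    simp_rw [h2]
    by_cases h3 : c = d + 1 ∧ b + 1 ≤ r
    · rw [if_pos h3, Finset.sum_eq_single (r - 1)]
      · rw [if_pos ⟨h3.1, by omega⟩]
      · intro n _ hn
        rw [if_neg]
        omega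
      · intro h
        exact absurd (Finset.mem_Icc.2 ⟨by omega, by omega⟩) h
    · rw [if_neg h3]
      refine Finset.sum_eq_zero fun n hn => if_neg ?_
      have := Finset.mem_Icc.1 hn
      omega
  rw [Finset.sum_congr rfl h1]
  split_ifs with h2
  · simp only [h2, true_and]
    rw [← Finset.sum_filter]
    refine Finset.sum_congr ?_ fun _ _ => rfl
    ext r
    simp only [Finset.mem_filter, Finset.mem_Icc]
    omega
  · simp [h2]

/-- The commutators leading to `E_{m+1,1}`, on the left Whittaker vector. -/
theorem Elower_chain (hm : 1 ≤ m) (hmN : m < N) (hbar : ℝ) (lam : ℕ → ℝ) : ∀ d, d < m →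
    ∃ W : ℕ → Fn N, (∀ n, NoDep (colsAfter (d + 1)) (W n)) ∧
      (∀ z, W (N - m + d) z = -(hbar : ℂ)⁻¹) ∧
      Elower lam 1 d (psiL N m hbar lam) = fun z =>
        (∑ n ∈ Finset.Icc (N - m + d) (N - 1), Complex.exp (coord z (n + 1, d + 2)) * W n z) *
          psiL N m hbar lam z := by
  intro d
  induction d with
  | zero =>
    intro _
    refine ⟨fun R z => Complex.exp (-coord z (R, 1)) *
      (∑ r ∈ Finset.Icc (N - m + 1) R, mu N lam r +
        -(hbar : ℂ)⁻¹ * Complex.exp (coord z (N - m, 1))), fun n => ?_, fun z => ?_, ?_⟩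
    · have h1 : ∀ r, (r, 1) ∉ colsAfter (0 + 1) := fun r => by simp [colsAfter]
      exact (noDep_coord (h1 n)).neg.cexp.mul ((noDep_const _ _).add
        ((noDep_const _ _).mul (noDep_coord (h1 _)).cexp))
    · simp only [add_zero]
      rw [Finset.Icc_eq_empty (by omega), Finset.sum_empty, zero_add, mul_left_comm,
        ← Complex.exp_add]
      simp
    · funext z
      rw [Elower, Edown_psiL hmN hbar lam le_rfl (by omega), if_neg (by omega), add_zero]
      congr 1
      symm
      refine (Finset.sum_congr rfl fun R hR => ?_).trans
        (Finset.sum_subset (Finset.Icc_subset_Icc_left (by omega)) ?_)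
      · have hR' := Finset.mem_Icc.1 hR
        rw [leftExtra, if_pos rfl, if_pos (by omega), ← mul_assoc, ← Complex.exp_add]
        ring_nf
      · intro R h2 h3
        simp only [Finset.mem_Icc] at h2 h3
        rw [leftExtra, if_pos rfl, if_neg (by omega), Finset.Icc_eq_empty (by omega)]
        simp
  | succ d ih =>
    intro hd
    obtain ⟨W, hW1, hW2, hW3⟩ := ih (by omega)
    refine ⟨fun R z => ∑ r ∈ Finset.Icc (N - m + d + 1) R,
      Complex.exp (coord z (r, d + 2) - coord z (R, d + 2)) * W (r - 1) z,
      fun n => ?_, fun z => ?_, ?_⟩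
    · refine noDep_sum _ fun r _ => (noDep_exp_sub ?_ ?_).mul
        ((hW1 _).mono fun p hp => lt_trans (Nat.lt_succ_self (d + 1)) hp) <;> simp [colsAfter]
    · simp only
      rw [show N - m + (d + 1) = N - m + d + 1 by omega, Finset.Icc_self, Finset.sum_singleton,
        sub_self, Complex.exp_zero, one_mul, Nat.add_sub_cancel, hW2]
    · have h1 : Edown lam (1 + d + 1) (psiL N m hbar lam) = 0 := by
        rw [Edown_psiL_of_two_le hmN hbar lam (by omega) (by omega), if_neg (by omega), zero_smul]
      funext z
      rw [Elower, comm, h1, (isHomogeneous_Elower lam 1 d).map_zero, hW3,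
        Edown_mul lam (by omega) (by omega) (Differentiable.fun_sum fun n _ =>
          (differentiable_coord (n + 1, d + 2)).cexp.fun_mul (hW1 n).1)
          ((contDiff_psiL hbar lam (n := 1)).differentiable (by simp)), h1]
      simp only [Pi.zero_apply, mul_zero, zero_add, sub_zero]
      congr 1
      symm
      refine (Finset.sum_subset (Finset.Icc_subset_Icc_left (by omega)) ?_).trans
        (Finset.sum_congr rfl fun R hR => ?_)
      · intro R h2 h3
        simp only [Finset.mem_Icc] at h2 h3
        rw [Finset.Icc_eq_empty (by omega), Finset.sum_empty, mul_zero]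
      · have hR' := Finset.mem_Icc.1 hR
        rw [sum_pd_chain (d := d + 1) (b := N - m + d) hW1 (by omega) z (by omega)
          (by omega) (by omega), sum_pd_chain (d := d + 1) (b := N - m + d) hW1
          (by omega) z (by omega) (by omega) (by omega), if_pos (by omega), if_neg (by omega),
          sub_zero, Finset.mul_sum, Finset.mul_sum]
        refine Finset.sum_congr rfl fun r _ => ?_
        rw [← mul_assoc, ← mul_assoc, ← Complex.exp_add, ← Complex.exp_add]
        rw [show 1 + d + 1 + 1 = d + 1 + 2 by omega, show 1 + d + 1 = d + 2 by omega]
        congr 2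
        ring

theorem isLeftWhittaker_psiL (hm : 1 ≤ m) (hmN : m < N) {hbar : ℝ} (hh : 0 < hbar) {lam : ℕ → ℝ}
    (hlam : ∀ j : ℕ, N + 3 ≤ 2 * j → j ≤ N → lam j ≠ 0) :
    IsLeftWhittaker m hbar lam (psiL N m hbar lam) where
  entire := (contDiff_psiL hbar lam (n := 1)).differentiable (by simp)
  ne_zero := by
    intro h
    have h1 := congrFun h 0
    rw [psiL_eq hmN] at h1
    simp [normC_ne_zero hh hlam] at h1
  corner := by
    intro z
    obtain ⟨W, -, h2, h3⟩ := Elower_chain hm hmN hbar lam (m - 1) (by omega)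
    rw [E, if_neg (by omega), if_neg (by omega), show m + 1 - 1 - 1 = m - 1 by omega, h3]
    simp only
    rw [show N - m + (m - 1) = N - 1 by omega, Finset.Icc_self, Finset.sum_singleton,
      show N - 1 + 1 = N by omega, coord_top, Complex.exp_zero, one_mul]
    rw [show N - m + (m - 1) = N - 1 by omega] at h2
    rw [h2]
  annihilated := by
    intro i hi k hk z
    have hi' := Finset.mem_Icc.1 hi
    have hk' := Finset.mem_Icc.1 hk
    rw [E]
    split_ifs with h1 h2
    · rw [h1]
      exact Ediag_psiL hmN hbar lam hi'.1 hi'.2 z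
    · omega
    · rw [Elower_eigen (c := fun i => if m < i then -(hbar : ℂ)⁻¹ else 0)
        fun k h3 h4 => Edown_psiL_of_two_le hmN hbar lam (by omega) (by omega)]
      rw [if_neg (by omega : ¬ m < i), ite_self, zero_smul, Pi.zero_apply]
  simple := by
    intro j hj z
    have hj' := Finset.mem_Icc.1 hj
    rw [E, if_neg (by omega), if_neg (by omega), show j + 1 - j - 1 = 0 by omega, Elower,
      Edown_psiL_of_two_le hmN hbar lam (by omega) (by omega), if_pos (by omega), Pi.smul_apply,
      smul_eq_mul]

end LeftEquations

/-! ### The right Whittaker vector -/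

section Right
variable {N m : ℕ}

/-- The vertices at which the horizontal arrows of the right Whittaker vector start. -/
def rightVerts (N m : ℕ) : Finset (ℕ × ℕ) := (gz N).filter fun p => p.2 < m

theorem mem_rightVerts {p : ℕ × ℕ} : p ∈ rightVerts N m ↔
    (1 ≤ p.2 ∧ p.2 ≤ p.1 ∧ p.1 < N) ∧ p.2 < m := by
  rw [rightVerts, Finset.mem_filter, mem_gz]

theorem potential_rightArrows (hmN : m < N) (z : gz N → ℂ) :
    potential (rightArrows N m) (coord z) = Complex.exp (coord z (N, N) - coord z (m, m)) +
      ∑ p ∈ rightVerts N m, Complex.exp (coord z (p.1 + 1, p.2 + 1) - coord z p) := by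
  rw [rightArrows_eq N m hmN, potential_add, potential_add, potential_singleton, rectHoriz,
    potential_map, potential_map, add_assoc]
  congr 1
  rw [← Finset.sum_filter_add_sum_filter_not (rightVerts N m) (fun p => ¬ N + p.2 ≤ p.1 + m)]
  congr 1
  · refine Finset.sum_bij' (fun a _ => (a.1 + a.2 - 1, a.2)) (fun p _ => (p.1 + 1 - p.2, p.2))
      ?_ ?_ ?_ ?_ ?_
    · simp [mem_rightVerts]; omega
    · simp [mem_rightVerts]; omega
    · rintro ⟨k, i⟩ h
      simp only [Finset.mem_product, Finset.mem_Icc] at h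
      simp only [Prod.mk.injEq, and_true]
      omega
    · rintro ⟨n, k⟩ h
      simp only [Finset.mem_filter, mem_rightVerts] at h
      simp only [Prod.mk.injEq, and_true]
      omega
    · simp [horiz]
  · refine Finset.sum_congr ?_ fun p _ => by simp [horiz]
    ext p
    simp only [Finset.mem_filter, mem_rightVerts, mem_gz]
    omega

/-- The term of the arrow starting at `(n, k)` in the right Whittaker vector. -/
def rightTerm (N m : ℕ) (z : gz N → ℂ) (n k : ℕ) : ℂ :=
  if (n, k) ∈ rightVerts N m then Complex.exp (coord z (n + 1, k + 1) - coord z (n, k)) else 0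

/-- The exponent of the right Whittaker vector. -/
def rightPhase (N m : ℕ) (hbar : ℝ) (lam : ℕ → ℝ) : Fn N := fun z =>
  ∑ p ∈ gz N, (if p.1 = p.2 ∧ m < p.1 then -mu N lam p.1 else 0) * coord z p +
    (-(1 / (hbar : ℂ))) * (Complex.exp (coord z (N, N) - coord z (m, m)) +
      ∑ p ∈ rightVerts N m, Complex.exp (coord z (p.1 + 1, p.2 + 1) - coord z p))

theorem psiR_eq (hmN : m < N) (hbar : ℝ) (lam : ℕ → ℝ) : psiR N m hbar lam = fun z =>
    1 / normC N (m + 1) hbar lam * Complex.exp (rightPhase N m hbar lam z) := by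
  funext z
  rw [psiR, rightPhase, potential_rightArrows hmN]
  congr 2
  have h1 : ∑ p ∈ gz N, (if p.1 = p.2 ∧ m < p.1 then -mu N lam p.1 else 0) * coord z p =
      -∑ k ∈ Finset.Icc (m + 1) (N - 1), mu N lam k * coord z (k, k) := by
    simp_rw [ite_mul, zero_mul]
    rw [← Finset.sum_filter, ← Finset.sum_neg_distrib]
    symm
    refine Finset.sum_bij' (fun k _ => (k, k)) (fun p _ => p.1) ?_ ?_ ?_ ?_ ?_
    · simp [mem_gz]; omega
    · simp [mem_gz]; omega
    · simp
    · rintro ⟨n, k⟩ h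
      simp only [Finset.mem_filter, mem_gz] at h
      simp only [Prod.mk.injEq, true_and]
      exact h.2.1
    · simp
  rw [h1]
  ring

theorem differentiable_rightPhase (hbar : ℝ) (lam : ℕ → ℝ) :
    Differentiable ℂ (rightPhase N m hbar lam) :=
  (Differentiable.fun_sum fun p _ => (differentiable_coord p).const_mul _).add
    (((differentiable_exp_sub _ _).add
      (Differentiable.fun_sum fun _ _ => differentiable_exp_sub _ _)).const_mul _)

theorem pd_rightPhase (hbar : ℝ) (lam : ℕ → ℝ) {n k : ℕ} (hp : (n, k) ∈ gz N)
    (z : gz N → ℂ) : pd (n, k) (rightPhase N m hbar lam) z =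
      (if n = k ∧ m < n then -mu N lam n else 0) - 1 / (hbar : ℂ) *
        (rightTerm N m z (n - 1) (k - 1) - rightTerm N m z n k -
          if n = m ∧ k = m then Complex.exp (-coord z (m, m)) else 0) := by
  have hp' := mem_gz.1 hp
  simp only at hp'
  have h0 : coord z (N, N) = 0 := coord_top z N
  have h1 : ((n, k) : ℕ × ℕ) ≠ (N, N) := by simp; omega
  unfold rightPhase
  have d1 : Differentiable ℂ fun z : gz N → ℂ => ∑ p ∈ gz N,
      (if p.1 = p.2 ∧ m < p.1 then -mu N lam p.1 else 0) * coord z p :=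
    Differentiable.fun_sum fun p _ => (differentiable_coord p).const_mul _
  have d2 : Differentiable ℂ fun z : gz N → ℂ =>
      ∑ p ∈ rightVerts N m, Complex.exp (coord z (p.1 + 1, p.2 + 1) - coord z p) :=
    Differentiable.fun_sum fun p _ => differentiable_exp_sub (p.1 + 1, p.2 + 1) p
  rw [pd_add _ d1 (((differentiable_exp_sub (N, N) (m, m)).fun_add d2).const_mul _),
    pd_const_mul, pd_add _ (differentiable_exp_sub (N, N) (m, m)) d2,
    pd_sum _ _ fun p _ => (differentiable_coord p).const_mul _,
    pd_sum _ _ fun p _ => differentiable_exp_sub (p.1 + 1, p.2 + 1) p, pd_exp_sub hp, h0,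
    if_neg h1]
  simp_rw [pd_const_mul, pd_coord hp, pd_exp_sub hp, mul_sub, Finset.sum_sub_distrib]
  have h2 : ∑ q ∈ rightVerts N m, Complex.exp (coord z (q.1 + 1, q.2 + 1) - coord z q) *
      (if (n, k) = q then 1 else 0) = rightTerm N m z n k := by
    simp_rw [mul_ite, mul_one, mul_zero]
    rw [Finset.sum_ite_eq, rightTerm]
  have h3 : ∑ q ∈ rightVerts N m, Complex.exp (coord z (q.1 + 1, q.2 + 1) - coord z q) *
      (if (n, k) = (q.1 + 1, q.2 + 1) then 1 else 0) = rightTerm N m z (n - 1) (k - 1) := by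
    have h4 : ∀ q : ℕ × ℕ, ((n, k) = (q.1 + 1, q.2 + 1)) ↔ (n - 1, k - 1) = q := by
      rintro ⟨a, b⟩
      simp only [Prod.mk.injEq]
      omega
    simp_rw [h4, mul_ite, mul_one, mul_zero]
    rw [Finset.sum_ite_eq, rightTerm]
  rw [h2, h3]
  simp only [mul_ite, mul_one, mul_zero, Finset.sum_ite_eq, hp, if_true, Prod.mk.injEq, zero_sub]
  by_cases h5 : n = m ∧ k = m
  · simp only [h5, and_self, if_true]
    ring
  · simp only [h5, if_false]
    ring

theorem pd_psiR (hmN : m < N) (hbar : ℝ) (lam : ℕ → ℝ) (p : ℕ × ℕ) (z : gz N → ℂ) :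
    pd p (psiR N m hbar lam) z = psiR N m hbar lam z * pd p (rightPhase N m hbar lam) z := by
  rw [psiR_eq hmN, pd_const_mul, pd_cexp p (differentiable_rightPhase hbar lam)]
  ring

/-- The contribution of the boundary terms to the sums over the main diagonal. -/
def rightExtra (N m : ℕ) (hbar : ℝ) (lam : ℕ → ℝ) (z : gz N → ℂ) (d R : ℕ) : ℂ :=
  if d = 0 then -∑ r ∈ Finset.Icc (m + 1) R, mu N lam r +
    1 / (hbar : ℂ) * (if m ≤ R then Complex.exp (-coord z (m, m)) else 0) else 0

theorem sum_pd_rightPhase (hm : 1 ≤ m) (hbar : ℝ) (lam : ℕ → ℝ) (z : gz N → ℂ)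
    (d R : ℕ) (hRN : d + R < N) :
    ∑ k ∈ Finset.Icc 1 R, pd (d + k, k) (rightPhase N m hbar lam) z =
      1 / (hbar : ℂ) * rightTerm N m z (d + R) R + rightExtra N m hbar lam z d R := by
  induction R with
  | zero =>
    have h1 : rightTerm N m z (d + 0) 0 = 0 := if_neg (by rw [mem_rightVerts]; simp)
    have h2 : ¬ m ≤ 0 := by omega
    rw [h1, rightExtra, if_neg h2]
    simp
  | succ R ih =>
    rw [Finset.sum_Icc_succ_top (by omega), ih (by omega),
      pd_rightPhase hbar lam (by rw [mem_gz]; simp only; omega)]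
    simp only [rightExtra, Nat.add_sub_cancel, show d + (R + 1) - 1 = d + R by omega]
    by_cases h1 : d = 0
    · simp only [h1, if_true, zero_add, true_and, and_self]
      by_cases h2 : m < R + 1
      · rw [Finset.sum_Icc_succ_top (by omega)]
        have h3 : m ≤ R := by omega
        have h4 : m ≤ R + 1 := by omega
        have h5 : R + 1 ≠ m := by omega
        simp only [h2, h3, h4, h5, if_true, if_false]
        ring
      · rw [Finset.Icc_eq_empty (by omega), Finset.Icc_eq_empty (by omega)]
        have h3 : ¬ m ≤ R := by omega
        by_cases h4 : m ≤ R + 1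
        · have h5 : R + 1 = m := by omega
          simp only [h3, if_true, if_false, h5, lt_irrefl, le_refl]
          ring
        · have h5 : R + 1 ≠ m := by omega
          simp only [h2, h3, h4, h5, if_false]
          ring
    · have h2 : d + (R + 1) ≠ R + 1 := by omega
      have h3 : ¬ (d + (R + 1) = m ∧ R + 1 = m) := by omega
      simp only [h1, h2, h3, if_false, false_and]
      ring

theorem Eup_eq {i d : ℕ} (hid : i + d + 1 = N) (f : Fn N) (z : gz N → ℂ) :
    Eup i f z = -∑ n ∈ Finset.Icc 1 i,
      Complex.exp (coord z (d + n, n) - coord z (d + n + 1, n)) *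
        (∑ k ∈ Finset.Icc 1 n, pd (d + k, k) f z -
          ∑ k ∈ Finset.Icc 1 (n - 1), pd (d + 1 + k, k) f z) := by
  rw [Eup]
  congr 1
  refine Finset.sum_congr rfl fun n hn => ?_
  have hn' := Finset.mem_Icc.1 hn
  rw [show N - 1 - i = d by omega, show N - i + n = d + n + 1 by omega, Finset.sum_sub_distrib]
  congr 2
  have h1 : ∑ k ∈ Finset.Icc 1 n, pd (d + k, k - 1) f z =
      ∑ k ∈ Finset.Icc 2 n, pd (d + k, k - 1) f z := by
    symm
    refine Finset.sum_subset (Finset.Icc_subset_Icc_left (by omega)) fun k h2 h3 => ?_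
    refine pd_of_notMem ?_ f z
    simp only [Finset.mem_Icc] at h2 h3
    rw [mem_gz]
    simp only
    omega
  rw [h1]
  refine Finset.sum_bij' (fun k _ => k - 1) (fun k _ => k + 1) ?_ ?_ ?_ ?_ ?_
  · simp; omega
  · simp; omega
  · simp; omega
  · simp
  · intro k hk
    have hk' := Finset.mem_Icc.1 hk
    rw [show d + 1 + (k - 1) = d + k by omega]

theorem Eup_psiR (hm : 1 ≤ m) (hmN : m < N) (hbar : ℝ) (lam : ℕ → ℝ) {i d : ℕ} (hi : 1 ≤ i)
    (hid : i + d + 1 = N) (z : gz N → ℂ) : Eup i (psiR N m hbar lam) z =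
      (-∑ n ∈ Finset.Icc 1 i, Complex.exp (coord z (d + n, n) - coord z (d + n + 1, n)) *
        rightExtra N m hbar lam z d n + if i < m then -(hbar : ℂ)⁻¹ else 0) *
        psiR N m hbar lam z := by
  rw [Eup_eq hid]
  set T : ℕ → ℂ := fun n => if 1 ≤ n ∧ n < m ∧ d + n < N then
    Complex.exp (coord z (d + n + 1, n + 1) - coord z (d + n + 1, n)) else 0 with hT
  have h1 : ∀ n ∈ Finset.Icc 1 i, Complex.exp (coord z (d + n, n) - coord z (d + n + 1, n)) *
        (∑ k ∈ Finset.Icc 1 n, pd (d + k, k) (psiR N m hbar lam) z -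
          ∑ k ∈ Finset.Icc 1 (n - 1), pd (d + 1 + k, k) (psiR N m hbar lam) z) =
      (Complex.exp (coord z (d + n, n) - coord z (d + n + 1, n)) * rightExtra N m hbar lam z d n +
        (hbar : ℂ)⁻¹ * (T n - T (n - 1))) * psiR N m hbar lam z := by
    intro n hn
    have hn' := Finset.mem_Icc.1 hn
    simp_rw [pd_psiR hmN, ← Finset.mul_sum]
    rw [sum_pd_rightPhase hm hbar lam z d n (by omega),
      sum_pd_rightPhase hm hbar lam z (d + 1) (n - 1) (by omega)]
    have h2 : rightExtra N m hbar lam z (d + 1) (n - 1) = 0 := if_neg (by omega)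
    have h3 : Complex.exp (coord z (d + n, n) - coord z (d + n + 1, n)) *
        rightTerm N m z (d + n) n = T n := by
      simp only [rightTerm, hT, mem_rightVerts, mul_ite, mul_zero, ← Complex.exp_add]
      refine if_congr (by omega) ?_ rfl
      congr 1
      ring
    have h4 : Complex.exp (coord z (d + n, n) - coord z (d + n + 1, n)) *
        rightTerm N m z (d + 1 + (n - 1)) (n - 1) = T (n - 1) := by
      simp only [rightTerm, hT, mem_rightVerts, mul_ite, mul_zero, ← Complex.exp_add,
        show n - 1 + 1 = n by omega, show d + 1 + (n - 1) = d + n by omega,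
        show d + (n - 1) + 1 = d + n by omega]
      refine if_congr (by omega) ?_ rfl
      congr 1
      ring
    rw [h2, ← h3, ← h4]
    ring
  rw [Finset.sum_congr rfl h1, ← Finset.sum_mul, Finset.sum_add_distrib, ← Finset.mul_sum,
    sum_Icc_sub_pred T le_rfl (by omega)]
  have h5 : T (1 - 1) = 0 := by simp [hT]
  have h6 : T i = if i < m then 1 else 0 := by
    simp only [hT, show d + i + 1 = N by omega, coord_top, sub_zero, Complex.exp_zero]
    exact if_congr (by omega) rfl rfl
  rw [h5, h6]
  split_ifs <;> ring

theorem Eup_psiR_of_add_two_le (hm : 1 ≤ m) (hmN : m < N) (hbar : ℝ) (lam : ℕ → ℝ) {i : ℕ}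
    (hi : 1 ≤ i) (hiN : i + 2 ≤ N) : Eup i (psiR N m hbar lam) =
      (if i < m then -(hbar : ℂ)⁻¹ else 0) • psiR N m hbar lam := by
  funext z
  rw [Eup_psiR hm hmN hbar lam (d := N - 1 - i) hi (by omega), Finset.sum_eq_zero, neg_zero,
    zero_add, Pi.smul_apply, smul_eq_mul]
  intro R _
  rw [rightExtra, if_neg (by omega), mul_zero]

theorem Ediag_psiR (hm : 1 ≤ m) (hmN : m < N) (hbar : ℝ) (lam : ℕ → ℝ) {j : ℕ} (hj : m < j)
    (hjN : j < N) (z : gz N → ℂ) : Ediag lam j (psiR N m hbar lam) z = 0 := by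
  rw [Ediag]
  simp_rw [pd_psiR hmN, ← Finset.mul_sum]
  have h1 := sum_pd_rightPhase hm hbar lam z (N - j) (j - 1) (by omega)
  have h2 : rightTerm N m z (N - j + (j - 1)) (j - 1) = 0 :=
    if_neg (by rw [mem_rightVerts]; simp only; omega)
  have h3 : rightExtra N m hbar lam z (N - j) (j - 1) = 0 := if_neg (by omega)
  have h4 : ∑ k ∈ Finset.Icc 1 (j - 1), pd (N + k - j, k) (rightPhase N m hbar lam) z =
      ∑ k ∈ Finset.Icc 1 (j - 1), pd (N - j + k, k) (rightPhase N m hbar lam) z := by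
    refine Finset.sum_congr rfl fun k _ => ?_
    rw [show N + k - j = N - j + k by omega]
  have h5 : ∑ k ∈ Finset.Icc j (N - 1), pd (k, j) (rightPhase N m hbar lam) z = -mu N lam j := by
    have h6 : ∀ k ∈ Finset.Icc j (N - 1), pd (k, j) (rightPhase N m hbar lam) z =
        if k = j then -mu N lam j else 0 := by
      intro k hk
      have hk' := Finset.mem_Icc.1 hk
      rw [pd_rightPhase hbar lam (by rw [mem_gz]; simp only; omega)]
      have e1 : rightTerm N m z (k - 1) (j - 1) = 0 :=
        if_neg (by rw [mem_rightVerts]; simp only; omega)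
      have e2 : rightTerm N m z k j = 0 := if_neg (by rw [mem_rightVerts]; simp only; omega)
      rw [e1, e2, if_neg (by omega : ¬ (k = m ∧ j = m))]
      by_cases h7 : k = j
      · subst h7
        rw [if_pos ⟨rfl, hj⟩, if_pos rfl]
        ring
      · rw [if_neg fun h => h7 h.1, if_neg h7]
        ring
    rw [Finset.sum_congr rfl h6, Finset.sum_ite_eq', if_pos (by simp; omega)]
  rw [h4, h1, h2, h3, h5]
  ring

/-! ### The equations of the right Whittaker vector -/

theorem Eup_mul {i d : ℕ} (hid : i + d + 1 = N) {g f : Fn N} (hg : Differentiable ℂ g)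
    (hf : Differentiable ℂ f) (z : gz N → ℂ) :
    Eup i (fun z => g z * f z) z = g z * Eup i f z +
      (-∑ n ∈ Finset.Icc 1 i, Complex.exp (coord z (d + n, n) - coord z (d + n + 1, n)) *
        (∑ k ∈ Finset.Icc 1 n, pd (d + k, k) g z -
          ∑ k ∈ Finset.Icc 1 (n - 1), pd (d + 1 + k, k) g z)) * f z := by
  rw [Eup_eq hid, Eup_eq hid, mul_neg, neg_mul, ← neg_add, Finset.mul_sum, Finset.sum_mul,
    ← Finset.sum_add_distrib]
  congr 1
  refine Finset.sum_congr rfl fun R _ => ?_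
  simp_rw [pd_mul _ hg hf, Finset.sum_add_distrib, ← Finset.mul_sum]
  ring

/-- The vertices on the diagonals below the `d`-th one. -/
def diagsAfter (d : ℕ) : Set (ℕ × ℕ) := {p | p.2 + d < p.1}

/-- The function that arises from the right Whittaker vector by the operators
`E_{N-d-1,N-d}, …, E_{N-1,N}`. -/
def diagSum (N m d : ℕ) (U : ℕ → Fn N) : Fn N := fun z =>
  ∑ n ∈ Finset.Icc m (N - 1 - d), Complex.exp (-coord z (d + 1 + n, n)) * U n z

theorem differentiable_diagSum {d : ℕ} {U : ℕ → Fn N} (hU : ∀ n, NoDep (diagsAfter d) (U n)) :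
    Differentiable ℂ (diagSum N m d U) :=
  Differentiable.fun_sum fun n _ => (differentiable_coord (d + 1 + n, n)).fun_neg.cexp.fun_mul (hU n).1

theorem sum_pd_diagSum (hm : 1 ≤ m) {d c : ℕ} {U : ℕ → Fn N}
    (hU : ∀ n, NoDep (diagsAfter d) (U n)) (hcd : d < c) (z : gz N → ℂ) {R : ℕ}
    (hR : c + R < N) :
    ∑ k ∈ Finset.Icc 1 R, pd (c + k, k) (diagSum N m d U) z =
    if c = d + 1 then -∑ k ∈ Finset.Icc m R, Complex.exp (-coord z (d + 1 + k, k)) * U k z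
    else 0 := by
  have h1 : ∀ k ∈ Finset.Icc 1 R, pd (c + k, k) (diagSum N m d U) z =
      if c = d + 1 ∧ m ≤ k then -(Complex.exp (-coord z (d + 1 + k, k)) * U k z) else 0 := by
    intro k hk
    have hk' := Finset.mem_Icc.1 hk
    have hp : (c + k, k) ∈ gz N := by rw [mem_gz]; simp only; omega
    have h2 : ∀ n, pd (c + k, k)
        (fun z : gz N → ℂ => Complex.exp (-coord z (d + 1 + n, n)) * U n z) z =
        if k = n then
          if c = d + 1 then -(Complex.exp (-coord z (d + 1 + k, k)) * U k z) else 0 else 0 := by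
      intro n
      have h3 : pd (c + k, k) (fun z : gz N → ℂ => -coord z (d + 1 + n, n)) z =
          -(if (c + k, k) = (d + 1 + n, n) then 1 else 0) := by
        have := pd_const_mul (c + k, k) (-1) (fun z : gz N → ℂ => coord z (d + 1 + n, n)) z
        simp only [neg_one_mul, pd_coord hp] at this
        exact this
      rw [pd_mul _ (differentiable_coord (d + 1 + n, n)).fun_neg.cexp (hU n).1,
        (hU n).2 (c + k, k) (show k + d < c + k by omega),
        pd_cexp _ (differentiable_coord (d + 1 + n, n)).fun_neg, h3]
      simp only [Prod.mk.injEq, mul_zero, zero_add]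
      by_cases h4 : k = n
      · subst h4
        by_cases h5 : c = d + 1
        · simp [h5]; ring
        · simp [h5]
      · simp [h4]
    unfold diagSum
    rw [pd_sum _ _ fun n _ => (differentiable_coord (d + 1 + n, n)).fun_neg.cexp.fun_mul (hU n).1]
    simp_rw [h2]
    rw [Finset.sum_ite_eq]
    simp only [Finset.mem_Icc]
    by_cases h3 : c = d + 1
    · simp only [h3, if_true, true_and]
      exact if_congr (by omega) rfl rfl
    · simp [h3]
  rw [Finset.sum_congr rfl h1]
  split_ifs with h2
  · simp only [h2, true_and]
    rw [← Finset.sum_filter, ← Finset.sum_neg_distrib]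
    refine Finset.sum_congr ?_ fun _ _ => rfl
    ext r
    simp only [Finset.mem_filter, Finset.mem_Icc]
    omega
  · simp [h2]

/-- The result of applying `E_{N-j,N-j+1} ⋯ E_{N-1,N}`. -/
def upChain (f : Fn N) : ℕ → Fn N
  | 0 => f
  | j + 1 => Eup (N - 1 - j) (upChain f j)

theorem upChain_psiR (hm : 1 ≤ m) (hmN : m < N) (hbar : ℝ) (lam : ℕ → ℝ) : ∀ d, m + d < N →
    ∃ U : ℕ → Fn N, (∀ n, NoDep (diagsAfter d) (U n)) ∧ (∀ z, U m z = -(hbar : ℂ)⁻¹) ∧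
      upChain (psiR N m hbar lam) (d + 1) = fun z => diagSum N m d U z * psiR N m hbar lam z := by
  intro d
  induction d with
  | zero =>
    intro _
    refine ⟨fun R z => Complex.exp (coord z (R, R)) *
      (∑ r ∈ Finset.Icc (m + 1) R, mu N lam r +
        -(hbar : ℂ)⁻¹ * Complex.exp (-coord z (m, m))), fun n => ?_, fun z => ?_, ?_⟩
    · have h1 : ∀ r, (r, r) ∉ diagsAfter 0 := fun r => by simp [diagsAfter]
      exact (noDep_coord (h1 n)).cexp.mul ((noDep_const _ _).add
        ((noDep_const _ _).mul (noDep_coord (h1 _)).neg.cexp))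
    · simp only
      rw [Finset.Icc_eq_empty (by omega), Finset.sum_empty, zero_add, mul_left_comm,
        ← Complex.exp_add]
      simp
    · funext z
      rw [upChain, upChain, Eup_psiR hm hmN hbar lam (d := 0) (by omega) (by omega),
        if_neg (by omega), add_zero]
      congr 1
      rw [← Finset.sum_neg_distrib]
      symm
      refine (Finset.sum_congr rfl fun R hR => ?_).trans
        (Finset.sum_subset (Finset.Icc_subset_Icc_left hm) ?_)
      · have hR' := Finset.mem_Icc.1 hR
        rw [rightExtra, if_pos rfl, if_pos (by omega), ← mul_assoc, ← Complex.exp_add]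
        simp only [zero_add]
        rw [show 1 + R = R + 1 by omega]
        ring_nf
      · intro R h2 h3
        simp only [Finset.mem_Icc] at h2 h3
        rw [rightExtra, if_pos rfl, if_neg (by omega), Finset.Icc_eq_empty (by omega)]
        simp
  | succ d ih =>
    intro hd
    obtain ⟨U, hU1, hU2, hU3⟩ := ih (by omega)
    refine ⟨fun R z => ∑ r ∈ Finset.Icc m R,
      Complex.exp (coord z (d + 1 + R, R) - coord z (d + 1 + r, r)) * U r z,
      fun n => ?_, fun z => ?_, ?_⟩
    · refine noDep_sum _ fun r _ => (noDep_exp_sub ?_ ?_).mul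
        ((hU1 _).mono fun p hp => lt_trans (Nat.lt_succ_self (p.2 + d)) hp) <;> simp [diagsAfter] <;> omega
    · simp only
      rw [Finset.Icc_self, Finset.sum_singleton, sub_self, Complex.exp_zero, one_mul, hU2]
    · have h1 : Eup (N - 1 - (d + 1)) (psiR N m hbar lam) = 0 := by
        rw [Eup_psiR_of_add_two_le hm hmN hbar lam (by omega) (by omega), if_neg (by omega),
          zero_smul]
      funext z
      rw [upChain, hU3, Eup_mul (d := d + 1) (by omega) (differentiable_diagSum hU1)
          ((contDiff_psiR hbar lam (n := 1)).differentiable (by simp)), h1]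
      simp only [Pi.zero_apply, mul_zero, zero_add]
      congr 1
      rw [← Finset.sum_neg_distrib]
      symm
      refine (Finset.sum_subset (Finset.Icc_subset_Icc_left hm) ?_).trans
        (Finset.sum_congr rfl fun R hR => ?_)
      · intro R h2 h3
        simp only [Finset.mem_Icc] at h2 h3
        simp only
        rw [Finset.Icc_eq_empty (by omega), Finset.sum_empty, mul_zero]
      · have hR' := Finset.mem_Icc.1 hR
        rw [sum_pd_diagSum hm hU1 (by omega) z (by omega),
          sum_pd_diagSum hm hU1 (by omega) z (by omega), if_pos rfl, if_neg (by omega), sub_zero,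
          mul_neg, neg_neg, Finset.mul_sum, Finset.mul_sum]
        refine Finset.sum_congr rfl fun r _ => ?_
        rw [← mul_assoc, ← mul_assoc, ← Complex.exp_add, ← Complex.exp_add]
        rw [show d + 1 + 1 + R = d + 1 + R + 1 by omega]
        congr 2
        ring

theorem Eup_upChain_psiR (hm : 1 ≤ m) (hmN : m < N) (hbar : ℝ) (lam : ℕ → ℝ) {i j : ℕ}
    (hi : m ≤ i) (hij : i + j + 2 ≤ N) : Eup i (upChain (psiR N m hbar lam) j) = 0 := by
  have h1 : Eup i (psiR N m hbar lam) = 0 := by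
    rw [Eup_psiR_of_add_two_le hm hmN hbar lam (by omega) (by omega), if_neg (by omega), zero_smul]
  rcases j with _ | d
  · exact h1
  · obtain ⟨U, hU1, -, hU3⟩ := upChain_psiR hm hmN hbar lam d (by omega)
    funext z
    rw [hU3, Eup_mul (d := N - 1 - i) (by omega) (differentiable_diagSum hU1)
          ((contDiff_psiR hbar lam (n := 1)).differentiable (by simp)), h1, Finset.sum_eq_zero]
    · simp
    · intro n hn
      have hn' := Finset.mem_Icc.1 hn
      rw [sum_pd_diagSum hm hU1 (by omega) z (by omega),
        sum_pd_diagSum hm hU1 (by omega) z (by omega), if_neg (by omega), if_neg (by omega),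
        sub_zero, mul_zero]

theorem Eupper_upChain_psiR (hm : 1 ≤ m) (hmN : m < N) (hbar : ℝ) (lam : ℕ → ℝ) (e : ℕ) :
    ∀ j, m + j + e + 1 = N → Eupper m e (upChain (psiR N m hbar lam) j) =
      upChain (psiR N m hbar lam) (N - m) := by
  induction e with
  | zero =>
    intro j hj
    rw [Eupper, show N - m = j + 1 by omega, upChain, show N - 1 - j = m by omega]
  | succ e ih =>
    intro j hj
    have h1 : Eupper m e (upChain (psiR N m hbar lam) j) = 0 := by
      rw [Eupper_eigen (c := fun _ => 0) fun k h1 h2 => by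
        rw [Eup_upChain_psiR hm hmN hbar lam h1 (by omega), zero_smul]]
      simp
    funext z
    have h2 : Eup (m + e + 1) (upChain (psiR N m hbar lam) j) =
        upChain (psiR N m hbar lam) (j + 1) := by
      rw [upChain, show N - 1 - j = m + e + 1 by omega]
    rw [Eupper, comm, h1, (isHomogeneous_Eup _).map_zero, h2, ih (j + 1) (by omega)]
    simp

theorem isRightWhittaker_psiR (hm : 1 ≤ m) (hmN : m < N) {hbar : ℝ} (hh : 0 < hbar) {lam : ℕ → ℝ}
    (hlam : ∀ j : ℕ, N + 3 ≤ 2 * j → j ≤ N → lam j ≠ 0) :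
    IsRightWhittaker m hbar lam (psiR N m hbar lam) where
  entire := (contDiff_psiR hbar lam (n := 1)).differentiable (by simp)
  ne_zero := by
    intro h
    have h1 := congrFun h 0
    rw [psiR_eq hmN] at h1
    simp [normC_ne_zero hh hlam] at h1
  simple := by
    intro i hi z
    have hi' := Finset.mem_Icc.1 hi
    rw [E, if_neg (by omega), if_pos (by omega), show i - (i - 1) - 1 = 0 by omega, Eupper,
      Eup_psiR_of_add_two_le hm hmN hbar lam (by omega) (by omega), if_pos (by omega),
      Pi.smul_apply, smul_eq_mul]
  annihilated := by
    intro j hj k hk z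
    have hj' := Finset.mem_Icc.1 hj
    have hk' := Finset.mem_Icc.1 hk
    rw [E]
    split_ifs with h1 h2
    · rw [h1]
      exact Ediag_psiR hm hmN hbar lam (by omega) (by omega) z
    · rw [Eupper_eigen (c := fun i => if i < m then -(hbar : ℂ)⁻¹ else 0)
        fun i h3 h4 => Eup_psiR_of_add_two_le hm hmN hbar lam (by omega) (by omega)]
      have h5 : (if j - k - 1 = 0 then (if k < m then -(hbar : ℂ)⁻¹ else 0) else 0) = 0 := by
        split_ifs
        · omega
        · rfl
        · rfl
      simp only [h5, zero_smul, Pi.zero_apply]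
    · omega
  corner := by
    intro z
    obtain ⟨U, -, h2, h3⟩ := upChain_psiR hm hmN hbar lam (N - m - 1) (by omega)
    have h4 := Eupper_upChain_psiR hm hmN hbar lam (N - m - 1) 0 (by omega)
    rw [upChain] at h4
    rw [E, if_neg (by omega), if_pos hmN, h4, show N - m = N - m - 1 + 1 by omega, h3]
    simp only [diagSum]
    rw [show N - 1 - (N - m - 1) = m by omega, Finset.Icc_self, Finset.sum_singleton,
      show N - m - 1 + 1 + m = N by omega, coord_top, neg_zero, Complex.exp_zero, one_mul, h2]

end Right

end

end GrWhittaker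

theorem theorem1p1 (N m : ℕ) (hm : 1 ≤ m) (hmN : m < N) (hbar : ℝ) (hhbar : 0 < hbar)
    (lam : ℕ → ℝ) (hlam : ∀ j : ℕ, N + 3 ≤ 2 * j → j ≤ N → lam j ≠ 0) :
    GrWhittaker.IsLeftWhittaker m hbar lam (GrWhittaker.psiL N m hbar lam) ∧
    GrWhittaker.IsRightWhittaker m hbar lam (GrWhittaker.psiR N m hbar lam) ∧
    ∀ x : ℝ,
      (∀ z, Summable
        (GrWhittaker.expTerm (GrWhittaker.logG m lam (Pi.single 1 x))
          (GrWhittaker.psiR N m hbar lam) z)) ∧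
      (∃ η, GrWhittaker.IsPairingContour N m hbar lam (Pi.single 1 x) η) ∧
      GrWhittaker.IsPhaseContour N m hbar lam x (fun _ => 0) ∧
      ∀ η η', GrWhittaker.IsPairingContour N m hbar lam (Pi.single 1 x) η →
        GrWhittaker.IsPhaseContour N m hbar lam x η' →
        MeasureTheory.Integrable (GrWhittaker.contourIntegrand η
          (GrWhittaker.psiIntegrand N m hbar lam (Pi.single 1 x))) ∧
        MeasureTheory.Integrable (GrWhittaker.contourIntegrand η'
          (fun z => Complex.exp (GrWhittaker.phase N m hbar lam x z))) ∧
        GrWhittaker.Psi N m hbar lam η (Pi.single 1 x) =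
          GrWhittaker.contourIntegral η'
            (fun z => Complex.exp (GrWhittaker.phase N m hbar lam x z)) := by
  refine ⟨GrWhittaker.isLeftWhittaker_psiL hm hmN hhbar hlam,
    GrWhittaker.isRightWhittaker_psiR hm hmN hhbar hlam, fun x => ⟨fun z => ?_, ?_, ?_, fun η η' h h' => ⟨?_, ?_, ?_⟩⟩⟩
  · exact (GrWhittaker.hasSum_expTerm hm hmN lam x
      (GrWhittaker.contDiff_psiR hbar lam) z).summable
  · exact GrWhittaker.exists_isPairingContour hm hmN hhbar hlam x
  · exact GrWhittaker.isPhaseContour_zero hm hmN hhbar lam x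
  · exact h.integrable hm hmN
  · exact h'.integrable hmN
  · rw [GrWhittaker.Psi_eq hm hmN hhbar hlam h, h'.contourIntegral_eq hhbar hm hmN]
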